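/- Let $s_0>0$, $r\ge 0$, $\sigma>0$, $T>0$, and let $K$ and $L$ satisfy $0<L<s_0$ and $L<K$. Let $S_t=s_0e^{(r-\sigma^2/2)t+\sigma B_t}$ be the Black--Scholes asset price, where $B$ is a standard Brownian motion, and let $S_{\inf}=\inf_{0\le t\le T}S_t$. The Black--Scholes prices of the European down-and-in and down-and-out digital calls with strike $K$ and lower barrier $L$ are $$\mathrm{price}^{di}_{BS}=e^{-rT}\,\mathbb E\big[\mathbf 1_{S_T\ge K}\mathbf 1_{S_{\inf}\le L}\big],\qquad \mathrm{price}^{do}_{BS}=e^{-rT}\,\mathbb E\big[\mathbf 1_{S_T\ge K}\mathbf 1_{S_{\inf}>L}\big].$$ For $n\ge1$ put $\Delta\tau=T/n$, $u=e^{\sigma\sqrt{\Delta\tau}}=d^{-1}$ and $p=\frac{e^{r\Delta\tau}-d}{u-d}$. In the $n$-step CRR tree the asset starts at $S^n_0=s_0$ and at each step is multiplied, independently, by $u$ with probability $p$ or by $d$ with probability $1-p$; $S^n_i$ is its value after $i$ steps. (The number $p$ lies in $(0,1)$ for all large $n$; for the remaining $n$ the expectations below are read as the corresponding weighted sums over paths.)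 The CRR prices are $$\mathrm{price}^{di}_{CRR}(n)=e^{-rT}\,\mathbb E\big[\mathbf 1_{S^n_n\ge K}\mathbf 1_{\min_{i\le n}S^n_i\le L}\big],\qquad \mathrm{price}^{do}_{CRR}(n)=e^{-rT}\,\mathbb E\big[\mathbf 1_{S^n_n\ge K}\mathbf 1_{\min_{i\le n}S^n_i> L}\big].$$ Write $\mathrm{frac}(x)=x-\lfloor x\rfloor$ and $$\Delta^K_n=1-2\,\mathrm{frac}\Big(\frac{\log(s_0/K)}{2\sigma\sqrt{\Delta\tau}}-\frac n2\Big),\qquad \Delta^L_n=\mathrm{frac}(2l_L),\quad l_L=\frac{\log(L/s_0)}{2\sigma\sqrt{\Delta\tau}}+\frac n2 .$$ Let $\Phi$ be the standard normal distribution function, $\varphi(x)=\frac{1}{\sqrt{2\pi}}e^{-x^2/2}$, $R=(s_0/L)^{1-2r/\sigma^2}$, and $$d_{11}=\frac{\log\frac{s_0}{K}+(r+\frac12\sigma^2)T}{\sigma\sqrt T},\quad d_{12}=d_{11}-\sigma\sqrt T,\quad d_{21}=\frac{\log\frac{L^2}{s_0K}+(r+\frac12\sigma^2)T}{\sigma\sqrt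 T},\quad d_{22}=d_{21}-\sigma\sqrt T,$$ $$\alpha=\frac{r-\frac12\sigma^2}{2\sigma},\quad \beta=\frac{\sigma^4-4\sigma^2r+12r^2}{48\sigma},\quad I=\frac{4\beta+\frac{16}{3}\alpha^3}{\sigma}\,T\log\frac{s_0}{L},$$ $$g_2=2T(\alpha^2d_{22}+\beta\sqrt T)+\Big(\frac{2\alpha\sqrt T}{3}-\frac{d_{22}}{12}\Big)(1-d_{22}^2),$$ $$\tilde A_1=R\,\varphi(d_{22}),\qquad \tilde A_2=-2\tilde A_1-4\alpha\sqrt T\,\Phi(d_{22})R,$$ $$\tilde B_1=R\,[g_2\varphi(d_{22})-I\,\Phi(d_{22})],\qquad \tilde B_2=-\tfrac{d_{22}}{2}R\,\varphi(d_{22}),\qquad \tilde B_3=R\,\varphi(d_{22})[2d_{22}-4\alpha\sqrt T],$$ $$\tilde B_4=R\,[\varphi(d_{22})(-2d_{22}+8\alpha\sqrt T)+8\alpha^2T\,\Phi(d_{22})],$$ $$c_1=\varphi(d_{12}),\qquad c_2=-\tfrac{d_{12}}{2}\varphi(d_{12}),\qquad c_3=\tilde c\,\varphi(d_{12}),$$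 $$\tilde c=\frac{d_{11}^3+d_{11}d_{12}^2+2d_{12}-4d_{11}}{24}+\frac{(2-d_{11}d_{12}-d_{11}^2)\sqrt T}{6\sigma}r+\frac{Td_{11}}{2\sigma^2}r^2,$$ $$\tilde C_1=c_1-\tilde A_1,\quad \tilde C_2=-\tilde A_2,\quad \tilde D_1=c_3-\tilde B_1,\quad \tilde D_2=c_2-\tilde B_2,\quad \tilde D_3=-\tilde B_3,\quad \tilde D_4=-\tilde B_4 .$$ Then, as $n\to\infty$ with all other parameters fixed, $$\mathrm{price}^{di}_{CRR}(n)-\mathrm{price}^{di}_{BS}=e^{-rT}\Big[\frac{\tilde A_1\Delta^K_n+\tilde A_2\Delta^L_n}{\sqrt n}+\frac{\tilde B_1+\tilde B_2(\Delta^K_n)^2+\tilde B_3\Delta^K_n\Delta^L_n+\tilde B_4(\Delta^L_n)^2}{n}\Big]+O\big(n^{-3/2}\big),$$ $$\mathrm{price}^{do}_{CRR}(n)-\mathrm{price}^{do}_{BS}=e^{-rT}\Big[\frac{\tilde C_1\Delta^K_n+\tilde C_2\Delta^L_n}{\sqrt n}+\frac{\tilde D_1+\tilde D_2(\Delta^K_n)^2+\tilde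 D_3\Delta^K_n\Delta^L_n+\tilde D_4(\Delta^L_n)^2}{n}\Big]+O\big(n^{-3/2}\big).$$ -/

import Mathlib

open MeasureTheory ProbabilityTheory Filter Asymptotics
open scoped NNReal

noncomputable section

namespace DigitalBarrier

/-- The data of the market and of the contract: spot `s₀`, strike `K`, lower barrier `L`, interest
rate `r`, volatility `σ`, maturity `T`. -/
structure Params where
  s₀ : ℝ
  K : ℝ
  L : ℝ
  r : ℝ
  σ : ℝ
  T : ℝ

namespace Params

variable (m : Params)

/-! ### The Black-Scholes model -/

section BlackScholes

variable {Ω : Type*}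

/-- Geometric Brownian motion `S_t = s₀ exp((r - σ²/2) t + σ B_t)`, the solution of
`dS_t = S_t (r dt + σ dB_t)`, `S_0 = s₀`. -/
def stock (B : ℝ≥0 → Ω → ℝ) (t : ℝ≥0) (ω : Ω) : ℝ :=
  m.s₀ * Real.exp ((m.r - m.σ ^ 2 / 2) * t + m.σ * B t ω)

/-- `S_inf`, the infimum of `S_t` over `0 ≤ t ≤ T`. -/
def stockInf (B : ℝ≥0 → Ω → ℝ) (ω : Ω) : ℝ :=
  sInf ((fun t : ℝ≥0 => m.stock B t ω) '' Set.Icc 0 m.T.toNNReal)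

/-- Payoff of the down-and-in digital call. -/
def payoffDI (B : ℝ≥0 → Ω → ℝ) : Ω → ℝ :=
  Set.indicator {ω | m.K ≤ m.stock B m.T.toNNReal ω ∧ m.stockInf B ω ≤ m.L} 1

/-- Payoff of the down-and-out digital call. -/
def payoffDO (B : ℝ≥0 → Ω → ℝ) : Ω → ℝ :=
  Set.indicator {ω | m.K ≤ m.stock B m.T.toNNReal ω ∧ m.L < m.stockInf B ω} 1

/-- Black-Scholes price of the down-and-in digital call. -/
def priceBSDI [MeasurableSpace Ω] (P : Measure Ω) (B : ℝ≥0 → Ω → ℝ) : ℝ :=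
  Real.exp (-m.r * m.T) * ∫ ω, m.payoffDI B ω ∂P

/-- Black-Scholes price of the down-and-out digital call. -/
def priceBSDO [MeasurableSpace Ω] (P : Measure Ω) (B : ℝ≥0 → Ω → ℝ) : ℝ :=
  Real.exp (-m.r * m.T) * ∫ ω, m.payoffDO B ω ∂P

end BlackScholes

/-! ### The `n`-step CRR tree -/

/-- The time step `T / n`. -/
def dt (n : ℕ) : ℝ := m.T / n

/-- The up factor `u`; the down factor is `u⁻¹`. -/
def up (n : ℕ) : ℝ := Real.exp (m.σ * √(m.dt n))

/-- The risk-neutral probability of an up move. -/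
def upProb (n : ℕ) : ℝ :=
  (Real.exp (m.r * m.dt n) - (m.up n)⁻¹) / (m.up n - (m.up n)⁻¹)

/-- The number of up moves among the first `i` moves of the path `w` (`true` is an up move). -/
def upCount {n : ℕ} (w : Fin n → Bool) (i : ℕ) : ℕ :=
  (Finset.univ.filter fun k : Fin n => (k : ℕ) < i ∧ w k = true).card

/-- The stock price after `i` moves along the path `w`. -/
def treeStock {n : ℕ} (w : Fin n → Bool) (i : ℕ) : ℝ :=
  m.s₀ * Real.exp ((2 * (upCount w i : ℝ) - i) * m.σ * √(m.dt n))

/-- The probability of the path `w`. -/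
def pathWeight {n : ℕ} (w : Fin n → Bool) : ℝ :=
  ∏ k, if w k then m.upProb n else 1 - m.upProb n

/-- CRR price of the down-and-in digital call. -/
def priceCRRDI (n : ℕ) : ℝ :=
  Real.exp (-m.r * m.T) * ∑ w : Fin n → Bool, m.pathWeight w *
    Set.indicator {w | m.K ≤ m.treeStock w n ∧ ∃ i ≤ n, m.treeStock w i ≤ m.L} 1 w

/-- CRR price of the down-and-out digital call. -/
def priceCRRDO (n : ℕ) : ℝ :=
  Real.exp (-m.r * m.T) * ∑ w : Fin n → Bool, m.pathWeight w *
    Set.indicator {w | m.K ≤ m.treeStock w n ∧ ∀ i ≤ n, m.L < m.treeStock w i} 1 w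

/-! ### Positions of strike and barrier relative to the nodes -/

/-- `Δ^K_n`. -/
def posK (n : ℕ) : ℝ :=
  1 - 2 * Int.fract (Real.log (m.s₀ / m.K) / (2 * m.σ * √(m.dt n)) - (n : ℝ) / 2)

/-- `l_L`. -/
def lL (n : ℕ) : ℝ := Real.log (m.L / m.s₀) / (2 * m.σ * √(m.dt n)) + (n : ℝ) / 2

/-- `Δ^L_n`. -/
def posL (n : ℕ) : ℝ := Int.fract (2 * m.lL n)

/-! ### The constants of the expansion -/

/-- Standard normal distribution function. -/
def Phi (x : ℝ) : ℝ := cdf (gaussianReal 0 1) x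

/-- Standard normal density. -/
def phi (x : ℝ) : ℝ := Real.exp (-x ^ 2 / 2) / √(2 * Real.pi)

def d11 : ℝ := (Real.log (m.s₀ / m.K) + (m.r + m.σ ^ 2 / 2) * m.T) / (m.σ * √m.T)

def d12 : ℝ := m.d11 - m.σ * √m.T

def d21 : ℝ :=
  (Real.log (m.L ^ 2 / (m.s₀ * m.K)) + (m.r + m.σ ^ 2 / 2) * m.T) / (m.σ * √m.T)

def d22 : ℝ := m.d21 - m.σ * √m.T

def alpha : ℝ := (m.r - m.σ ^ 2 / 2) / (2 * m.σ)

def beta : ℝ := (m.σ ^ 4 - 4 * m.σ ^ 2 * m.r + 12 * m.r ^ 2) / (48 * m.σ)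

def g2 : ℝ :=
  2 * m.T * (m.alpha ^ 2 * m.d22 + m.beta * √m.T)
    + (2 * m.alpha * √m.T / 3 - m.d22 / 12) * (1 - m.d22 ^ 2)

def I : ℝ :=
  (4 * m.beta + 16 / 3 * m.alpha ^ 3) / m.σ * Real.log (m.s₀ / m.L) * m.T

/-- The factor `(s₀ / L) ^ (1 - 2 r / σ²)`. -/
def rho : ℝ := (m.s₀ / m.L) ^ (1 - 2 * m.r / m.σ ^ 2)

def A1 : ℝ := m.rho * phi m.d22

def A2 : ℝ := -2 * m.A1 - 4 * m.alpha * √m.T * Phi m.d22 * m.rho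

def B1 : ℝ := m.rho * (m.g2 * phi m.d22 - m.I * Phi m.d22)

def B2 : ℝ := m.rho * (-m.d22 / 2) * phi m.d22

def B3 : ℝ := m.rho * phi m.d22 * (2 * m.d22 - 4 * m.alpha * √m.T)

def B4 : ℝ :=
  m.rho * (phi m.d22 * (-2 * m.d22 + 8 * m.alpha * √m.T)
    + 8 * m.alpha ^ 2 * m.T * Phi m.d22)

def c1 : ℝ := phi m.d12

def c2 : ℝ := -m.d12 / 2 * phi m.d12

def cTilde : ℝ :=
  (m.d11 ^ 3 + m.d11 * m.d12 ^ 2 + 2 * m.d12 - 4 * m.d11) / 24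
    + (2 - m.d11 * m.d12 - m.d11 ^ 2) * √m.T / (6 * m.σ) * m.r
    + m.T * m.d11 / (2 * m.σ ^ 2) * m.r ^ 2

def c3 : ℝ := m.cTilde * phi m.d12

def C1 : ℝ := m.c1 - m.A1

def C2 : ℝ := -m.A2

def D1 : ℝ := m.c3 - m.B1

def D2 : ℝ := m.c2 - m.B2

def D3 : ℝ := -m.B3

def D4 : ℝ := -m.B4

/-- The expansion of the error of the down-and-in price up to order `1 / n`. -/
def expansionDI (n : ℕ) : ℝ :=
  Real.exp (-m.r * m.T) *
    ((m.A1 * m.posK n + m.A2 * m.posL n) * (1 / √(n : ℝ))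
      + (m.B1 + m.B2 * m.posK n ^ 2 + m.B3 * m.posK n * m.posL n + m.B4 * m.posL n ^ 2)
        * (1 / (n : ℝ)))

/-- The expansion of the error of the down-and-out price up to order `1 / n`. -/
def expansionDO (n : ℕ) : ℝ :=
  Real.exp (-m.r * m.T) *
    ((m.C1 * m.posK n + m.C2 * m.posL n) * (1 / √(n : ℝ))
      + (m.D1 + m.D2 * m.posK n ^ 2 + m.D3 * m.posK n * m.posL n + m.D4 * m.posL n ^ 2)
        * (1 / (n : ℝ)))

end Params

end DigitalBarrier

end

noncomputable section
namespace DigitalBarrier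

/-! ### Biased simple random walks and the reflection principle -/

/-! Reflection, once in the tree and once in continuous time, reduces each down-and-in price to an
explicit weight times a single upper tail. In the tree, with the barrier `a` levels below the start
and `k` up moves needed to reach the strike, the price is the discount factor times `((1 - p) / p) ^
a` times the binomial tail from `k + a` (`hitSum_eq_pow_mul_tailSum`, `priceCRRDI_eq`). These
identities are algebraic in `p` and need only `p ≠ 0`. In the Black-Scholes model the corresponding
value is `rho * Phi d22` (`measure_drifted_hit`, `priceBSDI_eq`). Without the barrier the tails are
the binomial tail from `k` and `Phi d12`, so the down-and-out case follows by subtraction.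

It remains to expand the two tree factors. The binomial tail is a quotient of two integrals of one
beta kernel, so its normalization needs no asymptotics of factorials. On the scale `n^(-1/2)` the
kernel is a Gaussian times `1 + kernelCorr / n`, with an `O(n^(-2))` error of Gaussian decay. The
corrected Gaussian has an explicit antiderivative, which gives `binomTail_approx`. Into it go the
expansion of `√n (2p - 1)` and the exact positions of strike and barrier; rounding to the lattice
enters only through `posK` and `posL`. These oscillate with `n`, so `HasExpansion` allows bounded
sequences as coefficients. The weight is expanded through its logarithm, and the product of the two
expansions is the claim.

The continuous reflection formula is proved along finite time grids. At the first grid time below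
the barrier, the later increment is independent of the past, and changing its sign costs the density
factor `exp (-2 μ D)`. The overshoot below the barrier is at most `η` off an event whose measure
tends to `0` as the grid is refined, by continuity of paths. Letting the mesh and then `η` tend to
`0` gives the exact formula. -/

open Params in
lemma upCount_zero_right {n : ℕ} (w : Fin n → Bool) : upCount w 0 = 0 := by
  simp [upCount]

open Params in
lemma upCount_cons {n : ℕ} (c : Bool) (w : Fin n → Bool) (i : ℕ) :
    upCount (Fin.cons c w : Fin (n + 1) → Bool) (i + 1) = (if c then 1 else 0) + upCount w i := by
  unfold upCount
  rw [Finset.card_filter, Finset.card_filter, Fin.sum_univ_succ]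
  simp

/-- The position after `i` moves of the walk on `ℤ` started at `0` and driven by `w`. -/
def level {n : ℕ} (w : Fin n → Bool) (i : ℕ) : ℤ := 2 * (Params.upCount w i : ℤ) - i

lemma level_zero_right {n : ℕ} (w : Fin n → Bool) : level w 0 = 0 := by
  simp [level, upCount_zero_right]

lemma level_cons_true {n : ℕ} (w : Fin n → Bool) (i : ℕ) :
    level (Fin.cons true w : Fin (n + 1) → Bool) (i + 1) = 1 + level w i := by
  simp [level, upCount_cons]; ring

lemma level_cons_false {n : ℕ} (w : Fin n → Bool) (i : ℕ) :
    level (Fin.cons false w : Fin (n + 1) → Bool) (i + 1) = -1 + level w i := by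
  simp [level, upCount_cons]; ring

/-- The weight of the path `w` when up moves have weight `p` and down moves `1 - p`. -/
def walkWeight (p : ℝ) {n : ℕ} (w : Fin n → Bool) : ℝ := ∏ k, if w k then p else 1 - p

lemma sum_walkWeight_succ (p : ℝ) (n : ℕ) (f : (Fin (n + 1) → Bool) → ℝ) :
    ∑ w, walkWeight p w * f w = p * ∑ w : Fin n → Bool, walkWeight p w * f (Fin.cons true w)
      + (1 - p) * ∑ w : Fin n → Bool, walkWeight p w * f (Fin.cons false w) := by
  rw [← (Fin.consEquiv fun _ : Fin (n + 1) => Bool).sum_comp, Fintype.sum_prod_type,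
    Fintype.sum_bool, Finset.mul_sum, Finset.mul_sum]
  simp [Fin.consEquiv, walkWeight, Fin.prod_univ_succ, mul_assoc]

open Classical in
/-- The weight of the `n`-step paths from `y` that end at `k` or above. -/
def tailSum (p : ℝ) (n : ℕ) (y k : ℤ) : ℝ :=
  ∑ w : Fin n → Bool, walkWeight p w * if k ≤ y + level w n then 1 else 0

open Classical in
/-- The weight of the `n`-step paths from `y` that end at `k` or above and visit `(-∞, b]`. -/
def hitSum (p : ℝ) (n : ℕ) (y k b : ℤ) : ℝ :=
  ∑ w : Fin n → Bool, walkWeight p w *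
    if k ≤ y + level w n ∧ ∃ i ≤ n, y + level w i ≤ b then 1 else 0

lemma tailSum_succ (p : ℝ) (n : ℕ) (y k : ℤ) :
    tailSum p (n + 1) y k = p * tailSum p n (y + 1) k + (1 - p) * tailSum p n (y - 1) k := by
  simp only [tailSum]
  rw [sum_walkWeight_succ]
  simp only [level_cons_true, level_cons_false, add_assoc, sub_eq_add_neg]

lemma hitSum_of_le (p : ℝ) (n : ℕ) {y b : ℤ} (k : ℤ) (h : y ≤ b) :
    hitSum p n y k b = tailSum p n y k := by
  have : ∀ w : Fin n → Bool, ∃ i ≤ n, y + level w i ≤ b :=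
    fun w => ⟨0, Nat.zero_le _, by simpa [level_zero_right] using h⟩
  simp [hitSum, tailSum, this]

lemma exists_le_succ_iff {n : ℕ} {P : ℕ → Prop} (h : ¬ P 0) :
    (∃ i ≤ n + 1, P i) ↔ ∃ i ≤ n, P (i + 1) := by
  constructor
  · rintro ⟨_ | i, hi, hP⟩
    · exact absurd hP h
    · exact ⟨i, by omega, hP⟩
  · rintro ⟨i, hi, hP⟩
    exact ⟨i + 1, by omega, hP⟩

lemma hitSum_succ (p : ℝ) (n : ℕ) {y b : ℤ} (k : ℤ) (h : b < y) :
    hitSum p (n + 1) y k b = p * hitSum p n (y + 1) k b + (1 - p) * hitSum p n (y - 1) k b := by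
  simp only [hitSum]
  rw [sum_walkWeight_succ]
  have key : ∀ w : Fin (n + 1) → Bool, (∃ i ≤ n + 1, y + level w i ≤ b) ↔
      ∃ i ≤ n, y + level w (i + 1) ≤ b := fun w =>
    exists_le_succ_iff (P := fun i => y + level w i ≤ b)
      (by simp only [level_zero_right]; omega)
  simp only [key, level_cons_true, level_cons_false, add_assoc, sub_eq_add_neg]

/-- **Reflection principle** for biased simple random walks. -/
theorem hitSum_eq_pow_mul_tailSum {p : ℝ} (hp : p ≠ 0) {b k : ℤ} (hbk : b < k) (n d : ℕ) :
    hitSum p n (b + d) k b = ((1 - p) / p) ^ d * tailSum p n (b - d) k := by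
  -- As functions of the distance `d`, both sides obey the same one-step recursion and agree at `d =
  -- 0`. The recursion at `d + 1` calls `d` and `d + 2`, hence the generalization.
  induction n generalizing d with
  | zero =>
    rcases d with _ | d
    · simp [hitSum_of_le]
    · have h1 : ¬ (b + ((d + 1 : ℕ) : ℤ) ≤ b) := by push_cast; omega
      -- The place where `b < k` matters: the reflected start lies below the strike level.
      have h2 : ¬ (k ≤ b - ((d + 1 : ℕ) : ℤ)) := by push_cast; omega
      simp only [hitSum, tailSum, Nat.le_zero, exists_eq_left, level_zero_right, add_zero, h1, h2]
      simp
  | succ n ih =>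
    rcases d with _ | d
    · simp [hitSum_of_le]
    · rw [hitSum_succ p n k (by push_cast; omega), tailSum_succ]
      have e1 : b + ((d + 1 : ℕ) : ℤ) + 1 = b + ((d + 2 : ℕ) : ℤ) := by push_cast; ring
      have e2 : b + ((d + 1 : ℕ) : ℤ) - 1 = b + (d : ℤ) := by push_cast; ring
      have e3 : b - ((d + 1 : ℕ) : ℤ) + 1 = b - (d : ℤ) := by push_cast; ring
      have e4 : b - ((d + 1 : ℕ) : ℤ) - 1 = b - ((d + 2 : ℕ) : ℤ) := by push_cast; ring
      rw [e1, e2, e3, e4, ih, ih]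
      have hρ : p * ((1 - p) / p) = 1 - p := mul_div_cancel₀ _ hp
      generalize (1 - p) / p = ρ at hρ ⊢
      -- The relation `p ρ = 1 - p` exchanges the weights of up and down moves.
      linear_combination (ρ ^ (d + 1) * tailSum p n (b - ((d + 2 : ℕ) : ℤ)) k
        - ρ ^ d * tailSum p n (b - (d : ℤ)) k) * hρ

/-- The upper tail of the binomial distribution. -/
def binomTail (p : ℝ) (n j : ℕ) : ℝ :=
  ∑ i ∈ Finset.Ico j (n + 1), (n.choose i : ℝ) * p ^ i * (1 - p) ^ (n - i)

lemma sum_walkWeight_upCount (p : ℝ) (n : ℕ) (f : ℕ → ℝ) :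
    ∑ w : Fin n → Bool, walkWeight p w * f (Params.upCount w n)
      = ∑ i ∈ Finset.range (n + 1), (n.choose i : ℝ) * p ^ i * (1 - p) ^ (n - i) * f i := by
  let e : (Fin n → Bool) ≃ Finset (Fin n) :=
    { toFun := fun w => Finset.univ.filter fun k => w k = true
      invFun := fun s k => decide (k ∈ s)
      left_inv := fun w => by ext k; simp
      right_inv := fun s => by ext k; simp }
  have hw : ∀ w : Fin n → Bool, walkWeight p w * f (Params.upCount w n)
      = (fun m : ℕ => p ^ m * (1 - p) ^ (n - m) * f m) (e w).card := by
    intro w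
    have h1 : Params.upCount w n = (e w).card := by simp [Params.upCount, e]
    have h2 : walkWeight p w = p ^ (e w).card * (1 - p) ^ (n - (e w).card) := by
      have h3 : (Finset.univ.filter fun k => ¬ (w k = true)).card = n - (e w).card := by
        have := Finset.card_filter_add_card_filter_not (s := Finset.univ)
          (fun k : Fin n => w k = true)
        simp only [Finset.card_univ, Fintype.card_fin] at this
        simp only [e, Equiv.coe_fn_mk]
        omega
      rw [walkWeight, Finset.prod_ite, Finset.prod_const, Finset.prod_const, h3]
      rfl
    rw [h1, h2]
  rw [Finset.sum_congr rfl fun w _ => hw w,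
    e.sum_comp (fun s => (fun m : ℕ => p ^ m * (1 - p) ^ (n - m) * f m) s.card),
    ← Finset.powerset_univ,
    Finset.sum_powerset_apply_card (fun m : ℕ => p ^ m * (1 - p) ^ (n - m) * f m)]
  simp [mul_assoc]

lemma tailSum_eq_binomTail (p : ℝ) (n : ℕ) {y k : ℤ} {j : ℕ}
    (h : k = y + 2 * (j : ℤ) - n) : tailSum p n y k = binomTail p n j := by
  have h1 : ∀ w : Fin n → Bool, k ≤ y + level w n ↔ j ≤ Params.upCount w n := by
    intro w; simp only [level]; omega
  simp only [tailSum, h1]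
  rw [sum_walkWeight_upCount p n (fun i => if j ≤ i then 1 else 0), binomTail]
  simp only [mul_ite, mul_one, mul_zero]
  rw [← Finset.sum_filter]
  congr 1
  ext i
  simp only [Finset.mem_filter, Finset.mem_range, Finset.mem_Ico]
  omega

end DigitalBarrier
end

noncomputable section
namespace DigitalBarrier

/-! ### The prices in the tree as binomial tails -/

namespace Params

variable (m : Params)

lemma dt_pos {m : Params} (hT : 0 < m.T) {n : ℕ} (hn : 0 < n) : 0 < m.dt n :=
  div_pos hT (Nat.cast_pos.2 hn)

lemma treeStock_eq_level {n : ℕ} (w : Fin n → Bool) (i : ℕ) :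
    m.treeStock w i = m.s₀ * Real.exp (level w i * (m.σ * √(m.dt n))) := by
  simp [treeStock, level, mul_assoc]

variable {m}

lemma treeStock_le_iff (hs₀ : 0 < m.s₀) {n : ℕ} (hh : 0 < m.σ * √(m.dt n)) {x : ℝ} (hx : 0 < x)
    (w : Fin n → Bool) (i : ℕ) :
    m.treeStock w i ≤ x ↔ (level w i : ℝ) ≤ Real.log (x / m.s₀) / (m.σ * √(m.dt n)) := by
  rw [treeStock_eq_level, le_div_iff₀ hh, Real.le_log_iff_exp_le (by positivity), le_div_iff₀ hs₀,
    mul_comm]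

lemma le_treeStock_iff (hs₀ : 0 < m.s₀) {n : ℕ} (hh : 0 < m.σ * √(m.dt n)) {x : ℝ} (hx : 0 < x)
    (w : Fin n → Bool) (i : ℕ) :
    x ≤ m.treeStock w i ↔ Real.log (x / m.s₀) / (m.σ * √(m.dt n)) ≤ (level w i : ℝ) := by
  rw [treeStock_eq_level, div_le_iff₀ hh, Real.log_le_iff_le_exp (by positivity), div_le_iff₀ hs₀,
    mul_comm]

lemma log_div_div_eq (hs₀ : 0 < m.s₀) (hK : 0 < m.K) (n : ℕ) :
    Real.log (m.K / m.s₀) / (m.σ * √(m.dt n))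
      = -2 * (Real.log (m.s₀ / m.K) / (2 * m.σ * √(m.dt n)) - (n : ℝ) / 2) - n := by
  rw [Real.log_div hK.ne' hs₀.ne', Real.log_div hs₀.ne' hK.ne', mul_assoc 2]
  ring

lemma strike_le_treeStock_iff (hs₀ : 0 < m.s₀) (hK : 0 < m.K) {n : ℕ} (hh : 0 < m.σ * √(m.dt n))
    {k : ℕ}
    (hk : (k : ℤ) = -⌊Real.log (m.s₀ / m.K) / (2 * m.σ * √(m.dt n)) - (n : ℝ) / 2⌋)
    (w : Fin n → Bool) : m.K ≤ m.treeStock w n ↔ 2 * (k : ℤ) - n ≤ level w n := by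
  rw [le_treeStock_iff hs₀ hh hK, log_div_div_eq hs₀ hK n]
  set x := Real.log (m.s₀ / m.K) / (2 * m.σ * √(m.dt n)) - (n : ℝ) / 2
  have h1 : 2 * (k : ℤ) - n ≤ level w n ↔ -(upCount w n : ℤ) ≤ ⌊x⌋ := by
    simp only [level]; omega
  rw [h1, Int.le_floor]
  simp only [level]
  push_cast
  constructor <;> intro h <;> linarith

/-- Rounding preserves the order: the barrier is rounded down to a level and the strike is rounded
up. -/
lemma barrier_lt_strike (hs₀ : 0 < m.s₀) (hL : 0 < m.L) (hLK : m.L < m.K) {n : ℕ}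
    (hh : 0 < m.σ * √(m.dt n)) {k a : ℕ}
    (hk : (k : ℤ) = -⌊Real.log (m.s₀ / m.K) / (2 * m.σ * √(m.dt n)) - (n : ℝ) / 2⌋)
    (ha : (a : ℤ) = -⌊Real.log (m.L / m.s₀) / (m.σ * √(m.dt n))⌋) :
    -(a : ℤ) < 2 * (k : ℤ) - n := by
  have h1 := Int.floor_le (Real.log (m.L / m.s₀) / (m.σ * √(m.dt n)))
  have h2 := Int.floor_le (Real.log (m.s₀ / m.K) / (2 * m.σ * √(m.dt n)) - (n : ℝ) / 2)
  have h3 := log_div_div_eq hs₀ (hL.trans hLK) n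
  have h4 : Real.log (m.L / m.s₀) / (m.σ * √(m.dt n))
      < Real.log (m.K / m.s₀) / (m.σ * √(m.dt n)) := by gcongr
  have ha' : (a : ℝ) = -(⌊Real.log (m.L / m.s₀) / (m.σ * √(m.dt n))⌋ : ℝ) := by exact_mod_cast ha
  have hk' : (k : ℝ) =
      -(⌊Real.log (m.s₀ / m.K) / (2 * m.σ * √(m.dt n)) - (n : ℝ) / 2⌋ : ℝ) := by exact_mod_cast hk
  have : (-(a : ℝ)) < 2 * (k : ℝ) - n := by linarith
  exact_mod_cast this

/-- The price of the digital call in the tree is a binomial tail. -/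
lemma priceCRRDI_add_priceCRRDO (hs₀ : 0 < m.s₀) (hK : 0 < m.K) {n : ℕ}
    (hh : 0 < m.σ * √(m.dt n)) {k : ℕ}
    (hk : (k : ℤ) = -⌊Real.log (m.s₀ / m.K) / (2 * m.σ * √(m.dt n)) - (n : ℝ) / 2⌋) :
    m.priceCRRDI n + m.priceCRRDO n = Real.exp (-m.r * m.T) * binomTail (m.upProb n) n k := by
  rw [priceCRRDI, priceCRRDO, ← mul_add, ← Finset.sum_add_distrib,
    ← tailSum_eq_binomTail (m.upProb n) n (y := 0) (k := 2 * (k : ℤ) - n) (by ring), tailSum]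
  congr 1
  refine Finset.sum_congr rfl fun w _ => ?_
  rw [← mul_add]
  -- `pathWeight` is `walkWeight` at `p = upProb` by definition.
  change m.pathWeight w * _ = m.pathWeight w * _
  congr 1
  simp only [Set.indicator_apply, Set.mem_ofPred_eq, Pi.one_apply, zero_add,
    ← strike_le_treeStock_iff hs₀ hK hh hk w]
  have : (∀ i ≤ n, m.L < m.treeStock w i) ↔ ¬ ∃ i ≤ n, m.treeStock w i ≤ m.L := by
    push Not; rfl
  simp only [this]
  by_cases h1 : m.K ≤ m.treeStock w n <;> by_cases h2 : ∃ i ≤ n, m.treeStock w i ≤ m.L <;>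
    simp [h1, h2]

/-- The price of the down-and-in digital call in the tree, by reflection. -/
lemma priceCRRDI_eq (hs₀ : 0 < m.s₀) (hL : 0 < m.L) (hLK : m.L < m.K) {n : ℕ}
    (hh : 0 < m.σ * √(m.dt n)) (hp : m.upProb n ≠ 0) {k a : ℕ}
    (hk : (k : ℤ) = -⌊Real.log (m.s₀ / m.K) / (2 * m.σ * √(m.dt n)) - (n : ℝ) / 2⌋)
    (ha : (a : ℤ) = -⌊Real.log (m.L / m.s₀) / (m.σ * √(m.dt n))⌋) :
    m.priceCRRDI n = Real.exp (-m.r * m.T) *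
      (((1 - m.upProb n) / m.upProb n) ^ a * binomTail (m.upProb n) n (k + a)) := by
  rw [← tailSum_eq_binomTail (m.upProb n) n (y := -(a : ℤ) - (a : ℤ)) (k := 2 * (k : ℤ) - n)
    (by push_cast; ring),
    ← hitSum_eq_pow_mul_tailSum hp (barrier_lt_strike hs₀ hL hLK hh hk ha), priceCRRDI, hitSum]
  congr 1
  refine Finset.sum_congr rfl fun w _ => ?_
  change m.pathWeight w * _ = m.pathWeight w * _
  congr 1
  simp only [Set.indicator_apply, Set.mem_ofPred_eq, Pi.one_apply, neg_add_cancel, zero_add,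
    ← strike_le_treeStock_iff hs₀ (hL.trans hLK) hh hk w]
  have : ∀ i, m.treeStock w i ≤ m.L ↔ level w i ≤ -(a : ℤ) := by
    intro i
    rw [treeStock_le_iff hs₀ hh hL, ← Int.le_floor, ha, neg_neg]
  simp only [this]

end Params

/-! ### The binomial tail as an incomplete beta integral -/

open Polynomial in
lemma binomTail_eq_eval_bernstein (p : ℝ) (n j : ℕ) :
    binomTail p n j = (∑ i ∈ Finset.Ico j (n + 1), bernsteinPolynomial ℝ n i).eval p := by
  simp [binomTail, bernsteinPolynomial, Polynomial.eval_finsetSum]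

/-- The derivative of a Bernstein polynomial is a multiple of the difference of two neighbours of
lower degree, so the sum telescopes. The term at the upper end vanishes because its index exceeds
its degree. -/
lemma hasDerivAt_binomTail (p : ℝ) {n j : ℕ} (hj : j ≤ n) :
    HasDerivAt (fun p => binomTail p (n + 1) (j + 1))
      ((n + 1 : ℝ) * (n.choose j) * (p ^ j * (1 - p) ^ (n - j))) p := by
  have hd : Polynomial.derivative
      (∑ i ∈ Finset.Ico (j + 1) (n + 1 + 1), bernsteinPolynomial ℝ (n + 1) i)
      = ((n + 1 : ℕ) : Polynomial ℝ) * bernsteinPolynomial ℝ n j := by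
    rw [Polynomial.derivative_sum, ← Finset.sum_Ico_add' _ j (n + 1) 1]
    simp only [bernsteinPolynomial.derivative_succ, Nat.add_sub_cancel]
    have h := Finset.sum_Ico_sub (bernsteinPolynomial ℝ n) (show j ≤ n + 1 by omega)
    rw [bernsteinPolynomial.eq_zero_of_lt ℝ (Nat.lt_succ_self n)] at h
    rw [← Finset.mul_sum]
    congr 1
    simp only [← neg_sub (bernsteinPolynomial ℝ n (_ + 1)), Finset.sum_neg_distrib, h]
    simp
  simp only [binomTail_eq_eval_bernstein]
  refine (Polynomial.hasDerivAt _ p).congr_deriv ?_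
  rw [hd]
  simp [bernsteinPolynomial, mul_assoc]

lemma binomTail_one {n j : ℕ} (hj : j ≤ n) : binomTail 1 n j = 1 := by
  rw [binomTail, Finset.sum_eq_single n]
  · simp
  · intro i hi hin
    have : n - i ≠ 0 := by rw [Finset.mem_Ico] at hi; omega
    simp [this]
  · intro h; exact absurd (Finset.mem_Ico.2 ⟨hj, by omega⟩) h

lemma binomTail_zero (n j : ℕ) : binomTail 0 n (j + 1) = 0 := by
  refine Finset.sum_eq_zero fun i hi => ?_
  have : i ≠ 0 := by rw [Finset.mem_Ico] at hi; omega
  simp [this]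

lemma binomTail_eq_integral (p : ℝ) {n j : ℕ} (hj : j ≤ n) :
    binomTail p (n + 1) (j + 1)
      = (n + 1 : ℝ) * (n.choose j) * ∫ t in (0 : ℝ)..p, t ^ j * (1 - t) ^ (n - j) := by
  rw [← intervalIntegral.integral_const_mul,
    intervalIntegral.integral_eq_sub_of_hasDerivAt (fun t _ => hasDerivAt_binomTail t hj)
      (Continuous.intervalIntegrable (by fun_prop) _ _), binomTail_zero, sub_zero]

/-- The binomial tail is a regularized incomplete beta function. -/
lemma binomTail_eq_div (p : ℝ) {n j : ℕ} (hj : j ≤ n) :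
    binomTail p (n + 1) (j + 1) = (∫ t in (0 : ℝ)..p, t ^ j * (1 - t) ^ (n - j))
      / ∫ t in (0 : ℝ)..1, t ^ j * (1 - t) ^ (n - j) := by
  -- The tail equals `1` at `p = 1`, which identifies the binomial prefactor as the inverse of the
  -- complete integral.
  have h1 := binomTail_eq_integral 1 hj
  rw [binomTail_one (by omega)] at h1
  have h2 : (∫ t in (0 : ℝ)..1, t ^ j * (1 - t) ^ (n - j)) ≠ 0 := by
    intro h; simp [h] at h1
  rw [eq_div_iff h2, binomTail_eq_integral p hj]
  linear_combination (-∫ t in (0 : ℝ)..p, t ^ j * (1 - t) ^ (n - j)) * h1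

end DigitalBarrier
end

noncomputable section
namespace DigitalBarrier

/-! ### Gaussian approximation of the rescaled beta kernel -/

/-- Valid for all `x`. The factor `1 + exp x` is harmless later: multiplied by the Gaussian it gives
the Gaussian plus the beta kernel, and both have a common majorant. -/
lemma abs_exp_sub_one_sub_id_le_sq (x : ℝ) :
    |Real.exp x - 1 - x| ≤ x ^ 2 * (1 + Real.exp x) := by
  have hpos := Real.exp_pos x
  have h0 : 0 ≤ Real.exp x - 1 - x := by linarith [Real.add_one_le_exp x]
  rcases le_or_gt |x| 1 with h | h
  · refine (Real.abs_exp_sub_one_sub_id_le h).trans ?_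
    nlinarith [sq_nonneg x]
  · rw [abs_of_nonneg h0]
    have hx2 : 1 ≤ x ^ 2 := by rw [← sq_abs]; nlinarith
    rcases lt_abs.1 h with h | h
    · nlinarith
    · have : Real.exp x < 1 := by rw [Real.exp_lt_one_iff]; linarith
      nlinarith [sq_nonneg x]

lemma abs_log_add_log_le {y : ℝ} (hy : |y| ≤ 1 / 2) :
    |Real.log (1 + y) + Real.log (1 - y) + y ^ 2 + y ^ 4 / 2| ≤ 2 * y ^ 6 := by
  obtain ⟨h1, h2⟩ := abs_le.1 hy
  have hy2 : y ^ 2 ≤ 1 / 4 := by nlinarith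
  have h3 : |y ^ 2| < 1 := by rw [abs_of_nonneg (sq_nonneg y)]; linarith
  have h := Real.abs_log_sub_add_sum_range_le h3 2
  have e : Real.log (1 + y) + Real.log (1 - y) = Real.log (1 - y ^ 2) := by
    rw [← Real.log_mul (by linarith) (by linarith)]; ring_nf
  rw [e, abs_of_nonneg (sq_nonneg y)] at *
  have e2 : (∑ i ∈ Finset.range 2, (y ^ 2) ^ (i + 1) / ((i : ℝ) + 1)) + Real.log (1 - y ^ 2)
      = Real.log (1 - y ^ 2) + y ^ 2 + y ^ 4 / 2 := by
    simp [Finset.sum_range_succ]; ring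
  rw [e2] at h
  refine h.trans ?_
  rw [div_le_iff₀ (by linarith)]
  have : 0 ≤ y ^ 6 := by positivity
  have e3 : (y ^ 2) ^ (2 + 1) = y ^ 6 := by ring
  rw [e3]
  nlinarith

lemma abs_log_sub_log_le {y : ℝ} (hy : |y| ≤ 1 / 2) :
    |Real.log (1 + y) - Real.log (1 - y) - 2 * y - 2 * y ^ 3 / 3| ≤ 4 * |y| ^ 5 := by
  have h1 := Real.abs_log_sub_add_sum_range_le (x := y) (by linarith) 4
  have h2 := Real.abs_log_sub_add_sum_range_le (x := -y) (by rw [abs_neg]; linarith) 4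
  rw [abs_neg, sub_neg_eq_add] at h2
  have hb : |y| ^ (4 + 1) / (1 - |y|) ≤ 2 * |y| ^ 5 := by
    rw [div_le_iff₀ (by linarith)]
    have : 0 ≤ |y| ^ 5 := by positivity
    norm_num
    nlinarith
  have h3 := abs_sub_le_iff.1 (show |(∑ i ∈ Finset.range 4, (-y) ^ (i + 1) / ((i : ℝ) + 1)
    + Real.log (1 + y)) - 0| ≤ 2 * |y| ^ 5 by rw [sub_zero]; exact h2.trans hb)
  have h4 := abs_sub_le_iff.1 (show |(∑ i ∈ Finset.range 4, y ^ (i + 1) / ((i : ℝ) + 1)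
    + Real.log (1 - y)) - 0| ≤ 2 * |y| ^ 5 by rw [sub_zero]; exact h1.trans hb)
  simp only [Finset.sum_range_succ, Finset.sum_range_zero] at h3 h4
  norm_num at h3 h4
  rw [abs_le]
  constructor <;> nlinarith [h3.1, h3.2, h4.1, h4.2]

/-- The first correction to the Gaussian approximation of the beta kernel. -/
def kernelCorr (e s : ℝ) : ℝ := s ^ 2 / 2 - s ^ 4 / 4 + e * s ^ 3 / 3

/-- The density of the beta distribution up to normalization, on the scale of its fluctuations. -/
def betaKernel (R : ℝ) (a b : ℕ) : ℝ → ℝ :=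
  Set.indicator (Set.Icc (-R) R) fun s => (1 + s / R) ^ a * (1 - s / R) ^ b

/-! ### Pointwise comparison of the beta kernel with the corrected Gaussian -/

/-- Pair `b` factors of each kind into `1 - y ^ 2 ≤ exp (-y ^ 2)`; each of the `a - b` remaining
factors is at most `exp |y|`. -/
lemma pow_mul_pow_le_exp_of_le {y : ℝ} (hy : |y| ≤ 1) {a b : ℕ} (hab : b ≤ a) :
    (1 + y) ^ a * (1 - y) ^ b ≤ Real.exp (-b * y ^ 2 + (a - b) * |y|) := by
  obtain ⟨h1, h2⟩ := abs_le.1 hy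
  obtain ⟨c, rfl⟩ := Nat.exists_eq_add_of_le hab
  have e1 : (1 + y) ^ (b + c) * (1 - y) ^ b = (1 - y ^ 2) ^ b * (1 + y) ^ c := by
    rw [pow_add, mul_right_comm, ← mul_pow]; ring
  have e2 : Real.exp (-b * y ^ 2 + ((b + c : ℕ) - b) * |y|)
      = Real.exp (-y ^ 2) ^ b * Real.exp |y| ^ c := by
    rw [← Real.exp_nat_mul, ← Real.exp_nat_mul, ← Real.exp_add]; push_cast; ring_nf
  rw [e1, e2]
  have h3 : 0 ≤ 1 - y ^ 2 := by nlinarith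
  have h4 : 0 ≤ 1 + y := by linarith
  gcongr
  · linarith [Real.add_one_le_exp (-y ^ 2)]
  · linarith [Real.add_one_le_exp |y|, le_abs_self y]

lemma betaKernel_le {C R : ℝ} (hC : 0 ≤ C) (hR : 2 * C + 2 ≤ R) {a b : ℕ}
    (hab : (a : ℝ) + b + 1 = R ^ 2) (he : |(a : ℝ) - b| ≤ C * R) (s : ℝ) :
    betaKernel R a b s ≤ Real.exp (-s ^ 2 / 4 + C * |s|) := by
  unfold betaKernel
  by_cases hs : s ∈ Set.Icc (-R) R
  swap
  · rw [Set.indicator_of_notMem hs]; positivity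
  rw [Set.indicator_of_mem hs]
  have hR0 : 0 < R := by linarith
  obtain ⟨y, rfl⟩ : ∃ y, s = y * R := ⟨s / R, by field_simp⟩
  have hy : |y| ≤ 1 := by
    rw [abs_le]; constructor <;> nlinarith [hs.1, hs.2]
  rw [mul_div_cancel_right₀ _ hR0.ne']
  obtain ⟨he1, he2⟩ := abs_le.1 he
  have hRR : R ^ 2 ≥ 2 + 2 * C * R := by nlinarith
  rw [abs_mul, abs_of_pos hR0]
  have hy0 := abs_nonneg y
  -- The condition `2 * C + 2 ≤ R` yields `R ^ 2 ≥ 2 + 2 * C * R`, so the smaller exponent is at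
  -- least `R ^ 2 / 4`. The names `c`, `d` let one bound serve both orders of `a` and `b`, the
  -- second with `-y` for `y`.
  have hfin : ∀ c d : ℕ, (c : ℝ) + d + 1 = R ^ 2 → (d : ℝ) ≤ c → (c : ℝ) - d ≤ C * R →
      -(d : ℝ) * y ^ 2 + (c - d) * |y| ≤ -(y * R) ^ 2 / 4 + C * (|y| * R) := by
    intro c d h1 h2 h3
    have h4 : R ^ 2 / 4 ≤ d := by linarith
    nlinarith [mul_le_mul_of_nonneg_right h4 (sq_nonneg y), mul_le_mul_of_nonneg_right h3 hy0]
  rcases le_total b a with h | h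
  · exact (pow_mul_pow_le_exp_of_le hy h).trans
      (Real.exp_le_exp.2 (hfin a b hab (by exact_mod_cast h) (by linarith)))
  · have := pow_mul_pow_le_exp_of_le (y := -y) (by rwa [abs_neg]) h
    rw [abs_neg, sub_neg_eq_add, ← sub_eq_add_neg, neg_sq, mul_comm] at this
    exact this.trans
      (Real.exp_le_exp.2 (hfin b a (by linarith) (by exact_mod_cast h) (by linarith)))

/-- Split the logarithm into the part even in `y`, weighted by `(a + b) / 2 = (R ^ 2 - 1) / 2`, and
the odd part, weighted by `(a - b) / 2 = e R / 2`. The terms up to order `R ^ (-2)` are the Gaussian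
exponent and `kernelCorr`; what is left is `y ^ 4 / 4` and the two logarithmic remainders. -/
lemma abs_exponent_sub_le {C R y e : ℝ} (hR : 1 ≤ R) (hy : |y| ≤ 1 / 2) {a b : ℝ}
    (hab : a + b + 1 = R ^ 2) (he : a - b = e * R) (heC : |e| ≤ C) :
    |a * Real.log (1 + y) + b * Real.log (1 - y) - (-(y * R) ^ 2 / 2 + e * (y * R))
      - kernelCorr e (y * R) / R ^ 2| ≤ (2 + 2 * C) * (1 + |y * R|) ^ 6 / R ^ 4 := by
  have hC : 0 ≤ C := (abs_nonneg e).trans heC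
  have hR0 : 0 < R := by linarith
  have h1 := abs_log_add_log_le hy
  have h2 := abs_log_sub_log_le hy
  set l₁ := Real.log (1 + y)
  set l₂ := Real.log (1 - y)
  have e1 : a * l₁ + b * l₂ - (-(y * R) ^ 2 / 2 + e * (y * R)) - kernelCorr e (y * R) / R ^ 2
      = y ^ 4 / 4 + (R ^ 2 - 1) / 2 * (l₁ + l₂ + y ^ 2 + y ^ 4 / 2)
        + e * R / 2 * (l₁ - l₂ - 2 * y - 2 * y ^ 3 / 3) := by
    have ha : a = (R ^ 2 - 1 + e * R) / 2 := by linarith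
    have hb : b = (R ^ 2 - 1 - e * R) / 2 := by linarith
    rw [ha, hb, kernelCorr]
    field_simp
    ring
  rw [e1]
  have hy0 := abs_nonneg y
  have b1 : |y ^ 4 / 4| ≤ |y| ^ 4 / 4 := by rw [abs_div, abs_pow]; norm_num
  have b2 : |(R ^ 2 - 1) / 2 * (l₁ + l₂ + y ^ 2 + y ^ 4 / 2)| ≤ R ^ 2 * |y| ^ 6 := by
    rw [abs_mul, abs_of_nonneg (by nlinarith)]
    have : |y| ^ 6 = y ^ 6 := by rw [show (6 : ℕ) = 2 * 3 by norm_num, pow_mul, sq_abs]; ring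
    rw [this]
    have h6 : 0 ≤ y ^ 6 := by positivity
    calc (R ^ 2 - 1) / 2 * |l₁ + l₂ + y ^ 2 + y ^ 4 / 2| ≤ R ^ 2 / 2 * (2 * y ^ 6) := by
          gcongr; linarith
      _ = R ^ 2 * y ^ 6 := by ring
  have b3 : |e * R / 2 * (l₁ - l₂ - 2 * y - 2 * y ^ 3 / 3)| ≤ C * R * (2 * |y| ^ 5) := by
    rw [abs_mul, abs_div, abs_mul, abs_of_pos hR0, abs_two]
    calc |e| * R / 2 * |l₁ - l₂ - 2 * y - 2 * y ^ 3 / 3| ≤ C * R / 2 * (4 * |y| ^ 5) := by gcongr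
      _ = C * R * (2 * |y| ^ 5) := by ring
  refine (abs_add_le _ _).trans ((add_le_add ((abs_add_le _ _).trans (add_le_add b1 b2)) b3).trans
    ?_)
  rw [abs_mul, abs_of_pos hR0, le_div_iff₀ (by positivity)]
  have e2 : (|y| ^ 4 / 4 + R ^ 2 * |y| ^ 6 + C * R * (2 * |y| ^ 5)) * R ^ 4
      = (|y| * R) ^ 4 / 4 + (|y| * R) ^ 6 + 2 * C * (|y| * R) ^ 5 := by ring
  rw [e2]
  have ht : 0 ≤ |y| * R := by positivity
  generalize |y| * R = t at ht
  have p4 : t ^ 4 ≤ (1 + t) ^ 6 :=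
    (pow_le_pow_left₀ ht (by linarith) 4).trans (pow_le_pow_right₀ (by linarith) (by norm_num))
  have p5 : t ^ 5 ≤ (1 + t) ^ 6 :=
    (pow_le_pow_left₀ ht (by linarith) 5).trans (pow_le_pow_right₀ (by linarith) (by norm_num))
  have p6 : t ^ 6 ≤ (1 + t) ^ 6 := pow_le_pow_left₀ ht (by linarith) 6
  nlinarith [mul_le_mul_of_nonneg_left p5 hC]

lemma abs_kernelCorr_le {C e : ℝ} (heC : |e| ≤ C) (s : ℝ) :
    |kernelCorr e s| ≤ (2 + 2 * C) * (1 + |s|) ^ 6 := by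
  have hC : 0 ≤ C := (abs_nonneg e).trans heC
  have h1 : |kernelCorr e s| ≤ |s| ^ 2 / 2 + |s| ^ 4 / 4 + C * |s| ^ 3 / 3 := by
    unfold kernelCorr
    refine (abs_add_le _ _).trans (add_le_add ((abs_sub _ _).trans (add_le_add ?_ ?_)) ?_)
    · rw [abs_div, abs_pow]; norm_num
    · rw [abs_div, abs_pow]; norm_num
    · rw [abs_div, abs_mul, abs_pow, abs_of_pos (show (0 : ℝ) < 3 by norm_num)]; gcongr
  refine h1.trans ?_
  have ht := abs_nonneg s
  generalize |s| = t at ht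
  have p4 : t ^ 4 ≤ (1 + t) ^ 6 :=
    (pow_le_pow_left₀ ht (by linarith) 4).trans (pow_le_pow_right₀ (by linarith) (by norm_num))
  have p3 : t ^ 3 ≤ (1 + t) ^ 6 :=
    (pow_le_pow_left₀ ht (by linarith) 3).trans (pow_le_pow_right₀ (by linarith) (by norm_num))
  have p2 : t ^ 2 ≤ (1 + t) ^ 6 :=
    (pow_le_pow_left₀ ht (by linarith) 2).trans (pow_le_pow_right₀ (by linarith) (by norm_num))
  have p0 : 0 ≤ (1 + t) ^ 6 := by positivity
  nlinarith [mul_le_mul_of_nonneg_left p3 hC]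

/-- Central range: `x` is the deviation of the exponent from the Gaussian one, and `D` dominates
both the Gaussian `G` and the kernel `G * exp x`. -/
lemma abs_mul_exp_sub_le {G D x c K R : ℝ} (hG : 0 < G) (hGD : G ≤ D)
    (hHD : G * Real.exp x ≤ D) (hR : 1 ≤ R) (hK : 1 ≤ K) (hx : |x - c / R ^ 2| ≤ K / R ^ 4)
    (hc : |c| ≤ K) :
    |G * Real.exp x - G * (1 + c / R ^ 2)| ≤ 9 * K ^ 2 * D / R ^ 4 := by
  have hR0 : 0 < R := by linarith
  have hD : 0 < D := hG.trans_le hGD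
  have hxa : |x| ≤ 2 * K / R ^ 2 := by
    calc |x| = |(x - c / R ^ 2) + c / R ^ 2| := by ring_nf
      _ ≤ K / R ^ 4 + K / R ^ 2 := by
        refine (abs_add_le _ _).trans (add_le_add hx ?_)
        rw [abs_div, abs_of_pos (show 0 < R ^ 2 by positivity)]
        gcongr
      _ ≤ K / R ^ 2 + K / R ^ 2 := by
        gcongr 1
        exact div_le_div_of_nonneg_left (by linarith) (by positivity)
          (pow_le_pow_right₀ hR (by norm_num))
      _ = _ := by ring
  have hx2 : x ^ 2 ≤ 4 * K ^ 2 / R ^ 4 := by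
    calc x ^ 2 = |x| ^ 2 := (sq_abs x).symm
      _ ≤ (2 * K / R ^ 2) ^ 2 := by gcongr
      _ = _ := by ring
  calc |G * Real.exp x - G * (1 + c / R ^ 2)|
      = |G * ((Real.exp x - 1 - x) + (x - c / R ^ 2))| := by ring_nf
    _ = G * |(Real.exp x - 1 - x) + (x - c / R ^ 2)| := by rw [abs_mul, abs_of_pos hG]
    _ ≤ G * (x ^ 2 * (1 + Real.exp x) + K / R ^ 4) := by
        gcongr
        exact (abs_add_le _ _).trans (add_le_add (abs_exp_sub_one_sub_id_le_sq x) hx)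
    _ = x ^ 2 * (G + G * Real.exp x) + G * (K / R ^ 4) := by ring
    _ ≤ 4 * K ^ 2 / R ^ 4 * (D + D) + D * (K ^ 2 / R ^ 4) := by
        have : K ≤ K ^ 2 := by nlinarith
        gcongr
    _ = 9 * K ^ 2 * D / R ^ 4 := by ring

/-- Far range: once `R ^ 4 ≤ 16 * K`, no cancellation is needed and the triangle inequality
suffices. -/
lemma abs_sub_mul_le_of_pow_le {G D H c K R : ℝ} (hG : 0 < G) (hGD : G ≤ D) (hH : 0 ≤ H)
    (hHD : H ≤ D) (hR : 1 ≤ R) (hK : 1 ≤ K) (hc : |c| ≤ K) (hRK : R ^ 4 ≤ 16 * K) :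
    |H - G * (1 + c / R ^ 2)| ≤ 48 * K ^ 2 * D / R ^ 4 := by
  have hR0 : 0 < R := by linarith
  have hD : 0 < D := hG.trans_le hGD
  have hcorr : |1 + c / R ^ 2| ≤ 2 * K := by
    refine (abs_add_le _ _).trans ?_
    rw [abs_one, abs_div, abs_of_pos (show 0 < R ^ 2 by positivity)]
    have : |c| / R ^ 2 ≤ K := (div_le_self (abs_nonneg _) (one_le_pow₀ hR)).trans hc
    linarith
  calc |H - G * (1 + c / R ^ 2)| ≤ D + D * (2 * K) := by
        refine (abs_sub _ _).trans (add_le_add ?_ ?_)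
        · rwa [abs_of_nonneg hH]
        · rw [abs_mul, abs_of_pos hG]; gcongr
    _ ≤ 3 * K * D := by nlinarith
    _ ≤ 48 * K ^ 2 * D / R ^ 4 := by
        rw [le_div_iff₀ (by positivity)]
        calc 3 * K * D * R ^ 4 ≤ 3 * K * D * (16 * K) := by gcongr
          _ = 48 * K ^ 2 * D := by ring

lemma abs_betaKernel_sub_le_poly {C R e : ℝ} (hR : 2 * C + 2 ≤ R) {a b : ℕ}
    (hab : (a : ℝ) + b + 1 = R ^ 2) (he : (a : ℝ) - b = e * R) (heC : |e| ≤ C) (s : ℝ) :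
    |betaKernel R a b s - Real.exp (-s ^ 2 / 2 + e * s) * (1 + kernelCorr e s / R ^ 2)|
      ≤ 48 * (2 + 2 * C) ^ 2 * (1 + |s|) ^ 12 * Real.exp (-s ^ 2 / 4 + C * |s|) / R ^ 4 := by
  have hC : 0 ≤ C := (abs_nonneg e).trans heC
  have hR1 : 1 ≤ R := by linarith
  have hR0 : 0 < R := by linarith
  have hD := betaKernel_le hC hR hab (by rw [he, abs_mul, abs_of_pos hR0]; gcongr) s
  have hG : Real.exp (-s ^ 2 / 2 + e * s) ≤ Real.exp (-s ^ 2 / 4 + C * |s|) := by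
    apply Real.exp_le_exp.2
    have : e * s ≤ C * |s| := by
      calc e * s ≤ |e * s| := le_abs_self _
        _ = |e| * |s| := abs_mul _ _
        _ ≤ C * |s| := by gcongr
    nlinarith [sq_nonneg s]
  have hq := abs_kernelCorr_le heC s
  have hk : 2 ≤ 2 + 2 * C := by linarith
  have ht : 1 ≤ (1 + |s|) ^ 6 := one_le_pow₀ (by linarith [abs_nonneg s])
  have ht2 : (1 + |s|) ^ 12 = ((1 + |s|) ^ 6) ^ 2 := by ring
  have hs4 : s ^ 4 ≤ (1 + |s|) ^ 6 := by
    have : s ^ 4 = |s| ^ 4 := by rw [show (4 : ℕ) = 2 * 2 by norm_num, pow_mul, pow_mul, sq_abs]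
    rw [this]
    exact (pow_le_pow_left₀ (abs_nonneg s) (by linarith) 4).trans
      (pow_le_pow_right₀ (by linarith [abs_nonneg s]) (by norm_num))
  have hx : |s / R| ≤ 1 / 2 → |(a : ℝ) * Real.log (1 + s / R) + b * Real.log (1 - s / R)
      - (-s ^ 2 / 2 + e * s) - kernelCorr e s / R ^ 2|
      ≤ (2 + 2 * C) * (1 + |s|) ^ 6 / R ^ 4 := by
    intro hy
    have := abs_exponent_sub_le (C := C) (e := e) hR1 hy hab he heC
    rwa [div_mul_cancel₀ _ hR0.ne'] at this
  have hkt : 1 ≤ (2 + 2 * C) * (1 + |s|) ^ 6 := by nlinarith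
  have hfin : 48 * (2 + 2 * C) ^ 2 * (1 + |s|) ^ 12 * Real.exp (-s ^ 2 / 4 + C * |s|) / R ^ 4
      = 48 * ((2 + 2 * C) * (1 + |s|) ^ 6) ^ 2 * Real.exp (-s ^ 2 / 4 + C * |s|) / R ^ 4 := by
    rw [ht2, mul_pow, mul_assoc 48]
  rw [hfin]
  -- For `|s| ≤ R / 2` the logarithms can be expanded. Beyond that, `R ^ 4 ≤ 16 * s ^ 4` is absorbed
  -- by the polynomial factor.
  rcases le_or_gt |s / R| (1 / 2) with hy | hy
  · obtain ⟨hy1, hy2⟩ := abs_le.1 hy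
    have hmem : s ∈ Set.Icc (-R) R := by
      rw [le_div_iff₀ hR0] at hy1
      rw [div_le_iff₀ hR0] at hy2
      constructor <;> linarith
    have hH : betaKernel R a b s
        = Real.exp (a * Real.log (1 + s / R) + b * Real.log (1 - s / R)) := by
      rw [betaKernel, Set.indicator_of_mem hmem, Real.exp_add, mul_comm (a : ℝ),
        mul_comm (b : ℝ), Real.exp_mul, Real.exp_mul, Real.exp_log (by linarith),
        Real.exp_log (by linarith), Real.rpow_natCast, Real.rpow_natCast]
    have hEx : betaKernel R a b s = Real.exp (-s ^ 2 / 2 + e * s) * Real.exp (a *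
        Real.log (1 + s / R) + b * Real.log (1 - s / R) - (-s ^ 2 / 2 + e * s)) := by
      rw [hH, ← Real.exp_add]; ring_nf
    rw [hEx] at hD ⊢
    refine (abs_mul_exp_sub_le (Real.exp_pos _) hG hD hR1 hkt (hx hy) hq).trans ?_
    gcongr
    norm_num
  · have hsR : R / 2 ≤ |s| := by
      rw [abs_div, abs_of_pos hR0, lt_div_iff₀ hR0] at hy
      linarith
    have h16 : R ^ 4 ≤ 16 * ((2 + 2 * C) * (1 + |s|) ^ 6) := by
      have h1 : (R / 2) ^ 4 ≤ |s| ^ 4 := by gcongr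
      have : s ^ 4 = |s| ^ 4 := by
        rw [show (4 : ℕ) = 2 * 2 by norm_num, pow_mul, pow_mul, sq_abs]
      rw [← this] at h1
      have h2 : (R / 2) ^ 4 = R ^ 4 / 16 := by ring
      nlinarith
    have hH0 : 0 ≤ betaKernel R a b s := by
      refine Set.indicator_nonneg (fun s hs => ?_) s
      have h1 : 0 ≤ 1 + s / R := by
        have : -1 ≤ s / R := by rw [le_div_iff₀ hR0]; linarith [hs.1]
        linarith
      have h2 : 0 ≤ 1 - s / R := by
        have : s / R ≤ 1 := by rw [div_le_iff₀ hR0]; linarith [hs.2]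
        linarith
      positivity
    exact abs_sub_mul_le_of_pow_le (Real.exp_pos _) hG hH0 hD hR1 hkt hq h16

lemma abs_betaKernel_sub_le (C : ℝ) : ∃ M, 0 ≤ M ∧ ∀ R e : ℝ, 2 * C + 2 ≤ R → |e| ≤ C →
    ∀ a b : ℕ, (a : ℝ) + b + 1 = R ^ 2 → (a : ℝ) - b = e * R → ∀ s,
    |betaKernel R a b s - Real.exp (-s ^ 2 / 2 + e * s) * (1 + kernelCorr e s / R ^ 2)|
      ≤ M / R ^ 4 * Real.exp (-(1 / 8) * s ^ 2) := by
  -- The power `(1 + |s|) ^ 12` is at most `12! * exp (1 + |s|)`. Completing the square around `|s|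
  -- = 4 * (C + 1)` gives the remaining constant and leaves the decay `exp (-s ^ 2 / 8)`.
  refine ⟨48 * (2 + 2 * C) ^ 2 * ((Nat.factorial 12 : ℝ) * Real.exp (2 * (C + 1) ^ 2 + 1)),
    by positivity, fun R e hR heC a b hab he s => ?_⟩
  refine (abs_betaKernel_sub_le_poly hR hab he heC s).trans ?_
  have h1 : (1 + |s|) ^ 12 ≤ (Nat.factorial 12 : ℝ) * Real.exp (1 + |s|) := by
    have := Real.pow_div_factorial_le_exp (1 + |s|) (by positivity) 12
    rwa [div_le_iff₀ (by positivity), mul_comm] at this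
  have h2 : Real.exp (1 + |s|) * Real.exp (-s ^ 2 / 4 + C * |s|)
      ≤ Real.exp (2 * (C + 1) ^ 2 + 1) * Real.exp (-(1 / 8) * s ^ 2) := by
    rw [← Real.exp_add, ← Real.exp_add]
    apply Real.exp_le_exp.2
    rw [← sq_abs s]
    nlinarith [sq_nonneg (|s| - 4 * (C + 1))]
  calc 48 * (2 + 2 * C) ^ 2 * (1 + |s|) ^ 12 * Real.exp (-s ^ 2 / 4 + C * |s|) / R ^ 4
      ≤ 48 * (2 + 2 * C) ^ 2 * ((Nat.factorial 12 : ℝ) * Real.exp (1 + |s|))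
        * Real.exp (-s ^ 2 / 4 + C * |s|) / R ^ 4 := by gcongr
    _ = 48 * (2 + 2 * C) ^ 2 * (Nat.factorial 12 : ℝ)
        * (Real.exp (1 + |s|) * Real.exp (-s ^ 2 / 4 + C * |s|)) / R ^ 4 := by ring
    _ ≤ 48 * (2 + 2 * C) ^ 2 * (Nat.factorial 12 : ℝ)
        * (Real.exp (2 * (C + 1) ^ 2 + 1) * Real.exp (-(1 / 8) * s ^ 2)) / R ^ 4 := by gcongr
    _ = _ := by ring

end DigitalBarrier
end

noncomputable section
namespace DigitalBarrier
open Params (Phi phi)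
open scoped Topology

/-! ### The normal distribution function -/

lemma phi_eq_gaussianPDFReal (x : ℝ) : phi x = gaussianPDFReal 0 1 x := by
  simp [phi, gaussianPDFReal, div_eq_inv_mul]

lemma phi_pos (x : ℝ) : 0 < phi x := by unfold phi; positivity

lemma continuous_phi : Continuous phi := by unfold phi; fun_prop

lemma Phi_eq_integral (x : ℝ) : Phi x = ∫ t in Set.Iic x, phi t := by
  rw [Phi, cdf_eq_real, Measure.real, gaussianReal_apply_eq_integral _ one_ne_zero,
    ENNReal.toReal_ofReal (integral_nonneg fun t => gaussianPDFReal_nonneg _ _ _)]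
  simp_rw [phi_eq_gaussianPDFReal]

lemma integrable_phi : Integrable phi := by
  have : phi = gaussianPDFReal 0 1 := funext phi_eq_gaussianPDFReal
  rw [this]
  exact integrable_gaussianPDFReal 0 1

lemma hasDerivAt_Phi (x : ℝ) : HasDerivAt Phi (phi x) x := by
  have h : Phi = fun y => Phi 0 + ∫ t in (0 : ℝ)..y, phi t := by
    ext y
    rw [Phi_eq_integral, Phi_eq_integral,
      ← intervalIntegral.integral_Iic_sub_Iic integrable_phi.integrableOn
        integrable_phi.integrableOn]
    ring
  rw [h]
  exact ((continuous_phi.integral_hasStrictDerivAt 0 x).hasDerivAt).const_add _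

lemma hasDerivAt_phi (x : ℝ) : HasDerivAt phi (-x * phi x) x := by
  unfold phi
  have h : HasDerivAt (fun y : ℝ => -y ^ 2 / 2) (-x) x := by
    have := ((hasDerivAt_pow 2 x).neg).div_const 2
    simp only [Pi.neg_apply] at this
    refine this.congr_deriv ?_
    simp; ring
  refine (h.exp.div_const _).congr_deriv ?_
  ring

lemma Phi_nonneg (x : ℝ) : 0 ≤ Phi x := cdf_nonneg _ _

lemma Phi_le_one (x : ℝ) : Phi x ≤ 1 := cdf_le_one _ _

lemma continuous_Phi : Continuous Phi :=
  continuous_iff_continuousAt.2 fun x => (hasDerivAt_Phi x).continuousAt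

lemma tendsto_pow_mul_phi_cocompact (k : ℕ) :
    Tendsto (fun x : ℝ => x ^ k * phi x) (cocompact ℝ) (𝓝 0) := by
  have h := (tendsto_rpow_abs_mul_exp_neg_mul_sq_cocompact (a := 1 / 2) (by norm_num)
    (k : ℝ)).div_const (√(2 * Real.pi))
  rw [zero_div] at h
  refine squeeze_zero_norm (fun x => le_of_eq ?_) h
  rw [Real.norm_eq_abs, abs_mul, abs_of_pos (phi_pos x), abs_pow, Real.rpow_natCast, phi,
    mul_div_assoc]
  congr 3
  ring

/-! ### Gaussian integral of the corrected kernel -/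

/-- Coefficient of the normal density in the first correction to the binomial tail. -/
def tailCorr (e w : ℝ) : ℝ :=
  (w ^ 3 + 3 * w) / 4 + 2 * e * (w ^ 2 + 2) / 3 - (1 - e ^ 2) * w / 2 - e

lemma tendsto_tailCorr_mul_phi_cocompact (e : ℝ) :
    Tendsto (fun w => tailCorr e w * phi w) (cocompact ℝ) (𝓝 0) := by
  have h := (((tendsto_pow_mul_phi_cocompact 3).const_mul (1 / 4)).add
    ((tendsto_pow_mul_phi_cocompact 2).const_mul (2 * e / 3))).add
    (((tendsto_pow_mul_phi_cocompact 1).const_mul (3 / 4 - (1 - e ^ 2) / 2)).add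
    ((tendsto_pow_mul_phi_cocompact 0).const_mul (e / 3)))
  simp only [mul_zero, add_zero] at h
  refine h.congr fun w => ?_
  rw [tailCorr]; ring

/-- Antiderivative of the corrected Gaussian kernel, up to normalization. -/
def kernelPrim (e c s : ℝ) : ℝ :=
  Phi (s - e) * (1 + (e ^ 4 / 12 - 1 / 4) * c) + c * (tailCorr e (s - e) * phi (s - e))

/-- The constant `e ^ 4 / 12 - 1 / 4` is the mean of `kernelCorr e` under the normal law with mean
`e` and variance `1`. In the variable `w = s - e`, `tailCorr e` is the polynomial `P` for which `P'
- w P` is `kernelCorr e` minus that mean. -/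
lemma hasDerivAt_kernelPrim (e c s : ℝ) :
    HasDerivAt (kernelPrim e c) (phi (s - e) * (1 + kernelCorr e s * c)) s := by
  have hs : HasDerivAt (fun s : ℝ => s - e) 1 s := (hasDerivAt_id s).sub_const e
  have h1 := (hasDerivAt_Phi (s - e)).comp s hs
  have h2 := (hasDerivAt_phi (s - e)).comp s hs
  have h3 : HasDerivAt (fun s => tailCorr e (s - e))
      ((3 * (s - e) ^ 2 + 3) / 4 + 2 * e * (2 * (s - e)) / 3 - (1 - e ^ 2) / 2) s := by
    have : HasDerivAt (tailCorr e)
        ((3 * (s - e) ^ 2 + 3) / 4 + 2 * e * (2 * (s - e)) / 3 - (1 - e ^ 2) / 2) (s - e) := by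
      have p3 := hasDerivAt_pow 3 (s - e)
      have p2 := hasDerivAt_pow 2 (s - e)
      have p1 := hasDerivAt_id (s - e)
      refine (((((p3.add (p1.const_mul 3)).div_const 4).add
        (((p2.add_const 2).const_mul (2 * e)).div_const 3)).sub
        ((p1.const_mul (1 - e ^ 2)).div_const 2)).sub_const e).congr_deriv ?_
      norm_num
    exact (this.comp s hs).congr_deriv (mul_one _)
  refine ((h1.mul_const (1 + (e ^ 4 / 12 - 1 / 4) * c)).add
    ((h3.mul h2).const_mul c)).congr_deriv ?_
  simp only [Function.comp_apply, kernelCorr, tailCorr]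
  ring

lemma tendsto_sub_const_cocompact (e : ℝ) :
    Tendsto (fun s : ℝ => s - e) (cocompact ℝ) (cocompact ℝ) :=
  (Homeomorph.subRight e).isClosedEmbedding.tendsto_cocompact

lemma tendsto_kernelPrim_atBot (e c : ℝ) : Tendsto (kernelPrim e c) atBot (𝓝 0) := by
  have h1 := ((tendsto_cdf_atBot (gaussianReal 0 1)).comp
    (tendsto_atBot_add_const_right atBot (-e) tendsto_id)).mul_const
      (1 + (e ^ 4 / 12 - 1 / 4) * c)
  have h2 := (((tendsto_tailCorr_mul_phi_cocompact e).comp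
    (tendsto_sub_const_cocompact e)).mono_left atBot_le_cocompact).const_mul c
  have h := h1.add h2
  rw [zero_mul, mul_zero, add_zero] at h
  exact h

lemma tendsto_kernelPrim_atTop (e c : ℝ) :
    Tendsto (kernelPrim e c) atTop (𝓝 (1 + (e ^ 4 / 12 - 1 / 4) * c)) := by
  have h1 := ((tendsto_cdf_atTop (gaussianReal 0 1)).comp
    (tendsto_atTop_add_const_right atTop (-e) tendsto_id)).mul_const
      (1 + (e ^ 4 / 12 - 1 / 4) * c)
  have h2 := (((tendsto_tailCorr_mul_phi_cocompact e).comp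
    (tendsto_sub_const_cocompact e)).mono_left atTop_le_cocompact).const_mul c
  have h := h1.add h2
  rw [one_mul, mul_zero, add_zero] at h
  exact h

lemma exp_eq_mul_phi (e s : ℝ) :
    Real.exp (-s ^ 2 / 2 + e * s) = √(2 * Real.pi) * Real.exp (e ^ 2 / 2) * phi (s - e) := by
  rw [phi, mul_div_assoc', mul_assoc, mul_div_cancel_left₀ _ (by positivity), ← Real.exp_add]
  ring_nf

lemma integrable_betaKernel (R : ℝ) (a b : ℕ) : Integrable (betaKernel R a b) := by
  unfold betaKernel
  rw [integrable_indicator_iff measurableSet_Icc]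
  exact ContinuousOn.integrableOn_compact isCompact_Icc (by fun_prop)

/-- Integrates the pointwise estimate, both up to `s` and over the line. The total mass is needed as
the denominator of the normalized tail. -/
lemma integral_betaKernel (C : ℝ) : ∃ M, 0 ≤ M ∧ ∀ R e : ℝ, 2 * C + 2 ≤ R → |e| ≤ C →
    ∀ a b : ℕ, (a : ℝ) + b + 1 = R ^ 2 → (a : ℝ) - b = e * R →
    (∀ s, |(∫ t in Set.Iic s, betaKernel R a b t) / (√(2 * Real.pi) * Real.exp (e ^ 2 / 2))
      - kernelPrim e (1 / R ^ 2) s| ≤ M / R ^ 4) ∧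
    |(∫ t, betaKernel R a b t) / (√(2 * Real.pi) * Real.exp (e ^ 2 / 2))
      - (1 + (e ^ 4 / 12 - 1 / 4) * (1 / R ^ 2))| ≤ M / R ^ 4 := by
  obtain ⟨M, hM, H⟩ := abs_betaKernel_sub_le C
  set J := ∫ s : ℝ, Real.exp (-(1 / 8) * s ^ 2)
  have hJ : 0 ≤ J := integral_nonneg fun s => (Real.exp_pos _).le
  refine ⟨M * J, by positivity, fun R e hR he a b hab hab' => ?_⟩
  specialize H R e hR he a b hab hab'
  set N := √(2 * Real.pi) * Real.exp (e ^ 2 / 2) with hN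
  have hN1 : 1 ≤ N := by
    have h1 : 1 ≤ √(2 * Real.pi) := by
      rw [Real.one_le_sqrt]; linarith [Real.pi_gt_three]
    have h2 : 1 ≤ Real.exp (e ^ 2 / 2) := Real.one_le_exp (by positivity)
    nlinarith
  have hN0 : 0 < N := by linarith
  set c := 1 / R ^ 2 with hc
  set g : ℝ → ℝ := fun s => phi (s - e) * (1 + kernelCorr e s * c) with hg
  have hgc : Continuous g := by
    have := continuous_phi
    simp only [hg, kernelCorr]; fun_prop
  have hexpint : Integrable fun s : ℝ => M / R ^ 4 * Real.exp (-(1 / 8) * s ^ 2) :=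
    (integrable_exp_neg_mul_sq (by norm_num)).const_mul _
  have hH : ∀ s, ‖betaKernel R a b s - N * g s‖ ≤ M / R ^ 4 * Real.exp (-(1 / 8) * s ^ 2) := by
    intro s
    have := H s
    rwa [exp_eq_mul_phi, ← hN, mul_assoc, div_eq_mul_one_div (kernelCorr e s), ← hc] at this
  have hβ := integrable_betaKernel R a b
  have hdiff : Integrable fun s => betaKernel R a b s - N * g s :=
    hexpint.mono' (hβ.aestronglyMeasurable.sub (hgc.const_mul N).aestronglyMeasurable)
      (ae_of_all _ hH)
  have hgint : Integrable g := by
    have h1 : Integrable fun s => N * g s := by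
      refine (hβ.sub hdiff).congr (ae_of_all _ fun s => ?_)
      simp
    have h2 := h1.const_mul N⁻¹
    refine h2.congr (ae_of_all _ fun s => ?_)
    simp only
    field_simp
  -- One bound for all sets `S`, used for a half-line and for the whole line. Since `N ≥ 1`,
  -- dividing by `N` does not enlarge the error.
  have key : ∀ S : Set ℝ, |(∫ t in S, betaKernel R a b t) / N - ∫ t in S, g t|
      ≤ M * J / R ^ 4 := by
    intro S
    have e1 : (∫ t in S, betaKernel R a b t) / N - ∫ t in S, g t
        = (∫ t in S, (betaKernel R a b t - N * g t)) / N := by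
      rw [integral_sub hβ.integrableOn (hgint.const_mul N).integrableOn, integral_const_mul]
      field_simp
    rw [e1, abs_div, abs_of_pos hN0]
    refine (div_le_self (abs_nonneg _) hN1).trans ?_
    calc |∫ t in S, (betaKernel R a b t - N * g t)|
        ≤ ∫ t in S, M / R ^ 4 * Real.exp (-(1 / 8) * t ^ 2) :=
          norm_integral_le_of_norm_le hexpint.integrableOn (ae_of_all _ hH)
      _ ≤ ∫ t, M / R ^ 4 * Real.exp (-(1 / 8) * t ^ 2) :=
          setIntegral_le_integral hexpint (ae_of_all _ fun t => by positivity)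
      _ = M * J / R ^ 4 := by rw [integral_const_mul]; ring
  constructor
  · intro s
    have e1 : ∫ t in Set.Iic s, g t = kernelPrim e c s := by
      rw [integral_Iic_of_hasDerivAt_of_tendsto'
        (fun x _ => hasDerivAt_kernelPrim e c x) hgint.integrableOn
        (tendsto_kernelPrim_atBot e c), sub_zero]
    rw [← e1]
    exact key _
  · have e1 : ∫ t, g t = 1 + (e ^ 4 / 12 - 1 / 4) * c := by
      rw [integral_of_hasDerivAt_of_tendsto (fun x => hasDerivAt_kernelPrim e c x) hgint
        (tendsto_kernelPrim_atBot e c) (tendsto_kernelPrim_atTop e c), sub_zero]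
    rw [← e1]
    have := key Set.univ
    rwa [setIntegral_univ, setIntegral_univ] at this

/-! ### Expansion of the binomial tail -/

lemma integral_pow_mul_pow_eq {R : ℝ} (hR : 0 < R) (a b : ℕ) (p : ℝ) :
    ∫ s in (-R)..(R * (2 * p - 1)), (1 + s / R) ^ a * (1 - s / R) ^ b
      = 2 ^ (a + b) * (2 * R) * ∫ t in (0 : ℝ)..p, t ^ a * (1 - t) ^ b := by
  have h := intervalIntegral.integral_comp_mul_add (a := -R) (b := R * (2 * p - 1))
    (fun t : ℝ => t ^ a * (1 - t) ^ b) (c := 1 / (2 * R)) (by positivity) (1 / 2)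
  have e1 : 1 / (2 * R) * -R + 1 / 2 = 0 := by field_simp; ring
  have e2 : 1 / (2 * R) * (R * (2 * p - 1)) + 1 / 2 = p := by field_simp; ring
  rw [e1, e2, smul_eq_mul] at h
  have e3 : (1 / (2 * R))⁻¹ = 2 * R := by rw [one_div, inv_inv]
  rw [mul_assoc, ← e3, ← h, ← intervalIntegral.integral_const_mul]
  refine intervalIntegral.integral_congr fun s _ => ?_
  have e4 : 1 + s / R = 2 * (1 / (2 * R) * s + 1 / 2) := by field_simp; ring
  have e5 : 1 - s / R = 2 * (1 - (1 / (2 * R) * s + 1 / 2)) := by field_simp; ring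
  rw [e4, e5, mul_pow, mul_pow, pow_add]
  ring

lemma binomTail_eq_integral_betaKernel {R : ℝ} (hR : 0 < R) {p : ℝ} (hp0 : 0 ≤ p) (hp1 : p ≤ 1)
    (a b : ℕ) : binomTail p (a + b + 1) (a + 1)
      = (∫ s in Set.Iic (R * (2 * p - 1)), betaKernel R a b s) / ∫ s, betaKernel R a b s := by
  have key : ∀ q : ℝ, 0 ≤ q → q ≤ 1 → ∫ s in Set.Iic (R * (2 * q - 1)), betaKernel R a b s
      = 2 ^ (a + b) * (2 * R) * ∫ t in (0 : ℝ)..q, t ^ a * (1 - t) ^ b := by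
    intro q hq0 hq1
    have h1 : R * (2 * q - 1) ≤ R := by nlinarith
    have h2 : -R ≤ R * (2 * q - 1) := by nlinarith
    have h3 : Set.Iic (R * (2 * q - 1)) ∩ Set.Icc (-R) R = Set.Icc (-R) (R * (2 * q - 1)) := by
      ext s
      simp only [Set.mem_inter_iff, Set.mem_Iic, Set.mem_Icc]
      constructor
      · rintro ⟨h, h', -⟩; exact ⟨h', h⟩
      · rintro ⟨h, h'⟩; exact ⟨h', h, h'.trans h1⟩
    rw [← integral_pow_mul_pow_eq hR, betaKernel, setIntegral_indicator measurableSet_Icc, h3,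
      intervalIntegral.integral_of_le h2, integral_Icc_eq_integral_Ioc]
  have hfull : ∫ s, betaKernel R a b s = ∫ s in Set.Iic (R * (2 * 1 - 1)), betaKernel R a b s := by
    rw [betaKernel, setIntegral_indicator measurableSet_Icc, integral_indicator measurableSet_Icc,
      Set.inter_eq_right.2]
    intro s hs
    simp only [Set.mem_Iic]
    linarith [hs.2]
  rw [hfull, key p hp0 hp1, key 1 zero_le_one le_rfl, mul_div_mul_left _ _ (by positivity),
    binomTail_eq_div p (Nat.le_add_right a b), Nat.add_sub_cancel_left]

/-- The factor `1 + κ c` from the total mass also multiplies the main term `U` of the numerator, so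
it cancels to first order: `κ` survives only in a term of order `c ^ 2`. -/
lemma abs_div_sub_le {X Y U V κ c δ : ℝ} (hX : |X - (U * (1 + κ * c) + c * V)| ≤ δ)
    (hY : |Y - (1 + κ * c)| ≤ δ) (hY0 : 1 / 2 ≤ Y) (hU0 : 0 ≤ U) (hU1 : U ≤ 1) (hc0 : 0 ≤ c)
    (hc1 : c ≤ 1) : |X / Y - (U + c * V)| ≤ 2 * (δ * (2 + |V|) + |κ| * |V| * c ^ 2) := by
  have hY' : 0 < Y := by linarith
  have hδ : 0 ≤ δ := (abs_nonneg _).trans hX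
  have e1 : X / Y - (U + c * V) = ((X - (U * (1 + κ * c) + c * V))
      - (Y - (1 + κ * c)) * (U + c * V) - κ * V * c ^ 2) / Y := by
    field_simp; ring
  have hUV : |U + c * V| ≤ 1 + |V| := by
    refine (abs_add_le _ _).trans (add_le_add ?_ ?_)
    · rwa [abs_of_nonneg hU0]
    · rw [abs_mul, abs_of_nonneg hc0]
      exact mul_le_of_le_one_left (abs_nonneg V) hc1
  rw [e1, abs_div, abs_of_pos hY', div_le_iff₀ hY']
  have h1 : |(X - (U * (1 + κ * c) + c * V)) - (Y - (1 + κ * c)) * (U + c * V) - κ * V * c ^ 2|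
      ≤ δ * (2 + |V|) + |κ| * |V| * c ^ 2 := by
    refine (abs_sub _ _).trans (add_le_add ((abs_sub _ _).trans ?_) ?_)
    · rw [abs_mul]
      have : |Y - (1 + κ * c)| * |U + c * V| ≤ δ * (1 + |V|) := by gcongr
      linarith
    · rw [abs_mul, abs_mul, abs_of_nonneg (sq_nonneg c)]
  have h2 : 0 ≤ δ * (2 + |V|) + |κ| * |V| * c ^ 2 := by positivity
  nlinarith

/-- Second order normal approximation of the binomial tail, uniformly for success probabilities
at distance `O(n^(-1/2))` of `1 / 2` and thresholds at distance `O(n^(1/2))` of `n / 2`. -/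
theorem binomTail_approx (C : ℝ) : ∃ M N₀ : ℝ, ∀ (n j : ℕ) (p : ℝ), N₀ ≤ n → 1 ≤ j → j ≤ n →
    |(2 * j - n - 1) / √(n : ℝ)| ≤ C → |√(n : ℝ) * (2 * p - 1)| ≤ C →
    |binomTail p n j - (Phi (√(n : ℝ) * (2 * p - 1) - (2 * j - n - 1) / √(n : ℝ))
      + 1 / n * (tailCorr ((2 * j - n - 1) / √(n : ℝ))
          (√(n : ℝ) * (2 * p - 1) - (2 * j - n - 1) / √(n : ℝ))
        * phi (√(n : ℝ) * (2 * p - 1) - (2 * j - n - 1) / √(n : ℝ))))| ≤ M / (n : ℝ) ^ 2 := by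
  obtain ⟨M, hM, H⟩ := integral_betaKernel C
  obtain ⟨V₀, hV⟩ : ∃ V₀, ∀ e s : ℝ, |e| ≤ C → |s| ≤ C →
      |tailCorr e (s - e) * phi (s - e)| ≤ V₀ := by
    have hcont : Continuous fun x : ℝ × ℝ => tailCorr x.1 (x.2 - x.1) * phi (x.2 - x.1) := by
      have := continuous_phi
      unfold tailCorr; fun_prop
    obtain ⟨V₀, h⟩ := (isCompact_Icc.prod isCompact_Icc).exists_bound_of_continuousOn
      (s := Set.Icc (-C) C ×ˢ Set.Icc (-C) C) hcont.continuousOn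
    exact ⟨V₀, fun e s he hs => h (e, s) ⟨abs_le.1 he, abs_le.1 hs⟩⟩
  set κ₀ := C ^ 4 / 12 + 1 / 4 with hκ₀
  -- The threshold ensures `2 * C + 2 ≤ √n`, and makes `κ₀ / n` and `M / n ^ 2` at most `1 / 4`, so
  -- that the normalized total mass is at least `1 / 2`.
  refine ⟨2 * (M * (2 + V₀) + κ₀ * V₀), (2 * C + 2) ^ 2 + 4 * κ₀ + 4 * M + 1,
    fun n j p hn hj1 hjn he hs => ?_⟩
  have hC : 0 ≤ C := (abs_nonneg _).trans he
  have hκ₀' : 0 < κ₀ := by positivity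
  have hn1 : 1 ≤ (n : ℝ) := by nlinarith [sq_nonneg (2 * C + 2)]
  set R := √(n : ℝ) with hRdef
  have hR2 : R ^ 2 = n := Real.sq_sqrt (by positivity)
  have hRC : 2 * C + 2 ≤ R := Real.le_sqrt_of_sq_le (by linarith)
  have hR0 : 0 < R := by linarith
  have hn2 : (n : ℝ) ^ 2 = R ^ 4 := by rw [← hR2]; ring
  -- With `j = a + 1` and `n = a + b + 1` one gets `2 * j - n - 1 = a - b`, which is why the
  -- threshold is centred at `(n + 1) / 2`.
  obtain ⟨a, rfl⟩ : ∃ a, j = a + 1 := ⟨j - 1, by omega⟩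
  obtain ⟨b, rfl⟩ : ∃ b, n = a + b + 1 := ⟨n - a - 1, by omega⟩
  set e := (2 * ((a + 1 : ℕ) : ℝ) - ((a + b + 1 : ℕ) : ℝ) - 1) / R with hedef
  set s := R * (2 * p - 1) with hsdef
  -- That `p` lies in `[0, 1]` is not assumed; it follows from `|s| ≤ C ≤ R`.
  have hp : |2 * p - 1| ≤ 1 := by
    rw [hsdef, abs_mul, abs_of_pos hR0] at hs
    have : R * |2 * p - 1| ≤ R * 1 := by linarith
    exact le_of_mul_le_mul_left this hR0
  obtain ⟨hp1, hp2⟩ := abs_le.1 hp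
  have hab : (a : ℝ) + b + 1 = R ^ 2 := by rw [hR2]; push_cast; ring
  have hab' : (a : ℝ) - b = e * R := by
    rw [hedef, div_mul_cancel₀ _ hR0.ne']; push_cast; ring
  obtain ⟨H1, H2⟩ := H R e hRC he a b hab hab'
  rw [binomTail_eq_integral_betaKernel hR0 (by linarith) (by linarith) a b, ← hsdef]
  set N := √(2 * Real.pi) * Real.exp (e ^ 2 / 2)
  have hN0 : 0 < N := by positivity
  rw [← div_div_div_cancel_right₀ hN0.ne', hn2, ← hR2]
  have hκ : |e ^ 4 / 12 - 1 / 4| ≤ κ₀ := by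
    have h4 : e ^ 4 ≤ C ^ 4 := by
      have : e ^ 4 = |e| ^ 4 := by
        rw [show (4 : ℕ) = 2 * 2 by norm_num, pow_mul, pow_mul, sq_abs]
      rw [this]; gcongr
    have : 0 ≤ e ^ 4 := by positivity
    rw [abs_le, hκ₀]; constructor <;> linarith
  have hc0 : 0 ≤ 1 / R ^ 2 := by positivity
  have hc1 : 1 / R ^ 2 ≤ 1 := by rw [hR2, div_le_one (by linarith)]; exact hn1
  have hnκ : κ₀ * (1 / R ^ 2) ≤ 1 / 4 := by
    rw [hR2, mul_one_div, div_le_iff₀ (by linarith)]; nlinarith [sq_nonneg (2 * C + 2)]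
  have hnM : M / R ^ 4 ≤ 1 / 4 := by
    rw [← hn2, div_le_iff₀ (by positivity)]; nlinarith [sq_nonneg (2 * C + 2)]
  have hY0 : 1 / 2 ≤ (∫ s, betaKernel R a b s) / N := by
    have h1 := (abs_le.1 H2).1
    have h2 : |(e ^ 4 / 12 - 1 / 4) * (1 / R ^ 2)| ≤ 1 / 4 := by
      rw [abs_mul, abs_of_nonneg hc0]
      exact (mul_le_mul_of_nonneg_right hκ hc0).trans hnκ
    have h3 := (abs_le.1 h2).1
    linarith
  have hV' := hV e s he hs
  have hV0 : 0 ≤ V₀ := (abs_nonneg _).trans hV'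
  refine (abs_div_sub_le (H1 s) H2 hY0 (Phi_nonneg _) (Phi_le_one _) hc0 hc1).trans ?_
  calc 2 * (M / R ^ 4 * (2 + |tailCorr e (s - e) * phi (s - e)|)
        + |e ^ 4 / 12 - 1 / 4| * |tailCorr e (s - e) * phi (s - e)| * (1 / R ^ 2) ^ 2)
      ≤ 2 * (M / R ^ 4 * (2 + V₀) + κ₀ * V₀ * (1 / R ^ 2) ^ 2) := by gcongr
    _ = 2 * (M * (2 + V₀) + κ₀ * V₀) / R ^ 4 := by ring

end DigitalBarrier
end

noncomputable section
namespace DigitalBarrier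
open Params (Phi phi)
open scoped Topology

/-! ### Expansions in powers of `n^(-1/2)` -/

/-- `n^(-1/2)`. -/
def eps (n : ℕ) : ℝ := 1 / √(n : ℝ)

lemma eps_nonneg (n : ℕ) : 0 ≤ eps n := by unfold eps; positivity

lemma eps_pos {n : ℕ} (hn : 0 < n) : 0 < eps n := by
  have : (0 : ℝ) < n := Nat.cast_pos.2 hn
  unfold eps; positivity

lemma eps_le_one (n : ℕ) : eps n ≤ 1 := by
  rcases Nat.eq_zero_or_pos n with rfl | hn
  · simp [eps]
  · have : (1 : ℝ) ≤ n := by exact_mod_cast hn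
    exact div_le_one_of_le₀ (Real.one_le_sqrt.2 this) (Real.sqrt_nonneg _)

lemma eps_sq (n : ℕ) : eps n ^ 2 = 1 / (n : ℝ) := by
  rw [eps, div_pow, one_pow, Real.sq_sqrt (Nat.cast_nonneg n)]

lemma tendsto_eps : Tendsto eps atTop (𝓝 0) := by
  have h : Tendsto (fun n : ℕ => √(n : ℝ)) atTop atTop :=
    Real.tendsto_sqrt_atTop.comp tendsto_natCast_atTop_atTop
  exact (tendsto_inv_atTop_zero.comp h).congr fun n => by simp [eps]

lemma eps_pow_isBigO {j k : ℕ} (h : j ≤ k) :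
    (fun n => eps n ^ k) =O[atTop] fun n => eps n ^ j := by
  refine IsBigO.of_bound' (Eventually.of_forall fun n => ?_)
  rw [Real.norm_of_nonneg (pow_nonneg (eps_nonneg n) _),
    Real.norm_of_nonneg (pow_nonneg (eps_nonneg n) _)]
  exact pow_le_pow_of_le_one (eps_nonneg n) (eps_le_one n) h

lemma eps_pow_isBigO_one (k : ℕ) : (fun n => eps n ^ k) =O[atTop] fun _ => (1 : ℝ) := by
  simpa using eps_pow_isBigO (Nat.zero_le k)

/-- `f n = a + b n * n^(-1/2) + c n * n^(-1) + O(n^(-3/2))`, with bounded coefficients. -/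
structure HasExpansion (f : ℕ → ℝ) (a : ℝ) (b c : ℕ → ℝ) : Prop where
  bdd_fst : b =O[atTop] fun _ => (1 : ℝ)
  bdd_snd : c =O[atTop] fun _ => (1 : ℝ)
  isBigO_sub : (fun n => f n - (a + b n * eps n + c n * eps n ^ 2)) =O[atTop] fun n => eps n ^ 3

namespace HasExpansion

variable {f g : ℕ → ℝ} {a a' : ℝ} {b b' c c' : ℕ → ℝ}

lemma isBigO_sub_fst (hf : HasExpansion f a b c) :
    (fun n => f n - (a + b n * eps n)) =O[atTop] fun n => eps n ^ 2 := by
  have h1 := hf.isBigO_sub.trans (eps_pow_isBigO (show 2 ≤ 3 by norm_num))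
  have h2 : (fun n => c n * eps n ^ 2) =O[atTop] fun n => eps n ^ 2 := by
    simpa using hf.bdd_snd.mul (isBigO_refl (fun n => eps n ^ 2) atTop)
  exact (h1.add h2).congr_left fun n => by ring

lemma isBigO_sub_const (hf : HasExpansion f a b c) : (fun n => f n - a) =O[atTop] eps := by
  have h1 : (fun n => f n - (a + b n * eps n)) =O[atTop] eps := by
    simpa using hf.isBigO_sub_fst.trans (eps_pow_isBigO (show 1 ≤ 2 by norm_num))
  have h2 : (fun n => b n * eps n) =O[atTop] eps := by
    simpa using hf.bdd_fst.mul (isBigO_refl eps atTop)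
  exact (h1.add h2).congr_left fun n => by ring

lemma tendsto (hf : HasExpansion f a b c) : Tendsto f atTop (𝓝 a) := by
  have := hf.isBigO_sub_const.trans_tendsto tendsto_eps
  simpa using this.add_const a

lemma isBigO_one (hf : HasExpansion f a b c) : f =O[atTop] fun _ => (1 : ℝ) :=
  hf.tendsto.isBigO_one ℝ

lemma congr' (hf : HasExpansion f a b c) (h : f =ᶠ[atTop] g) : HasExpansion g a b c :=
  ⟨hf.bdd_fst, hf.bdd_snd, hf.isBigO_sub.congr' (by
    filter_upwards [h] with n hn; rw [hn]) EventuallyEq.rfl⟩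

lemma mul (hf : HasExpansion f a b c) (hg : HasExpansion g a' b' c') :
    HasExpansion (fun n => f n * g n) (a * a') (fun n => a * b' n + b n * a')
      (fun n => a * c' n + b n * b' n + c n * a') where
  bdd_fst := by
    simpa using (hg.bdd_fst.const_mul_left a).add
      ((hf.bdd_fst.const_mul_left a').congr_left fun n => mul_comm _ _)
  bdd_snd := by
    have h1 : (fun n => b n * b' n) =O[atTop] fun _ => (1 : ℝ) := by
      simpa using hf.bdd_fst.mul hg.bdd_fst
    exact ((hg.bdd_snd.const_mul_left a).add h1).add
      ((hf.bdd_snd.const_mul_left a').congr_left fun n => mul_comm _ _)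
  isBigO_sub := by
    have hone : ∀ k : ℕ, (fun n => eps n ^ k) =O[atTop] fun _ => (1 : ℝ) := eps_pow_isBigO_one
    have h1 : (fun n => (f n - (a + b n * eps n + c n * eps n ^ 2)) * g n)
        =O[atTop] fun n => eps n ^ 3 := by
      simpa using hf.isBigO_sub.mul hg.isBigO_one
    have hF : (fun n => a + b n * eps n + c n * eps n ^ 2) =O[atTop] fun _ => (1 : ℝ) := by
      have h := hf.isBigO_one.sub (hf.isBigO_sub.trans (hone 3))
      exact h.congr_left fun n => by ring
    have h2 : (fun n => (a + b n * eps n + c n * eps n ^ 2)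
        * (g n - (a' + b' n * eps n + c' n * eps n ^ 2))) =O[atTop] fun n => eps n ^ 3 := by
      simpa using hF.mul hg.isBigO_sub
    have h3 : (fun n => (b n * c' n + c n * b' n + c n * c' n * eps n ^ 1) * eps n ^ 3)
        =O[atTop] fun n => eps n ^ 3 := by
      have e1 : (fun n => b n * c' n) =O[atTop] fun _ => (1 : ℝ) := by
        simpa using hf.bdd_fst.mul hg.bdd_snd
      have e2 : (fun n => c n * b' n) =O[atTop] fun _ => (1 : ℝ) := by
        simpa using hf.bdd_snd.mul hg.bdd_fst
      have e3 : (fun n => c n * c' n * eps n ^ 1) =O[atTop] fun _ => (1 : ℝ) := by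
        simpa using (hf.bdd_snd.mul hg.bdd_snd).mul (hone 1)
      simpa using ((e1.add e2).add e3).mul (isBigO_refl (fun n => eps n ^ 3) atTop)
    exact ((h1.add h2).add h3).congr_left fun n => by ring

/-- Composition with a function that has a Taylor expansion of second order. -/
lemma comp {φ : ℝ → ℝ} {φ₁ φ₂ : ℝ}
    (hφ : (fun t => φ (a + t) - (φ a + φ₁ * t + φ₂ * t ^ 2)) =O[𝓝 0] fun t => t ^ 3)
    (hf : HasExpansion f a b c) :
    HasExpansion (fun n => φ (f n)) (φ a) (fun n => φ₁ * b n)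
      (fun n => φ₁ * c n + φ₂ * b n ^ 2) where
  bdd_fst := hf.bdd_fst.const_mul_left _
  bdd_snd := by
    have h := hf.bdd_fst.pow 2
    simp only [one_pow] at h
    exact (hf.bdd_snd.const_mul_left _).add (h.const_mul_left _)
  isBigO_sub := by
    have hu := hf.isBigO_sub_const
    have hu0 : Tendsto (fun n => f n - a) atTop (𝓝 0) := hu.trans_tendsto tendsto_eps
    have h1 := (hφ.comp_tendsto hu0).trans (hu.pow 3)
    have h2 := hf.isBigO_sub.const_mul_left φ₁
    -- The difference of squares `(f - a)^2 - (b ε)^2` factors into `O(ε ^ 2)` times `O(ε)`.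
    have h3 : (fun n => φ₂ * ((f n - (a + b n * eps n)) * ((f n - a) + b n * eps n)))
        =O[atTop] fun n => eps n ^ 3 := by
      have hb : (fun n => b n * eps n) =O[atTop] eps := by
        simpa using hf.bdd_fst.mul (isBigO_refl eps atTop)
      have h := hf.isBigO_sub_fst.mul (hu.add hb)
      refine IsBigO.const_mul_left ?_ φ₂
      exact h.congr_right fun n => by ring
    refine ((h1.add h2).add h3).congr_left fun n => ?_
    simp only [Function.comp_apply, add_sub_cancel]
    ring

end HasExpansion

/-! ### Taylor expansions -/

/-- By the mean value inequality, a bound on the derivative gains one power of `x`. Applied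
repeatedly, it yields Taylor remainders. -/
lemma isBigO_pow_succ_of_hasDerivAt {g g' : ℝ → ℝ} {k : ℕ} (hg : ∀ x, HasDerivAt g (g' x) x)
    (h0 : g 0 = 0) (hk : g' =O[𝓝 0] fun x => x ^ k) : g =O[𝓝 0] fun x => x ^ (k + 1) := by
  obtain ⟨c, hc0, hc⟩ := hk.exists_nonneg
  obtain ⟨δ, hδ, hball⟩ := Metric.eventually_nhds_iff.1 hc.bound
  refine IsBigO.of_bound c ?_
  filter_upwards [Metric.ball_mem_nhds (0 : ℝ) hδ] with x hx
  have hx' : |x| < δ := by simpa using hx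
  have := (convex_Icc (-|x|) |x|).norm_image_sub_le_of_norm_hasDerivWithin_le
    (f := g) (f' := g') (C := c * |x| ^ k) (x := 0) (y := x)
    (fun y _ => (hg y).hasDerivWithinAt) (fun y hy => ?_) (by simp) (abs_le.1 le_rfl)
  · rw [h0, sub_zero, sub_zero] at this
    refine this.trans (le_of_eq ?_)
    rw [Real.norm_eq_abs, norm_pow, Real.norm_eq_abs, pow_succ, mul_assoc]
  · have hy' : |y| ≤ |x| := abs_le.2 hy
    have h := hball (y := y) (by simpa using hy'.trans_lt hx')
    rw [norm_pow, Real.norm_eq_abs y] at h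
    exact h.trans (by gcongr)

lemma Phi_taylor (d : ℝ) :
    (fun t => Phi (d + t) - (Phi d + phi d * t + -d / 2 * phi d * t ^ 2))
      =O[𝓝 0] fun t => t ^ 3 := by
  have hs : ∀ t : ℝ, HasDerivAt (fun t : ℝ => d + t) 1 t := fun t => (hasDerivAt_id t).const_add d
  have hphi : ∀ t, HasDerivAt (fun t => phi (d + t)) (-(d + t) * phi (d + t)) t := fun t => by
    exact ((hasDerivAt_phi (d + t)).comp t (hs t)).congr_deriv (mul_one _)
  have hPhi : ∀ t, HasDerivAt (fun t => Phi (d + t)) (phi (d + t)) t := fun t => by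
    exact ((hasDerivAt_Phi (d + t)).comp t (hs t)).congr_deriv (mul_one _)
  have h2 : (fun t => -(d + t) * phi (d + t) + d * phi d) =O[𝓝 0] fun t : ℝ => t ^ 1 := by
    have hd : DifferentiableAt ℝ (fun t => -(d + t) * phi (d + t)) 0 :=
      (((hs 0).neg).mul (hphi 0)).differentiableAt
    have := hd.isBigO_sub
    simpa using this
  have h1 : (fun t => phi (d + t) - phi d + d * phi d * t) =O[𝓝 0] fun t : ℝ => t ^ 2 := by
    refine isBigO_pow_succ_of_hasDerivAt (k := 1) (fun t => ?_) (by simp) h2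
    exact (((hphi t).sub_const _).add ((hasDerivAt_id t).const_mul (d * phi d))).congr_deriv
      (by simp)
  refine isBigO_pow_succ_of_hasDerivAt (k := 2) (fun t => ?_) (by simp) h1
  refine ((hPhi t).sub ((((hasDerivAt_id t).const_mul (phi d)).const_add (Phi d)).add
    ((hasDerivAt_pow 2 t).const_mul (-d / 2 * phi d)))).congr_deriv ?_
  simp; ring

lemma exp_taylor (d : ℝ) :
    (fun t => Real.exp (d + t) - (Real.exp d + Real.exp d * t + Real.exp d / 2 * t ^ 2))
      =O[𝓝 0] fun t => t ^ 3 := by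
  have h := (Real.exp_sub_sum_range_isBigO_pow 3).const_mul_left (Real.exp d)
  refine h.congr_left fun t => ?_
  simp [Finset.sum_range_succ, Real.exp_add]
  ring

/-! ### Expansion of binomial tails along sequences -/

/-- The argument of `Phi` expands as `A - e₀ + x ε + B ε ^ 2`: the rounding `x` of the threshold is
its only first-order term. -/
lemma HasExpansion.binomTail {p : ℕ → ℝ} {j : ℕ → ℕ} {A e₀ : ℝ} {B x : ℕ → ℝ}
    (hp : HasExpansion (fun n => √(n : ℝ) * (2 * p n - 1)) A (fun _ => 0) B)
    (hx : x =O[atTop] fun _ => (1 : ℝ))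
    (hj : ∀ᶠ n : ℕ in atTop, (2 * (j n : ℝ) - n - 1) / √(n : ℝ) = e₀ - x n * eps n) :
    HasExpansion (fun n => DigitalBarrier.binomTail (p n) n (j n)) (Phi (A - e₀))
      (fun n => phi (A - e₀) * x n)
      (fun n => phi (A - e₀) * B n + -(A - e₀) / 2 * phi (A - e₀) * x n ^ 2
        + tailCorr e₀ (A - e₀) * phi (A - e₀)) := by
  set d := A - e₀ with hd
  set e : ℕ → ℝ := fun n => e₀ - x n * eps n with he
  set s : ℕ → ℝ := fun n => √(n : ℝ) * (2 * p n - 1) with hs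
  have hxe : (fun n => x n * eps n) =O[atTop] eps := by
    simpa using hx.mul (isBigO_refl eps atTop)
  have hw : HasExpansion (fun n => s n - e n) d x B := by
    refine ⟨hx, hp.bdd_snd, hp.isBigO_sub.congr_left fun n => ?_⟩
    simp only [he, hs, hd]; ring
  have hΦ := hw.comp (Phi_taylor d)
  have het : Tendsto e atTop (𝓝 e₀) := by
    have := (hxe.trans_tendsto tendsto_eps).const_sub e₀
    rwa [sub_zero] at this
  -- This term carries a factor `1 / n`, so its limit with error `O(ε)` is enough.
  have hcorr : (fun n => tailCorr (e n) (s n - e n) * phi (s n - e n) - tailCorr e₀ d * phi d)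
      =O[atTop] eps := by
    have hdiff : DifferentiableAt ℝ (fun z : ℝ × ℝ => tailCorr z.1 z.2 * phi z.2) (e₀, d) := by
      have h1 : DifferentiableAt ℝ (fun z : ℝ × ℝ => phi z.2) (e₀, d) :=
        DifferentiableAt.comp (g := phi) (f := Prod.snd) (e₀, d)
          (hasDerivAt_phi d).differentiableAt differentiableAt_snd
      refine DifferentiableAt.mul ?_ h1
      unfold tailCorr
      fun_prop
    have ht : Tendsto (fun n => (e n, s n - e n)) atTop (𝓝 (e₀, d)) := het.prodMk_nhds hw.tendsto
    refine (hdiff.isBigO_sub.comp_tendsto ht).trans ?_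
    refine IsBigO.trans ?_ (isBigO_refl eps atTop)
    have h1 : (fun n => e n - e₀) =O[atTop] eps := by
      refine hxe.neg_left.congr_left fun n => ?_
      simp only [he]; ring
    exact h1.prod_left hw.isBigO_sub_const
  obtain ⟨Cₑ, hCe⟩ := (het.isBigO_one ℝ).bound
  obtain ⟨Cₛ, hCs⟩ := hp.isBigO_one.bound
  obtain ⟨M, N₀, H⟩ := binomTail_approx (max Cₑ Cₛ)
  have hsqrt : Tendsto (fun n : ℕ => √(n : ℝ)) atTop atTop :=
    Real.tendsto_sqrt_atTop.comp tendsto_natCast_atTop_atTop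
  have hmain : (fun n => DigitalBarrier.binomTail (p n) n (j n)
      - (Phi (s n - e n) + 1 / n * (tailCorr (e n) (s n - e n) * phi (s n - e n))))
      =O[atTop] fun n => eps n ^ 3 := by
    refine IsBigO.trans ?_ (eps_pow_isBigO (show 3 ≤ 4 by norm_num))
    refine IsBigO.of_bound M ?_
    filter_upwards [hCe, hCs, hj, tendsto_natCast_atTop_atTop.eventually_ge_atTop N₀,
      hsqrt.eventually_gt_atTop (Cₑ + 1), eventually_ge_atTop 1] with n h1 h2 h3 h4 h5 h6
    simp only [Real.norm_eq_abs, norm_one, mul_one] at h1 h2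
    have hn : (1 : ℝ) ≤ n := by exact_mod_cast h6
    have hs1 : 1 ≤ √(n : ℝ) := Real.one_le_sqrt.2 hn
    have hs2 : √(n : ℝ) ^ 2 = n := Real.sq_sqrt (by positivity)
    have h3' : 2 * (j n : ℝ) - n - 1 = e n * √(n : ℝ) := by
      rw [div_eq_iff (by positivity)] at h3
      exact h3
    -- From `|e n| ≤ Cₑ < √n - 1`; this places the index between `1` and `n`, as the uniform
    -- estimate requires.
    have hle : |2 * (j n : ℝ) - n - 1| ≤ n - √(n : ℝ) := by
      rw [h3', abs_mul, abs_of_nonneg (Real.sqrt_nonneg _)]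
      nlinarith
    obtain ⟨hl1, hl2⟩ := abs_le.1 hle
    have hj1 : 1 ≤ j n := by
      have : (0 : ℝ) < j n := by linarith
      exact_mod_cast this
    have hj2 : j n ≤ n := by
      have : (j n : ℝ) ≤ n := by linarith
      exact_mod_cast this
    have := H n (j n) (p n) h4 hj1 hj2 (by rw [h3]; exact h1.trans (le_max_left _ _))
      (h2.trans (le_max_right _ _))
    rw [h3] at this
    rw [Real.norm_eq_abs, norm_pow, Real.norm_of_nonneg (eps_nonneg n),
      show eps n ^ 4 = (eps n ^ 2) ^ 2 by ring, eps_sq, div_pow, one_pow, mul_one_div]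
    exact this
  refine ⟨hΦ.bdd_fst, hΦ.bdd_snd.add (isBigO_const_const _ one_ne_zero _), ?_⟩
  have h2 : (fun n => eps n ^ 2 * (tailCorr (e n) (s n - e n) * phi (s n - e n)
      - tailCorr e₀ d * phi d)) =O[atTop] fun n => eps n ^ 3 :=
    ((isBigO_refl (fun n => eps n ^ 2) atTop).mul hcorr).congr_right fun n => by ring
  refine ((hmain.add h2).add hΦ.isBigO_sub).congr_left fun n => ?_
  rw [← eps_sq]
  ring

/-! ### Expansion of the risk-neutral probability -/

/-- The numerator and denominator of `(2p - 1) / x` for `x = n^(-1/2)`, `c = σ √T`, `ρ = r T`. The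
hypotheses `hA` and `hB` match the coefficients of `x ^ 2` and `x ^ 4`; all odd powers below `x ^ 5`
cancel. -/
lemma exp_pair_isBigO (c ρ : ℝ) (A B : ℝ) (hA : 2 * c * A = 2 * ρ - c ^ 2)
    (hB : 2 * c * B = ρ ^ 2 - c ^ 4 / 12 - c ^ 3 * A / 3) :
    (fun x : ℝ => (2 * Real.exp (ρ * x ^ 2) - Real.exp (c * x) - Real.exp (-(c * x)))
      - x * (Real.exp (c * x) - Real.exp (-(c * x))) * (A + B * x ^ 2))
      =O[𝓝 0] fun x => x ^ 5 := by
  have hlin : ∀ a : ℝ, Tendsto (fun x : ℝ => a * x) (𝓝 0) (𝓝 0) := fun a => by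
    have : Continuous fun x : ℝ => a * x := by fun_prop
    simpa using this.tendsto 0
  have hsq : Tendsto (fun x : ℝ => ρ * x ^ 2) (𝓝 0) (𝓝 0) := by
    have : Continuous fun x : ℝ => ρ * x ^ 2 := by fun_prop
    simpa using this.tendsto 0
  have hpow : ∀ {j k : ℕ}, j ≤ k → (fun x : ℝ => x ^ k) =O[𝓝 0] fun x => x ^ j :=
    fun h => IsBigO.of_bound' (by
      filter_upwards [Metric.ball_mem_nhds (0 : ℝ) one_pos] with x hx
      rw [norm_pow, norm_pow]
      exact pow_le_pow_of_le_one (norm_nonneg x) (mem_ball_zero_iff.1 hx).le h)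
  have hexp : ∀ a : ℝ, (fun x => Real.exp (a * x)
      - (1 + a * x + (a * x) ^ 2 / 2 + (a * x) ^ 3 / 6 + (a * x) ^ 4 / 24))
      =O[𝓝 0] fun x => x ^ 5 := by
    intro a
    have h := (Real.exp_sub_sum_range_isBigO_pow 5).comp_tendsto (hlin a)
    refine (h.congr_left (f₂ := fun x => Real.exp (a * x)
      - (1 + a * x + (a * x) ^ 2 / 2 + (a * x) ^ 3 / 6 + (a * x) ^ 4 / 24)) fun x => ?_).trans ?_
    · simp [Finset.sum_range_succ, Nat.factorial]
    · have : (fun x : ℝ => (a * x) ^ 5) =O[𝓝 0] fun x => x ^ 5 := by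
        simp only [mul_pow]
        exact (isBigO_refl _ _).const_mul_left _
      exact this
  have hE : (fun x => Real.exp (ρ * x ^ 2) - (1 + ρ * x ^ 2 + (ρ * x ^ 2) ^ 2 / 2))
      =O[𝓝 0] fun x => x ^ 5 := by
    have h := (Real.exp_sub_sum_range_isBigO_pow 3).comp_tendsto hsq
    refine (h.congr_left (f₂ := fun x => Real.exp (ρ * x ^ 2)
      - (1 + ρ * x ^ 2 + (ρ * x ^ 2) ^ 2 / 2)) fun x => ?_).trans ?_
    · simp [Finset.sum_range_succ, Nat.factorial]
    · have : (fun x : ℝ => (ρ * x ^ 2) ^ 3) =O[𝓝 0] fun x => x ^ 5 := by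
        simp only [mul_pow, ← pow_mul]
        exact (hpow (by norm_num)).const_mul_left _
      exact this
  have hp := hexp c
  have hm := hexp (-c)
  have hbd : (fun x : ℝ => x * (A + B * x ^ 2)) =O[𝓝 0] fun _ => (1 : ℝ) := by
    have : Continuous fun x : ℝ => x * (A + B * x ^ 2) := by fun_prop
    exact (this.tendsto 0).isBigO_one ℝ
  have h6 : (fun x : ℝ => -(c ^ 3 * B / 3) * x ^ 6) =O[𝓝 0] fun x => x ^ 5 :=
    (hpow (by norm_num)).const_mul_left _
  have hprod := (hp.sub hm).mul hbd
  simp only [mul_one] at hprod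
  refine ((((hE.const_mul_left 2).sub hp).sub hm).sub hprod |>.add h6).congr_left fun x => ?_
  simp only [neg_mul]
  linear_combination x ^ 2 * hA + x ^ 4 * hB

/-- The denominator is at least `2 * c * x ^ 2` because `sinh y ≥ y` for `y ≥ 0`, so dividing costs
two powers of `x`. -/
lemma ratio_isBigO {c : ℝ} (hc : 0 < c) (ρ : ℝ) {A B : ℝ} (hA : 2 * c * A = 2 * ρ - c ^ 2)
    (hB : 2 * c * B = ρ ^ 2 - c ^ 4 / 12 - c ^ 3 * A / 3) :
    (fun x : ℝ => (2 * Real.exp (ρ * x ^ 2) - Real.exp (c * x) - Real.exp (-(c * x)))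
      / (x * (Real.exp (c * x) - Real.exp (-(c * x)))) - (A + B * x ^ 2))
      =O[𝓝[>] 0] fun x => x ^ 3 := by
  have h1 := (exp_pair_isBigO c ρ A B hA hB).mono (nhdsWithin_le_nhds (s := Set.Ioi 0))
  obtain ⟨K, hK⟩ := h1.bound
  refine IsBigO.of_bound (K / (2 * c)) ?_
  filter_upwards [hK, self_mem_nhdsWithin] with x hx hx0
  have hx0 : 0 < x := hx0
  have hsinh : 2 * (c * x) ≤ Real.exp (c * x) - Real.exp (-(c * x)) := by
    have := Real.self_le_sinh_iff.2 (show 0 ≤ c * x by positivity)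
    rw [Real.sinh_eq] at this
    linarith
  have hcx : 0 < c * x := by positivity
  have hden : 2 * c * x ^ 2 ≤ x * (Real.exp (c * x) - Real.exp (-(c * x))) := by nlinarith
  have hden0 : 0 < x * (Real.exp (c * x) - Real.exp (-(c * x))) :=
    lt_of_lt_of_le (by positivity) hden
  rw [div_sub' hden0.ne', norm_div, Real.norm_of_nonneg hden0.le, div_le_iff₀ hden0,
    norm_pow, Real.norm_of_nonneg hx0.le]
  rw [norm_pow, Real.norm_of_nonneg hx0.le] at hx
  refine hx.trans ?_
  have hK0 : 0 ≤ K := by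
    have : 0 ≤ K * x ^ 5 := (norm_nonneg _).trans hx
    exact nonneg_of_mul_nonneg_left this (by positivity)
  calc K * x ^ 5 = K / (2 * c) * x ^ 3 * (2 * c * x ^ 2) := by field_simp
    _ ≤ _ := by gcongr

end DigitalBarrier
end

noncomputable section
namespace DigitalBarrier
open Params (Phi phi)
open scoped Topology

/-! ### Expansion of the prices in the tree -/

namespace Params

variable {m : Params}

lemma sqrt_dt (hT : 0 < m.T) (n : ℕ) : √(m.dt n) = √m.T * eps n := by
  rw [dt, Real.sqrt_div hT.le, eps, mul_one_div]

lemma hasExpansion_upProb (hσ : 0 < m.σ) (hT : 0 < m.T) :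
    HasExpansion (fun n : ℕ => √(n : ℝ) * (2 * m.upProb n - 1)) (2 * m.alpha * √m.T)
      (fun _ => 0) (fun _ => 2 * m.beta * m.T * √m.T) := by
  have hsT : 0 < √m.T := Real.sqrt_pos.2 hT
  have hT2 : √m.T ^ 2 = m.T := Real.sq_sqrt hT.le
  have hc : 0 < m.σ * √m.T := by positivity
  have h := ratio_isBigO hc (m.r * m.T) (A := 2 * m.alpha * √m.T) (B := 2 * m.beta * m.T * √m.T)
    (by
      have e : 2 * (m.σ * √m.T) * (2 * m.alpha * √m.T) = 4 * m.σ * m.alpha * √m.T ^ 2 := by ring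
      rw [e, mul_pow, hT2, alpha]; field_simp; ring)
    (by
      have e1 : 2 * (m.σ * √m.T) * (2 * m.beta * m.T * √m.T)
          = 4 * m.σ * m.beta * m.T * √m.T ^ 2 := by ring
      have e2 : (m.σ * √m.T) ^ 4 = m.σ ^ 4 * (√m.T ^ 2) ^ 2 := by ring
      have e3 : (m.σ * √m.T) ^ 3 * (2 * m.alpha * √m.T)
          = 2 * m.σ ^ 3 * m.alpha * (√m.T ^ 2) ^ 2 := by ring
      rw [e1, e2, e3, hT2, alpha, beta]; field_simp; ring)
  have ht : Tendsto eps atTop (𝓝[>] 0) := by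
    refine tendsto_nhdsWithin_iff.2 ⟨tendsto_eps, ?_⟩
    filter_upwards [eventually_gt_atTop 0] with n hn using eps_pos hn
  refine ⟨isBigO_const_const _ one_ne_zero _, isBigO_const_const _ one_ne_zero _, ?_⟩
  refine (h.comp_tendsto ht).congr' ?_ EventuallyEq.rfl
  filter_upwards [eventually_gt_atTop 0] with n hn
  have hn' : (0 : ℝ) < n := Nat.cast_pos.2 hn
  have hε := eps_pos hn
  have hsq : √(n : ℝ) = 1 / eps n := by rw [eps, one_div_one_div]
  have hdt : m.r * m.dt n = m.r * m.T * eps n ^ 2 := by rw [dt, eps_sq]; ring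
  have hup : m.up n = Real.exp (m.σ * √m.T * eps n) := by rw [up, sqrt_dt hT, mul_assoc]
  have hd : Real.exp (m.σ * √m.T * eps n) - Real.exp (-(m.σ * √m.T * eps n)) ≠ 0 := by
    have h1 : 0 < m.σ * √m.T * eps n := by positivity
    exact (sub_pos.2 (Real.exp_lt_exp.2 (by linarith))).ne'
  simp only [Function.comp_apply, zero_mul, add_zero]
  congr 1
  rw [upProb, hdt, hup, ← Real.exp_neg, hsq]
  generalize Real.exp (m.σ * √m.T * eps n) = u at hd ⊢
  generalize Real.exp (-(m.σ * √m.T * eps n)) = v at hd ⊢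
  field_simp
  ring

lemma posK_isBigO : m.posK =O[atTop] fun _ => (1 : ℝ) := by
  refine IsBigO.of_bound 1 (Eventually.of_forall fun n => ?_)
  have h1 := Int.fract_nonneg (Real.log (m.s₀ / m.K) / (2 * m.σ * √(m.dt n)) - (n : ℝ) / 2)
  have h2 := Int.fract_lt_one (Real.log (m.s₀ / m.K) / (2 * m.σ * √(m.dt n)) - (n : ℝ) / 2)
  rw [Real.norm_eq_abs, norm_one, mul_one, posK, abs_le]
  constructor <;> linarith

lemma posL_isBigO : m.posL =O[atTop] fun _ => (1 : ℝ) := by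
  refine IsBigO.of_bound 1 (Eventually.of_forall fun n => ?_)
  have h1 := Int.fract_nonneg (2 * m.lL n)
  have h2 := Int.fract_lt_one (2 * m.lL n)
  rw [Real.norm_eq_abs, norm_one, mul_one, posL, abs_le]
  constructor <;> linarith

/-- The least number of up moves that ends at the strike or above. -/
def strikeIndex (m : Params) (n : ℕ) : ℕ :=
  (-⌊Real.log (m.s₀ / m.K) / (2 * m.σ * √(m.dt n)) - (n : ℝ) / 2⌋).toNat

/-- The number of down moves that leads to the barrier or below. -/
def barrierIndex (m : Params) (n : ℕ) : ℕ :=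
  (-⌊Real.log (m.L / m.s₀) / (m.σ * √(m.dt n))⌋).toNat

lemma barrierIndex_eq (hs₀ : 0 < m.s₀) (hL : 0 < m.L) (hLs₀ : m.L < m.s₀) (hσ : 0 < m.σ)
    (n : ℕ) : (m.barrierIndex n : ℤ) = -⌊Real.log (m.L / m.s₀) / (m.σ * √(m.dt n))⌋ := by
  have h : Real.log (m.L / m.s₀) / (m.σ * √(m.dt n)) ≤ 0 :=
    div_nonpos_of_nonpos_of_nonneg
      (Real.log_nonpos (by positivity) ((div_le_one hs₀).2 hLs₀.le)) (by positivity)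
  rw [barrierIndex, Int.toNat_of_nonneg]
  have : ⌊Real.log (m.L / m.s₀) / (m.σ * √(m.dt n))⌋ ≤ 0 := by
    have h1 := Int.floor_le (Real.log (m.L / m.s₀) / (m.σ * √(m.dt n)))
    have h2 : (⌊Real.log (m.L / m.s₀) / (m.σ * √(m.dt n))⌋ : ℝ) ≤ 0 := h1.trans h
    exact_mod_cast h2
  omega

lemma log_div_mul_sqrt_dt (hT : 0 < m.T) (y : ℝ) (n : ℕ) :
    y / (m.σ * √(m.dt n)) = y / (m.σ * √m.T) * √(n : ℝ) := by
  rw [sqrt_dt hT, eps, mul_one_div, mul_div_assoc', div_div_eq_mul_div, div_mul_eq_mul_div]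

/-- The truncation by `toNat` is inactive for large `n`, where `n / 2` dominates the term of order
`√n`. -/
lemma strikeIndex_eq (hT : 0 < m.T) : ∀ᶠ n : ℕ in atTop, (m.strikeIndex n : ℤ)
    = -⌊Real.log (m.s₀ / m.K) / (2 * m.σ * √(m.dt n)) - (n : ℝ) / 2⌋ := by
  have hsqrt : Tendsto (fun n : ℕ => √(n : ℝ)) atTop atTop :=
    Real.tendsto_sqrt_atTop.comp tendsto_natCast_atTop_atTop
  filter_upwards [hsqrt.eventually_ge_atTop (Real.log (m.s₀ / m.K) / (m.σ * √m.T))] with n hn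
  have hx : Real.log (m.s₀ / m.K) / (2 * m.σ * √(m.dt n)) - (n : ℝ) / 2 ≤ 0 := by
    have e1 : Real.log (m.s₀ / m.K) / (2 * m.σ * √(m.dt n))
        = Real.log (m.s₀ / m.K) / (m.σ * √(m.dt n)) / 2 := by
      rw [div_div, mul_comm _ (2 : ℝ), mul_assoc]
    rw [e1, log_div_mul_sqrt_dt hT]
    have hs := Real.sq_sqrt (Nat.cast_nonneg (α := ℝ) n)
    nlinarith [Real.sqrt_nonneg (n : ℝ)]
  rw [strikeIndex, Int.toNat_of_nonneg]
  have h1 := Int.floor_le (Real.log (m.s₀ / m.K) / (2 * m.σ * √(m.dt n)) - (n : ℝ) / 2)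
  have h2 : ⌊Real.log (m.s₀ / m.K) / (2 * m.σ * √(m.dt n)) - (n : ℝ) / 2⌋ ≤ 0 := by
    exact_mod_cast h1.trans hx
  omega

/-- The shift by `-1` in the centring is what turns the fractional part `f` into `1 - 2 * f`, that
is, into `posK`. -/
lemma strikeIndex_scaled (hT : 0 < m.T) : ∀ᶠ n : ℕ in atTop,
    (2 * (m.strikeIndex n : ℝ) - n - 1) / √(n : ℝ)
      = -(Real.log (m.s₀ / m.K) / (m.σ * √m.T)) - m.posK n * eps n := by
  filter_upwards [strikeIndex_eq hT, eventually_gt_atTop 0] with n hn hn0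
  have hn' : (0 : ℝ) < √(n : ℝ) := Real.sqrt_pos.2 (Nat.cast_pos.2 hn0)
  have h : (m.strikeIndex n : ℝ)
      = -(⌊Real.log (m.s₀ / m.K) / (2 * m.σ * √(m.dt n)) - (n : ℝ) / 2⌋ : ℝ) := by
    exact_mod_cast hn
  have e1 : Real.log (m.s₀ / m.K) / (2 * m.σ * √(m.dt n))
      = Real.log (m.s₀ / m.K) / (m.σ * √m.T) * √(n : ℝ) / 2 := by
    rw [← log_div_mul_sqrt_dt hT, div_div, mul_comm _ (2 : ℝ), mul_assoc]
  have hf := Int.self_sub_floor (Real.log (m.s₀ / m.K) / (2 * m.σ * √(m.dt n)) - (n : ℝ) / 2)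
  have hk : 2 * (m.strikeIndex n : ℝ) - n - 1
      = -(Real.log (m.s₀ / m.K) / (m.σ * √m.T)) * √(n : ℝ) - m.posK n := by
    rw [posK, ← hf, h, e1]; ring
  rw [hk, eps]
  field_simp

/-- The number `2 * lL n` differs from the scaled barrier by the integer `n`, so both have the
fractional part `posL`. -/
lemma barrierIndex_scaled (hs₀ : 0 < m.s₀) (hL : 0 < m.L) (hLs₀ : m.L < m.s₀) (hσ : 0 < m.σ)
    (hT : 0 < m.T) {n : ℕ} (hn : 0 < n) : m.barrierIndex n * eps n
      = Real.log (m.s₀ / m.L) / (m.σ * √m.T) + m.posL n * eps n := by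
  have hn' : (0 : ℝ) < √(n : ℝ) := Real.sqrt_pos.2 (Nat.cast_pos.2 hn)
  have h : (m.barrierIndex n : ℝ) = -(⌊Real.log (m.L / m.s₀) / (m.σ * √(m.dt n))⌋ : ℝ) := by
    exact_mod_cast barrierIndex_eq hs₀ hL hLs₀ hσ n
  have e1 : 2 * m.lL n = Real.log (m.L / m.s₀) / (m.σ * √(m.dt n)) + n := by
    rw [lL, mul_add, mul_assoc 2, mul_div_assoc', mul_div_mul_left _ _ two_ne_zero]; ring
  have hf := Int.self_sub_floor (Real.log (m.L / m.s₀) / (m.σ * √(m.dt n)))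
  have hlog : Real.log (m.L / m.s₀) = -Real.log (m.s₀ / m.L) := by
    rw [← Real.log_inv, inv_div]
  have ha : (m.barrierIndex n : ℝ)
      = Real.log (m.s₀ / m.L) / (m.σ * √m.T) * √(n : ℝ) + m.posL n := by
    rw [posL, e1, Int.fract_add_natCast, ← hf, h, log_div_mul_sqrt_dt hT, hlog]; ring
  rw [ha, eps]
  field_simp

/-- Coefficient of the density in the term of order `1 / n` of the expansion of the binomial tail
at the point `d`. -/
def tailCoeff (m : Params) (d : ℝ) : ℝ :=
  2 * m.T * (m.alpha ^ 2 * d + m.beta * √m.T)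
    + (2 * m.alpha * √m.T / 3 - d / 12) * (1 - d ^ 2)

lemma tailCorr_eq_tailCoeff (hT : 0 < m.T) (d : ℝ) :
    2 * m.beta * m.T * √m.T + tailCorr (2 * m.alpha * √m.T - d) d = m.tailCoeff d := by
  have hT2 : √m.T ^ 2 = m.T := Real.sq_sqrt hT.le
  rw [tailCorr, tailCoeff]
  linear_combination (2 * m.alpha ^ 2 * d) * hT2

lemma d12_eq (hσ : 0 < m.σ) (hT : 0 < m.T) :
    m.d12 = 2 * m.alpha * √m.T + Real.log (m.s₀ / m.K) / (m.σ * √m.T) := by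
  have hsT : 0 < √m.T := Real.sqrt_pos.2 hT
  have hT2 : √m.T ^ 2 = m.T := Real.sq_sqrt hT.le
  rw [d12, d11, alpha]
  generalize Real.log (m.s₀ / m.K) = l
  field_simp
  rw [hT2]
  ring

lemma d22_eq (hs₀ : 0 < m.s₀) (hL : 0 < m.L) (hLK : m.L < m.K) (hσ : 0 < m.σ) (hT : 0 < m.T) :
    m.d22 = 2 * m.alpha * √m.T + Real.log (m.s₀ / m.K) / (m.σ * √m.T)
      - 2 * (Real.log (m.s₀ / m.L) / (m.σ * √m.T)) := by
  have hK := hL.trans hLK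
  have hlog : Real.log (m.L ^ 2 / (m.s₀ * m.K))
      = Real.log (m.s₀ / m.K) - 2 * Real.log (m.s₀ / m.L) := by
    rw [Real.log_div (by positivity) (by positivity), Real.log_pow, Real.log_mul hs₀.ne' hK.ne',
      Real.log_div hs₀.ne' hK.ne', Real.log_div hs₀.ne' hL.ne']
    push_cast; ring
  rw [← d12_eq hσ hT, d22, d21, hlog, d12, d11]
  ring

lemma hasExpansion_vanilla (hσ : 0 < m.σ) (hT : 0 < m.T) :
    HasExpansion (fun n => binomTail (m.upProb n) n (m.strikeIndex n)) (Phi m.d12)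
      (fun n => phi m.d12 * m.posK n)
      (fun n => phi m.d12 * m.tailCoeff m.d12 + -m.d12 / 2 * phi m.d12 * m.posK n ^ 2) := by
  have h := (hasExpansion_upProb hσ hT).binomTail posK_isBigO (strikeIndex_scaled hT)
  rw [sub_neg_eq_add, ← d12_eq hσ hT] at h
  convert h using 2 with n
  rw [← tailCorr_eq_tailCoeff hT, show 2 * m.alpha * √m.T - m.d12
    = -(Real.log (m.s₀ / m.K) / (m.σ * √m.T)) by rw [d12_eq hσ hT]; ring]
  ring

/-- Adding `barrierIndex` to the threshold moves the limit point from `d12` to `d22`. The factor `2`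
in `2 * j` turns the rounding `posK` into `posK - 2 * posL`. -/
lemma hasExpansion_reflected (hs₀ : 0 < m.s₀) (hL : 0 < m.L) (hLs₀ : m.L < m.s₀)
    (hLK : m.L < m.K) (hσ : 0 < m.σ) (hT : 0 < m.T) :
    HasExpansion (fun n => binomTail (m.upProb n) n (m.strikeIndex n + m.barrierIndex n))
      (Phi m.d22) (fun n => phi m.d22 * (m.posK n - 2 * m.posL n))
      (fun n => phi m.d22 * m.tailCoeff m.d22
        + -m.d22 / 2 * phi m.d22 * (m.posK n - 2 * m.posL n) ^ 2) := by
  have h := (hasExpansion_upProb hσ hT).binomTail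
    (j := fun n => m.strikeIndex n + m.barrierIndex n)
    (x := fun n => m.posK n - 2 * m.posL n)
    (e₀ := 2 * (Real.log (m.s₀ / m.L) / (m.σ * √m.T)) - Real.log (m.s₀ / m.K) / (m.σ * √m.T))
    (posK_isBigO.sub (posL_isBigO.const_mul_left 2)) (by
      filter_upwards [strikeIndex_scaled hT, eventually_gt_atTop 0] with n h1 hn
      have h2 := barrierIndex_scaled hs₀ hL hLs₀ hσ hT hn
      have e : (2 * ((m.strikeIndex n + m.barrierIndex n : ℕ) : ℝ) - n - 1) / √(n : ℝ)
          = (2 * (m.strikeIndex n : ℝ) - n - 1) / √(n : ℝ) + 2 * (m.barrierIndex n * eps n) := by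
        rw [eps]; push_cast; ring
      rw [e, h1, h2]; ring)
  have hd : 2 * m.alpha * √m.T - (2 * (Real.log (m.s₀ / m.L) / (m.σ * √m.T))
      - Real.log (m.s₀ / m.K) / (m.σ * √m.T)) = m.d22 := by
    rw [d22_eq hs₀ hL hLK hσ hT]; ring
  rw [hd] at h
  convert h using 2 with n
  rw [← tailCorr_eq_tailCoeff hT, ← hd]
  ring_nf

lemma rho_eq (hs₀ : 0 < m.s₀) (hL : 0 < m.L) (hσ : 0 < m.σ) (hT : 0 < m.T) :
    m.rho = Real.exp (-2 * (Real.log (m.s₀ / m.L) / (m.σ * √m.T)) * (2 * m.alpha * √m.T)) := by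
  have hsT : 0 < √m.T := Real.sqrt_pos.2 hT
  rw [rho, Real.rpow_def_of_pos (by positivity), alpha]
  generalize Real.log (m.s₀ / m.L) = l
  congr 1
  field_simp
  ring

/-- The logarithm of the reflection weight, since `√n (2p - 1) ε = 2p - 1`. The odd logarithmic
series turns it into `(a ε) * (-2 s - (2/3) s ^ 3 ε ^ 2)` up to `O(ε ^ 4)`, where `a` is
`barrierIndex` and `s = √n (2p - 1)`. -/
lemma hasExpansion_exponent (hs₀ : 0 < m.s₀) (hL : 0 < m.L) (hLs₀ : m.L < m.s₀)
    (hσ : 0 < m.σ) (hT : 0 < m.T) :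
    HasExpansion (fun n => m.barrierIndex n
        * (Real.log (1 - √(n : ℝ) * (2 * m.upProb n - 1) * eps n)
          - Real.log (1 + √(n : ℝ) * (2 * m.upProb n - 1) * eps n)))
      (-2 * (Real.log (m.s₀ / m.L) / (m.σ * √m.T)) * (2 * m.alpha * √m.T))
      (fun n => -4 * m.alpha * √m.T * m.posL n) (fun _ => -m.I) := by
  have hs := hasExpansion_upProb hσ hT
  have hsT : 0 < √m.T := Real.sqrt_pos.2 hT
  have hT2 : √m.T ^ 2 = m.T := Real.sq_sqrt hT.le
  set s : ℕ → ℝ := fun n => √(n : ℝ) * (2 * m.upProb n - 1) with hsdef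
  set A := 2 * m.alpha * √m.T with hA
  set B := 2 * m.beta * m.T * √m.T with hB
  set l := Real.log (m.s₀ / m.L) / (m.σ * √m.T) with hl
  have hlin : HasExpansion (fun n => l + m.posL n * eps n) l m.posL (fun _ => 0) :=
    ⟨posL_isBigO, isBigO_const_const _ one_ne_zero _, (isBigO_zero _ _).congr_left fun n => by
      simp⟩
  have hsA : (fun n => s n - A) =O[atTop] eps := hs.isBigO_sub_const
  have hs3 : (fun n => s n ^ 3 - A ^ 3) =O[atTop] eps := by
    have hb : (fun n => s n ^ 2 + s n * A + A ^ 2) =O[atTop] fun _ => (1 : ℝ) := by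
      have h := hs.tendsto
      exact (((h.pow 2).add (h.mul_const A)).add_const (A ^ 2)).isBigO_one ℝ
    have := hsA.mul hb
    simp only [mul_one] at this
    exact this.congr_left fun n => by ring
  have hpoly : HasExpansion (fun n => -2 * s n - 2 / 3 * s n ^ 3 * eps n ^ 2) (-2 * A)
      (fun _ => 0) (fun _ => -2 * B - 2 / 3 * A ^ 3) := by
    refine ⟨isBigO_const_const _ one_ne_zero _, isBigO_const_const _ one_ne_zero _, ?_⟩
    have h1 := hs.isBigO_sub.const_mul_left (-2)
    have h2 : (fun n => -2 / 3 * ((s n ^ 3 - A ^ 3) * eps n ^ 2)) =O[atTop] fun n => eps n ^ 3 :=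
      ((hs3.mul (isBigO_refl (fun n => eps n ^ 2) atTop)).congr_right
        fun n => by ring).const_mul_left _
    exact (h1.add h2).congr_left fun n => by simp only [hsdef]; ring
  have hprod := hlin.mul hpoly
  have hrem : (fun n => m.barrierIndex n * (Real.log (1 - s n * eps n)
      - Real.log (1 + s n * eps n))
      - (l + m.posL n * eps n) * (-2 * s n - 2 / 3 * s n ^ 3 * eps n ^ 2))
      =O[atTop] fun n => eps n ^ 3 := by
    refine IsBigO.trans ?_ (eps_pow_isBigO (show 3 ≤ 4 by norm_num))
    have hbig : (fun n => (l + m.posL n * eps n) * s n ^ 5 * eps n ^ 4) =O[atTop]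
        fun n => eps n ^ 4 := by
      have h5 := (hlin.isBigO_one.mul (hs.isBigO_one.pow 5)).mul
        (isBigO_refl (fun n => eps n ^ 4) atTop)
      simpa using h5
    refine IsBigO.trans (IsBigO.of_bound 4 ?_) hbig
    have hsmall : ∀ᶠ n in atTop, |s n * eps n| ≤ 1 / 2 := by
      have h0 : Tendsto (fun n => |s n * eps n|) atTop (𝓝 0) := by
        simpa using (hs.tendsto.mul tendsto_eps).abs
      exact h0.eventually_le_const (by norm_num)
    filter_upwards [hsmall, eventually_gt_atTop 0] with n hn hn0
    have ha := barrierIndex_scaled hs₀ hL hLs₀ hσ hT hn0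
    rw [← hl] at ha
    have hlog := abs_log_sub_log_le hn
    rw [← ha]
    have e1 : m.barrierIndex n * (Real.log (1 - s n * eps n) - Real.log (1 + s n * eps n))
        - m.barrierIndex n * eps n * (-2 * s n - 2 / 3 * s n ^ 3 * eps n ^ 2)
        = -(m.barrierIndex n * (Real.log (1 + s n * eps n) - Real.log (1 - s n * eps n)
          - 2 * (s n * eps n) - 2 * (s n * eps n) ^ 3 / 3)) := by ring
    rw [e1, norm_neg, norm_mul, Real.norm_eq_abs, Real.norm_eq_abs, Real.norm_eq_abs,
      abs_of_nonneg (Nat.cast_nonneg (α := ℝ) (m.barrierIndex n))]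
    calc (m.barrierIndex n : ℝ) * |Real.log (1 + s n * eps n) - Real.log (1 - s n * eps n)
          - 2 * (s n * eps n) - 2 * (s n * eps n) ^ 3 / 3|
        ≤ m.barrierIndex n * (4 * |s n * eps n| ^ 5) := by gcongr
      _ = 4 * |m.barrierIndex n * eps n * s n ^ 5 * eps n ^ 4| := by
        rw [show m.barrierIndex n * eps n * s n ^ 5 * eps n ^ 4
          = m.barrierIndex n * (s n * eps n) ^ 5 by ring, abs_mul (m.barrierIndex n : ℝ), abs_pow,
          abs_of_nonneg (Nat.cast_nonneg (α := ℝ) (m.barrierIndex n))]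
        ring
  have hI : l * (-2 * B - 2 / 3 * A ^ 3) = -m.I := by
    have e : √m.T ^ 3 = m.T * √m.T := by rw [pow_succ, hT2]
    rw [hl, hA, hB, I, mul_pow, mul_pow, e]
    generalize Real.log (m.s₀ / m.L) = y
    field_simp
    ring
  refine ⟨?_, isBigO_const_const _ one_ne_zero _, ?_⟩
  · exact posL_isBigO.const_mul_left _
  · refine (hrem.add hprod.isBigO_sub).congr_left fun n => ?_
    simp only [hsdef]
    linear_combination -eps n ^ 2 * hI - 2 * m.posL n * eps n * hA

lemma hasExpansion_weight (hs₀ : 0 < m.s₀) (hL : 0 < m.L) (hLs₀ : m.L < m.s₀)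
    (hσ : 0 < m.σ) (hT : 0 < m.T) :
    HasExpansion (fun n => ((1 - m.upProb n) / m.upProb n) ^ m.barrierIndex n) m.rho
      (fun n => m.rho * (-4 * m.alpha * √m.T * m.posL n))
      (fun n => m.rho * -m.I + m.rho / 2 * (-4 * m.alpha * √m.T * m.posL n) ^ 2) := by
  have h := (hasExpansion_exponent hs₀ hL hLs₀ hσ hT).comp (exp_taylor _)
  rw [← rho_eq hs₀ hL hσ hT] at h
  refine h.congr' ?_
  have hs := hasExpansion_upProb hσ hT
  have hsmall : ∀ᶠ n : ℕ in atTop, |√(n : ℝ) * (2 * m.upProb n - 1) * eps n| ≤ 1 / 2 := by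
    have h0 : Tendsto (fun n : ℕ => |√(n : ℝ) * (2 * m.upProb n - 1) * eps n|) atTop (𝓝 0) := by
      simpa using (hs.tendsto.mul tendsto_eps).abs
    exact h0.eventually_le_const (by norm_num)
  filter_upwards [hsmall, eventually_gt_atTop 0] with n hn hn0
  have hn' : (0 : ℝ) < √(n : ℝ) := Real.sqrt_pos.2 (Nat.cast_pos.2 hn0)
  have e1 : √(n : ℝ) * (2 * m.upProb n - 1) * eps n = 2 * m.upProb n - 1 := by
    rw [eps]; field_simp
  rw [e1] at hn ⊢
  obtain ⟨h1, h2⟩ := abs_le.1 hn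
  rw [mul_comm, Real.exp_mul, Real.rpow_natCast, Real.exp_sub, Real.exp_log (by linarith),
    Real.exp_log (by linarith)]
  congr 1
  rw [show 1 - (2 * m.upProb n - 1) = 2 * (1 - m.upProb n) by ring,
    show 1 + (2 * m.upProb n - 1) = 2 * m.upProb n by ring, mul_div_mul_left _ _ two_ne_zero]

lemma upProb_ne_zero (hσ : 0 < m.σ) (hT : 0 < m.T) : ∀ᶠ n : ℕ in atTop, m.upProb n ≠ 0 := by
  have h0 := ((hasExpansion_upProb hσ hT).tendsto.mul tendsto_eps)
  rw [mul_zero] at h0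
  filter_upwards [h0.eventually_const_lt (show (-1 : ℝ) < 0 by norm_num),
    eventually_gt_atTop 0] with n hn hn0 hp
  have hn' : (0 : ℝ) < √(n : ℝ) := Real.sqrt_pos.2 (Nat.cast_pos.2 hn0)
  rw [hp, eps] at hn
  field_simp at hn
  norm_num at hn

lemma isBigO_priceCRRDI (hs₀ : 0 < m.s₀) (hL : 0 < m.L) (hLs₀ : m.L < m.s₀) (hLK : m.L < m.K)
    (hσ : 0 < m.σ) (hT : 0 < m.T) :
    (fun n => m.priceCRRDI n - Real.exp (-m.r * m.T) * (m.rho * Phi m.d22) - m.expansionDI n)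
      =O[atTop] fun n => eps n ^ 3 := by
  have h := ((hasExpansion_weight hs₀ hL hLs₀ hσ hT).mul
    (hasExpansion_reflected hs₀ hL hLs₀ hLK hσ hT)).isBigO_sub.const_mul_left
      (Real.exp (-m.r * m.T))
  refine h.congr' ?_ EventuallyEq.rfl
  filter_upwards [upProb_ne_zero hσ hT, strikeIndex_eq hT, eventually_gt_atTop 0]
    with n hp hk hn0
  have hh : 0 < m.σ * √(m.dt n) := mul_pos hσ (Real.sqrt_pos.2 (dt_pos hT hn0))
  have hT2 : √m.T ^ 2 = m.T := Real.sq_sqrt hT.le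
  rw [priceCRRDI_eq hs₀ hL hLK hh hp hk (barrierIndex_eq hs₀ hL hLs₀ hσ n), expansionDI,
    ← eps_sq, ← eps, A2, A1, B1, B2, B3, B4, g2, tailCoeff]
  linear_combination (-8 * Real.exp (-m.r * m.T) * m.rho * Phi m.d22 * m.posL n ^ 2
    * m.alpha ^ 2 * eps n ^ 2) * hT2

lemma cTilde_eq (hσ : 0 < m.σ) (hT : 0 < m.T) : m.tailCoeff m.d12 = m.cTilde := by
  have hT2 : √m.T ^ 2 = m.T := Real.sq_sqrt hT.le
  have hd : m.d11 = m.d12 + m.σ * √m.T := by rw [d12]; ring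
  rw [tailCoeff, cTilde, hd, alpha, beta]
  generalize m.d12 = d
  generalize √m.T = t at hT2 ⊢
  rw [← hT2]
  field_simp
  ring

/-- In-out parity: the coefficients of the two barrier expansions add up to `c1`, `c2`, `c3`, those
of the plain digital call. -/
lemma isBigO_priceCRR_sum (hs₀ : 0 < m.s₀) (hK : 0 < m.K) (hσ : 0 < m.σ) (hT : 0 < m.T) :
    (fun n => m.priceCRRDI n + m.priceCRRDO n - Real.exp (-m.r * m.T) * Phi m.d12
      - (m.expansionDI n + m.expansionDO n)) =O[atTop] fun n => eps n ^ 3 := by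
  have h := (hasExpansion_vanilla hσ hT).isBigO_sub.const_mul_left (Real.exp (-m.r * m.T))
  refine h.congr' ?_ EventuallyEq.rfl
  filter_upwards [strikeIndex_eq hT, eventually_gt_atTop 0] with n hk hn0
  have hh : 0 < m.σ * √(m.dt n) := mul_pos hσ (Real.sqrt_pos.2 (dt_pos hT hn0))
  rw [priceCRRDI_add_priceCRRDO hs₀ hK hh hk, cTilde_eq hσ hT, expansionDI, expansionDO,
    ← eps_sq, ← eps, C1, C2, D1, D2, D3, D4, c1, c2, c3]
  ring

end Params

end DigitalBarrier
end

noncomputable section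
namespace DigitalBarrier
open Params (Phi phi)
open scoped Topology ENNReal

/-! ### Reflection of Gaussian variables with drift -/

lemma gaussianReal_Ici (μ : ℝ) {v : ℝ≥0} (hv : v ≠ 0) (y : ℝ) :
    gaussianReal μ v (Set.Ici y) = ENNReal.ofReal (Phi ((μ - y) / √(v : ℝ))) := by
  have hs : 0 < √(v : ℝ) := Real.sqrt_pos.2 (by positivity)
  have h1 : (gaussianReal 0 1).map (fun z => μ - √(v : ℝ) * z) = gaussianReal μ v := by
    have : (fun z => μ - √(v : ℝ) * z) = (fun z => μ - z) ∘ fun z => √(v : ℝ) * z := rfl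
    rw [this, ← Measure.map_map (by fun_prop) (by fun_prop), gaussianReal_map_const_mul,
      gaussianReal_map_const_sub]
    congr 1
    · simp
    · ext; simp
  rw [← h1, Measure.map_apply (by fun_prop) measurableSet_Ici, Phi, ofReal_cdf]
  congr 1
  ext z
  simp only [Set.mem_preimage, Set.mem_Ici, Set.mem_Iic]
  rw [le_div_iff₀ hs]
  constructor <;> intro h <;> linarith

/-- The mean `μ v` is proportional to the variance, so the tilt undoing a sign change does not
depend on `v`. The same density therefore works for every remaining time. -/
lemma gaussianPDFReal_mul_exp (μ : ℝ) {v : ℝ≥0} (hv : v ≠ 0) (x : ℝ) :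
    gaussianPDFReal (μ * v) v x * Real.exp (-2 * μ * x) = gaussianPDFReal (μ * v) v (-x) := by
  have hv' : (v : ℝ) ≠ 0 := by exact_mod_cast hv
  simp only [gaussianPDFReal]
  rw [mul_assoc, ← Real.exp_add]
  congr 2
  field_simp
  ring

lemma lintegral_gaussianReal_mul_exp (μ : ℝ) (v : ℝ≥0) {f : ℝ → ℝ≥0∞} (hf : Measurable f) :
    ∫⁻ x, f x * ENNReal.ofReal (Real.exp (-2 * μ * x)) ∂gaussianReal (μ * v) v
      = ∫⁻ x, f (-x) ∂gaussianReal (μ * v) v := by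
  by_cases hv : v = 0
  · simp [hv]
  have hfn : Measurable fun x => f (-x) := hf.comp measurable_neg
  rw [gaussianReal_of_var_ne_zero _ hv,
    lintegral_withDensity_eq_lintegral_mul _ (measurable_gaussianPDF _ _) (by fun_prop),
    lintegral_withDensity_eq_lintegral_mul _ (measurable_gaussianPDF _ _) hfn,
    ← (Measure.measurePreserving_neg (volume : Measure ℝ)).lintegral_comp
      ((measurable_gaussianPDF _ _).mul hfn)]
  refine lintegral_congr fun x => ?_
  simp only [Pi.mul_apply, neg_neg, gaussianPDF]
  rw [← gaussianPDFReal_mul_exp μ hv, ENNReal.ofReal_mul (gaussianPDFReal_nonneg _ _ _)]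
  ring

variable {Ω E : Type*} [MeasurableSpace Ω] [MeasurableSpace E] {P : Measure Ω}

lemma lintegral_mul_exp_of_indepFun [IsProbabilityMeasure P] {Z : Ω → E} {D : Ω → ℝ}
    (hZ : Measurable Z) (hD : Measurable D) (hZD : IndepFun Z D P) {μ : ℝ} {v : ℝ≥0}
    (hlaw : P.map D = gaussianReal (μ * v) v) {F : E × ℝ → ℝ≥0∞} (hF : Measurable F) :
    ∫⁻ ω, F (Z ω, D ω) * ENNReal.ofReal (Real.exp (-2 * μ * D ω)) ∂P
      = ∫⁻ ω, F (Z ω, -D ω) ∂P := by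
  have hprod := (indepFun_iff_map_prod_eq_prod_map_map hZ.aemeasurable hD.aemeasurable).1 hZD
  have hZD' : Measurable fun ω => (Z ω, D ω) := hZ.prodMk hD
  have : IsProbabilityMeasure (P.map Z) := Measure.isProbabilityMeasure_map hZ.aemeasurable
  have hF' : Measurable fun q : E × ℝ => F (q.1, -q.2) := by fun_prop
  have h1 := lintegral_map (μ := P)
    (f := fun q : E × ℝ => F q * ENNReal.ofReal (Real.exp (-2 * μ * q.2))) (by fun_prop) hZD'
  have h2 := lintegral_map (μ := P) hF' hZD'
  rw [hprod, hlaw] at h1 h2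
  simp only at h1 h2
  rw [← h1, ← h2, lintegral_prod _ (by fun_prop), lintegral_prod _ hF'.aemeasurable]
  refine lintegral_congr fun z => ?_
  exact lintegral_gaussianReal_mul_exp μ v (f := fun x => F (z, x)) (by fun_prop)

/-- The measure with density `exp (-2 μ (X + b))`, under which the reflection at `-b` of a
Brownian motion with drift `μ` and terminal value `X` has the original law after the reflection. -/
def reflMeasure (P : Measure Ω) (μ b : ℝ) (X : Ω → ℝ) : Measure Ω :=
  P.withDensity fun ω => ENNReal.ofReal (Real.exp (-2 * μ * (X ω + b)))

/-- Here `Z` is the past, `y (Z)` the current value and `D` the later increment. The tilt `exp (-2 μ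
D)` is spent on reversing `D`; only the offset of `y (Z)` from `-b` remains in the density. -/
lemma reflMeasure_apply [IsProbabilityMeasure P] {Z : Ω → E} {D : Ω → ℝ}
    (hZ : Measurable Z) (hD : Measurable D) (hZD : IndepFun Z D P) {μ : ℝ} {v : ℝ≥0}
    (hlaw : P.map D = gaussianReal (μ * v) v) {y : E → ℝ} (hy : Measurable y) {G : Set E}
    (hG : MeasurableSet G) {X : Ω → ℝ} (hX : ∀ ω, X ω = y (Z ω) + D ω) (b c : ℝ) :
    reflMeasure P μ b X {ω | Z ω ∈ G ∧ X ω ≤ c}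
      = ∫⁻ ω in {ω | Z ω ∈ G ∧ y (Z ω) - D ω ≤ c},
          ENNReal.ofReal (Real.exp (-2 * μ * (y (Z ω) + b))) ∂P := by
  have hXm : Measurable X := by
    have : X = fun ω => y (Z ω) + D ω := funext hX
    rw [this]; fun_prop
  have hS : MeasurableSet {q : E × ℝ | q.1 ∈ G ∧ y q.1 + q.2 ≤ c} :=
    (measurable_fst hG).inter
      (measurableSet_le ((hy.comp measurable_fst).add measurable_snd) measurable_const)
  have hS1 : MeasurableSet {ω | Z ω ∈ G ∧ X ω ≤ c} :=
    (hZ hG).inter (measurableSet_le hXm measurable_const)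
  have hS2 : MeasurableSet {ω | Z ω ∈ G ∧ y (Z ω) - D ω ≤ c} :=
    (hZ hG).inter (measurableSet_le ((hy.comp hZ).sub hD) measurable_const)
  set F : E × ℝ → ℝ≥0∞ := Set.indicator {q : E × ℝ | q.1 ∈ G ∧ y q.1 + q.2 ≤ c}
    fun q => ENNReal.ofReal (Real.exp (-2 * μ * (y q.1 + b))) with hFdef
  have hF : Measurable F := Measurable.indicator (by fun_prop) hS
  have key := lintegral_mul_exp_of_indepFun hZ hD hZD hlaw hF
  classical
  rw [reflMeasure, withDensity_apply _ hS1, ← lintegral_indicator hS1, ← lintegral_indicator hS2]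
  refine Eq.trans (lintegral_congr fun ω => ?_) (key.trans (lintegral_congr fun ω => ?_))
  · simp only [hFdef, Set.indicator_apply, Set.mem_ofPred_eq, hX ω]
    split_ifs
    · rw [← ENNReal.ofReal_mul (Real.exp_pos _).le, ← Real.exp_add]
      ring_nf
    · simp
  · simp only [hFdef, Set.indicator_apply, Set.mem_ofPred_eq, sub_eq_add_neg]

lemma exp_neg_two_mul_le {μ η o : ℝ} (ho : |o| ≤ η) :
    Real.exp (-2 * μ * o) ≤ Real.exp (2 * |μ| * η) := by
  apply Real.exp_le_exp.2
  calc -2 * μ * o ≤ |-2 * μ * o| := le_abs_self _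
    _ = 2 * |μ| * |o| := by rw [abs_mul, abs_mul]; norm_num
    _ ≤ 2 * |μ| * η := by gcongr

lemma measure_le_reflMeasure [IsProbabilityMeasure P] {Z : Ω → E} {D : Ω → ℝ}
    (hZ : Measurable Z) (hD : Measurable D) (hZD : IndepFun Z D P) {μ : ℝ} {v : ℝ≥0}
    (hlaw : P.map D = gaussianReal (μ * v) v) {y : E → ℝ} (hy : Measurable y) {G : Set E}
    (hG : MeasurableSet G) {X : Ω → ℝ} (hX : ∀ ω, X ω = y (Z ω) + D ω) {b η : ℝ} (x : ℝ)
    (hGy : ∀ z ∈ G, y z ≤ -b ∧ -b - η ≤ y z) :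
    P {ω | Z ω ∈ G ∧ x ≤ X ω} ≤ ENNReal.ofReal (Real.exp (2 * |μ| * η))
      * reflMeasure P μ b X {ω | Z ω ∈ G ∧ X ω ≤ -2 * b - x} := by
  have hS2 : MeasurableSet {ω | Z ω ∈ G ∧ y (Z ω) - D ω ≤ -2 * b - x} :=
    (hZ hG).inter (measurableSet_le ((hy.comp hZ).sub hD) measurable_const)
  rw [reflMeasure_apply hZ hD hZD hlaw hy hG hX, ← lintegral_const_mul _ (by fun_prop)]
  -- With `X = y + D` and `y ≤ -b`, the reflected value is `y - D = 2 y - X ≤ -2 b - X`.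
  calc P {ω | Z ω ∈ G ∧ x ≤ X ω} ≤ P {ω | Z ω ∈ G ∧ y (Z ω) - D ω ≤ -2 * b - x} := by
        refine measure_mono fun ω hω => ⟨hω.1, ?_⟩
        have h1 := hω.2
        rw [hX ω] at h1
        linarith [(hGy _ hω.1).1]
    _ = ∫⁻ ω in {ω | Z ω ∈ G ∧ y (Z ω) - D ω ≤ -2 * b - x}, 1 ∂P := by simp
    _ ≤ _ := by
        refine setLIntegral_mono' hS2 fun ω hω => ?_
        rw [← ENNReal.ofReal_mul (Real.exp_pos _).le, ← ENNReal.ofReal_one]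
        refine ENNReal.ofReal_le_ofReal ?_
        obtain ⟨h1, h2⟩ := hGy _ hω.1
        have := exp_neg_two_mul_le (μ := μ) (o := -(y (Z ω) + b)) (η := η) (by
          rw [abs_neg, abs_le]; constructor <;> linarith)
        calc (1 : ℝ) = Real.exp (-2 * μ * -(y (Z ω) + b)) * Real.exp (-2 * μ * (y (Z ω) + b)) := by
              rw [← Real.exp_add, ← Real.exp_zero]; ring_nf
          _ ≤ _ := by gcongr

/-- Converse comparison: an overshoot of at most `η` below `-b` costs `2 * η` in the terminal level.
-/
lemma reflMeasure_le_measure [IsProbabilityMeasure P] {Z : Ω → E} {D : Ω → ℝ}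
    (hZ : Measurable Z) (hD : Measurable D) (hZD : IndepFun Z D P) {μ : ℝ} {v : ℝ≥0}
    (hlaw : P.map D = gaussianReal (μ * v) v) {y : E → ℝ} (hy : Measurable y) {G : Set E}
    (hG : MeasurableSet G) {X : Ω → ℝ} (hX : ∀ ω, X ω = y (Z ω) + D ω) {b η : ℝ} (x : ℝ)
    (hGy : ∀ z ∈ G, y z ≤ -b ∧ -b - η ≤ y z) :
    reflMeasure P μ b X {ω | Z ω ∈ G ∧ X ω ≤ -2 * b - x}
      ≤ ENNReal.ofReal (Real.exp (2 * |μ| * η)) * P {ω | Z ω ∈ G ∧ x - 2 * η ≤ X ω} := by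
  have hS2 : MeasurableSet {ω | Z ω ∈ G ∧ y (Z ω) - D ω ≤ -2 * b - x} :=
    (hZ hG).inter (measurableSet_le ((hy.comp hZ).sub hD) measurable_const)
  rw [reflMeasure_apply hZ hD hZD hlaw hy hG hX]
  calc ∫⁻ ω in {ω | Z ω ∈ G ∧ y (Z ω) - D ω ≤ -2 * b - x},
        ENNReal.ofReal (Real.exp (-2 * μ * (y (Z ω) + b))) ∂P
      ≤ ∫⁻ ω in {ω | Z ω ∈ G ∧ y (Z ω) - D ω ≤ -2 * b - x},
        ENNReal.ofReal (Real.exp (2 * |μ| * η)) ∂P := by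
        refine setLIntegral_mono' hS2 fun ω hω => ENNReal.ofReal_le_ofReal ?_
        obtain ⟨h1, h2⟩ := hGy _ hω.1
        exact exp_neg_two_mul_le (by rw [abs_le]; constructor <;> linarith)
    _ = ENNReal.ofReal (Real.exp (2 * |μ| * η))
        * P {ω | Z ω ∈ G ∧ y (Z ω) - D ω ≤ -2 * b - x} := setLIntegral_const _ _
    _ ≤ _ := by
        refine mul_le_mul' le_rfl (measure_mono ?_)
        rintro ω ⟨h1, h2⟩
        refine ⟨h1, ?_⟩
        rw [hX ω]
        linarith [(hGy _ h1).2]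

lemma reflMeasure_Iic [IsProbabilityMeasure P] {X : Ω → ℝ} (hX : Measurable X) {μ : ℝ} {v : ℝ≥0}
    (hv : v ≠ 0) (hlaw : P.map X = gaussianReal (μ * v) v) (b c : ℝ) :
    reflMeasure P μ b X {ω | X ω ≤ c}
      = ENNReal.ofReal (Real.exp (-2 * μ * b) * Phi ((μ * v + c) / √(v : ℝ))) := by
  -- Reflection at time `0`: the past is trivial and the whole of `X` is the increment.
  have h := reflMeasure_apply (P := P) (Z := fun _ => ()) (D := X) measurable_const hX
    (indepFun_const_left () X) hlaw (y := fun _ => 0) measurable_const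
    (G := Set.univ) MeasurableSet.univ (X := X) (fun ω => by simp) b c
  simp only [Set.mem_univ, true_and, zero_add, zero_sub] at h
  rw [h, setLIntegral_const, ENNReal.ofReal_mul (Real.exp_pos _).le]
  congr 1
  have e : {ω | -X ω ≤ c} = X ⁻¹' Set.Ici (-c) := by
    ext ω; simp only [Set.mem_ofPred_eq, Set.mem_preimage, Set.mem_Ici]; exact neg_le
  rw [e, ← Measure.map_apply hX measurableSet_Ici, hlaw, gaussianReal_Ici _ hv, sub_neg_eq_add]

lemma isFiniteMeasure_reflMeasure [IsProbabilityMeasure P] {X : Ω → ℝ} (hX : Measurable X) {μ : ℝ}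
    {v : ℝ≥0} (hlaw : P.map X = gaussianReal (μ * v) v) (b : ℝ) :
    IsFiniteMeasure (reflMeasure P μ b X) := by
  refine ⟨?_⟩
  have h := lintegral_gaussianReal_mul_exp μ v (f := fun _ => 1) measurable_const
  have h1 := lintegral_map (μ := P)
    (f := fun x : ℝ => 1 * ENNReal.ofReal (Real.exp (-2 * μ * x))) (by fun_prop) hX
  rw [hlaw, h] at h1
  simp only [one_mul, lintegral_const, measure_univ, mul_one] at h1
  rw [reflMeasure, withDensity_apply _ MeasurableSet.univ, Measure.restrict_univ]
  calc ∫⁻ ω, ENNReal.ofReal (Real.exp (-2 * μ * (X ω + b))) ∂P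
      = ∫⁻ ω, ENNReal.ofReal (Real.exp (-2 * μ * b))
        * ENNReal.ofReal (Real.exp (-2 * μ * X ω)) ∂P := by
        refine lintegral_congr fun ω => ?_
        rw [← ENNReal.ofReal_mul (Real.exp_pos _).le, ← Real.exp_add]; ring_nf
    _ = ENNReal.ofReal (Real.exp (-2 * μ * b)) * 1 := by
        rw [lintegral_const_mul _ (by fun_prop), ← h1]
    _ < ∞ := by simp

end DigitalBarrier
end

noncomputable section
namespace DigitalBarrier
open Params (Phi phi)
open scoped Topology ENNReal

variable {Ω : Type*}

/-! ### Reflection along a finite set of times -/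

/-- The process `X` visits `(-∞, -b]` for the first time at time `j`. -/
def firstHit (X : ℕ → Ω → ℝ) (b : ℝ) (j : ℕ) : Set Ω :=
  {ω | X j ω ≤ -b ∧ ∀ i < j, -b < X i ω}

/-- The process `X` visits `(-∞, -b]` up to time `n`. -/
def hitSet (X : ℕ → Ω → ℝ) (b : ℝ) (n : ℕ) : Set Ω := {ω | ∃ j ≤ n, X j ω ≤ -b}

/-- The process `X` starts below `-b` or has a down step of more than `η` up to time `n`. -/
def badSet (X : ℕ → Ω → ℝ) (b η : ℝ) (n : ℕ) : Set Ω :=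
  {ω | X 0 ω ≤ -b ∨ ∃ i < n, η < X i ω - X (i + 1) ω}

/-- Brownian motion with drift. -/
def drifted (W : ℝ≥0 → Ω → ℝ) (μ : ℝ) (t : ℝ≥0) (ω : Ω) : ℝ := μ * t + W t ω

lemma firstHit_disjoint (X : ℕ → Ω → ℝ) (b : ℝ) :
    Pairwise (Function.onFun Disjoint (firstHit X b)) := by
  intro i j hij
  rw [Function.onFun, Set.disjoint_left]
  intro ω hi hj
  rcases lt_or_gt_of_ne hij with h | h
  · exact absurd hi.1 (not_le.2 (hj.2 i h))
  · exact absurd hj.1 (not_le.2 (hi.2 j h))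

lemma exists_mem_firstHit {X : ℕ → Ω → ℝ} {b : ℝ} {n : ℕ} {ω : Ω} (h : ω ∈ hitSet X b n) :
    ∃ j ≤ n, ω ∈ firstHit X b j := by
  classical
  obtain ⟨j, hj, hω⟩ := h
  have hex : ∃ j, X j ω ≤ -b := ⟨j, hω⟩
  exact ⟨Nat.find hex, (Nat.find_le hω).trans hj, Nat.find_spec hex,
    fun i hi => not_le.1 (Nat.find_min hex hi)⟩

lemma mem_badSet_of_firstHit {X : ℕ → Ω → ℝ} {b η : ℝ} {j n : ℕ} (hj : j ≤ n) {ω : Ω}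
    (h : ω ∈ firstHit X b j) (hη : X j ω < -b - η) : ω ∈ badSet X b η n := by
  rcases j with _ | j
  · exact Or.inl h.1
  · refine Or.inr ⟨j, by omega, ?_⟩
    have := h.2 j (Nat.lt_succ_self j)
    linarith

variable [MeasurableSpace Ω] {P : Measure Ω}

lemma measurableSet_firstHit {X : ℕ → Ω → ℝ} (hX : ∀ i, Measurable (X i)) (b : ℝ) (j : ℕ) :
    MeasurableSet (firstHit X b j) := by
  have : firstHit X b j = {ω | X j ω ≤ -b} ∩ ⋂ i, ⋂ _ : i < j, {ω | -b < X i ω} := by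
    ext ω; simp [firstHit]
  rw [this]
  exact (measurableSet_le (hX j) measurable_const).inter
    (MeasurableSet.iInter fun i => MeasurableSet.iInter fun _ =>
      measurableSet_lt measurable_const (hX i))

lemma measurableSet_hitSet {X : ℕ → Ω → ℝ} (hX : ∀ i, Measurable (X i)) (b : ℝ) (n : ℕ) :
    MeasurableSet (hitSet X b n) := by
  have : hitSet X b n = ⋃ j, ⋃ _ : j ≤ n, {ω | X j ω ≤ -b} := by
    ext ω; simp [hitSet]
  rw [this]
  exact MeasurableSet.iUnion fun j => MeasurableSet.iUnion fun _ =>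
    measurableSet_le (hX j) measurable_const

lemma measurableSet_badSet {X : ℕ → Ω → ℝ} (hX : ∀ i, Measurable (X i)) (b η : ℝ) (n : ℕ) :
    MeasurableSet (badSet X b η n) := by
  have : badSet X b η n = {ω | X 0 ω ≤ -b} ∪ ⋃ i, ⋃ _ : i < n, {ω | η < X i ω - X (i + 1) ω} := by
    ext ω; simp [badSet]
  rw [this]
  exact (measurableSet_le (hX 0) measurable_const).union
    (MeasurableSet.iUnion fun i => MeasurableSet.iUnion fun _ =>
      measurableSet_lt measurable_const ((hX i).sub (hX (i + 1))))

/-- Sums the estimates over the disjoint events of first visit. Visits with overshoot beyond `η`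
fall into `badSet`. The measures are arbitrary because the lemma serves both directions of the
comparison. -/
lemma measure_hitSet_inter_le {P Q : Measure Ω} {X : ℕ → Ω → ℝ} (hX : ∀ i, Measurable (X i))
    {b η : ℝ} {n : ℕ} {C C' : Set Ω} (hC' : MeasurableSet C') {κ : ℝ≥0∞}
    (h : ∀ j ≤ n, P ({ω | ω ∈ firstHit X b j ∧ -b - η ≤ X j ω} ∩ C)
      ≤ κ * Q ({ω | ω ∈ firstHit X b j ∧ -b - η ≤ X j ω} ∩ C')) :
    P (hitSet X b n ∩ C) ≤ κ * Q (hitSet X b n ∩ C') + P (badSet X b η n) := by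
  set F : ℕ → Set Ω := fun j => {ω | ω ∈ firstHit X b j ∧ -b - η ≤ X j ω}
  have hF : ∀ j, MeasurableSet (F j) := fun j =>
    (measurableSet_firstHit hX b j).inter (measurableSet_le measurable_const (hX j))
  have hsub : hitSet X b n ∩ C ⊆ (⋃ j ∈ Finset.range (n + 1), F j ∩ C) ∪ badSet X b η n := by
    rintro ω ⟨hω, hωC⟩
    obtain ⟨j, hj, hω'⟩ := exists_mem_firstHit hω
    rcases le_or_gt (-b - η) (X j ω) with h1 | h1
    · left
      simp only [Set.mem_iUnion]
      exact ⟨j, Finset.mem_range.2 (by omega), ⟨hω', h1⟩, hωC⟩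
    · exact Or.inr (mem_badSet_of_firstHit hj hω' h1)
  have hdisj : Set.PairwiseDisjoint (↑(Finset.range (n + 1))) fun j => F j ∩ C' := by
    intro i _ j _ hij
    refine (firstHit_disjoint X b hij).mono ?_ ?_
    · exact fun ω hω => hω.1.1
    · exact fun ω hω => hω.1.1
  calc P (hitSet X b n ∩ C) ≤ P (⋃ j ∈ Finset.range (n + 1), F j ∩ C) + P (badSet X b η n) :=
        (measure_mono hsub).trans (measure_union_le _ _)
    _ ≤ ∑ j ∈ Finset.range (n + 1), κ * Q (F j ∩ C') + P (badSet X b η n) := by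
        gcongr
        refine (measure_biUnion_finset_le _ _).trans (Finset.sum_le_sum fun j hj => ?_)
        exact h j (by rw [Finset.mem_range] at hj; omega)
    _ = κ * Q (⋃ j ∈ Finset.range (n + 1), F j ∩ C') + P (badSet X b η n) := by
        rw [← Finset.mul_sum, measure_biUnion_finset hdisj fun j _ => (hF j).inter hC']
    _ ≤ κ * Q (hitSet X b n ∩ C') + P (badSet X b η n) := by
        gcongr
        intro ω hω
        simp only [Set.mem_iUnion] at hω
        obtain ⟨j, hj, hω⟩ := hω
        exact ⟨⟨j, by rw [Finset.mem_range] at hj; omega, hω.1.1.1⟩, hω.2⟩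

/-! ### Reflection at the first grid visit of Brownian motion with drift -/

section PreBrownian

variable {W : ℝ≥0 → Ω → ℝ}

lemma measurable_drifted (hWm : ∀ t, Measurable (W t)) (μ : ℝ) (t : ℝ≥0) :
    Measurable (drifted W μ t) := by
  have := hWm t
  unfold drifted; fun_prop

lemma map_drifted (hW : IsPreBrownianReal W P) (μ : ℝ) (t : ℝ≥0) :
    P.map (drifted W μ t) = gaussianReal (μ * t) t := by
  have := (gaussianReal_const_add (hW.hasLaw_eval t) (μ * t)).map_eq
  rwa [zero_add] at this

/-- The two estimates of the reflection principle for one time `t j` of first visit. -/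
lemma firstHit_estimates [IsProbabilityMeasure P] (hW : IsPreBrownianReal W P)
    (hWm : ∀ t, Measurable (W t)) (μ : ℝ) {T : ℝ≥0} {t : ℕ → ℝ≥0} (ht : Monotone t) {j : ℕ}
    (hj : t j ≤ T) (b η x : ℝ) :
    (P ({ω | ω ∈ firstHit (fun i => drifted W μ (t i)) b j ∧ -b - η ≤ drifted W μ (t j) ω}
        ∩ {ω | x ≤ drifted W μ T ω})
      ≤ ENNReal.ofReal (Real.exp (2 * |μ| * η)) * reflMeasure P μ b (drifted W μ T)
        ({ω | ω ∈ firstHit (fun i => drifted W μ (t i)) b j ∧ -b - η ≤ drifted W μ (t j) ω}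
          ∩ {ω | drifted W μ T ω ≤ -2 * b - x})) ∧
    (reflMeasure P μ b (drifted W μ T)
        ({ω | ω ∈ firstHit (fun i => drifted W μ (t i)) b j ∧ -b - η ≤ drifted W μ (t j) ω}
          ∩ {ω | drifted W μ T ω ≤ -2 * b - x})
      ≤ ENNReal.ofReal (Real.exp (2 * |μ| * η)) *
        P ({ω | ω ∈ firstHit (fun i => drifted W μ (t i)) b j ∧ -b - η ≤ drifted W μ (t j) ω}
          ∩ {ω | x - 2 * η ≤ drifted W μ T ω})) := by
  -- The past consists of all values up to `t j`, so the independence of the shifted process applies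
  -- directly.
  set Z : Ω → (Set.Iic (t j) → ℝ) := fun ω s => W s ω with hZdef
  set v : ℝ≥0 := T - t j with hv
  set D : Ω → ℝ := fun ω => μ * v + (W (t j + v) ω - W (t j) ω) with hDdef
  have hZ : Measurable Z := measurable_pi_lambda _ fun s => hWm s
  have hD : Measurable D := by
    have h1 := hWm (t j + v)
    have h2 := hWm (t j)
    fun_prop
  have hlaw : P.map D = gaussianReal (μ * v) v := by
    have := (gaussianReal_const_add ((hW.shift (t j)).hasLaw_eval v) (μ * v)).map_eq
    rwa [zero_add] at this
  have hind : IndepFun Z D P := by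
    have h := (hW.indepFun_shift (t j)).symm
    exact h.comp (φ := id) (ψ := fun f : ℝ≥0 → ℝ => μ * v + f v) measurable_id (by fun_prop)
  set y : (Set.Iic (t j) → ℝ) → ℝ := fun z => μ * t j + z ⟨t j, Set.mem_Iic.2 le_rfl⟩ with hydef
  have hy : Measurable y := by fun_prop
  set G : Set (Set.Iic (t j) → ℝ) := {z | y z ≤ -b ∧ -b - η ≤ y z} ∩
    ⋂ i : Fin j, {z | -b < μ * t i + z ⟨t i, Set.mem_Iic.2 (ht i.2.le)⟩} with hGdef
  have hG : MeasurableSet G := by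
    refine MeasurableSet.inter ?_ (MeasurableSet.iInter fun i => ?_)
    · exact (measurableSet_le hy measurable_const).inter (measurableSet_le measurable_const hy)
    · exact measurableSet_lt measurable_const (by fun_prop)
  have hGy : ∀ z ∈ G, y z ≤ -b ∧ -b - η ≤ y z := fun z hz => hz.1
  have hX : ∀ ω, drifted W μ T ω = y (Z ω) + D ω := by
    intro ω
    have h1 : t j + v = T := add_tsub_cancel_of_le hj
    have h2 : (T : ℝ) = t j + v := by rw [← h1]; push_cast; rfl
    simp only [drifted, hydef, hZdef, hDdef, h1]
    rw [h2]; ring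
  have hset : ∀ C : Set Ω, {ω | ω ∈ firstHit (fun i => drifted W μ (t i)) b j
      ∧ -b - η ≤ drifted W μ (t j) ω} ∩ C = {ω | Z ω ∈ G ∧ ω ∈ C} := by
    intro C
    ext ω
    simp only [firstHit, hGdef, hydef, hZdef, drifted, Set.mem_inter_iff, Set.mem_ofPred_eq,
      Set.mem_iInter]
    constructor
    · rintro ⟨⟨⟨h1, h2⟩, h3⟩, h4⟩
      exact ⟨⟨⟨h1, h3⟩, fun i => h2 i i.2⟩, h4⟩
    · rintro ⟨⟨⟨h1, h3⟩, h2⟩, h4⟩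
      exact ⟨⟨⟨h1, fun i hi => h2 ⟨i, hi⟩⟩, h3⟩, h4⟩
  simp only [hset, Set.mem_ofPred_eq]
  exact ⟨measure_le_reflMeasure hZ hD hind hlaw hy hG hX x hGy,
    reflMeasure_le_measure hZ hD hind hlaw hy hG hX x hGy⟩

lemma measure_hitSet_le [IsProbabilityMeasure P] (hW : IsPreBrownianReal W P)
    (hWm : ∀ t, Measurable (W t)) (μ : ℝ) {T : ℝ≥0} {t : ℕ → ℝ≥0} (ht : Monotone t) {n : ℕ}
    (hn : t n = T) (b η x : ℝ) :
    P (hitSet (fun i => drifted W μ (t i)) b n ∩ {ω | x ≤ drifted W μ T ω})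
      ≤ ENNReal.ofReal (Real.exp (2 * |μ| * η))
        * reflMeasure P μ b (drifted W μ T) {ω | drifted W μ T ω ≤ -2 * b - x}
        + P (badSet (fun i => drifted W μ (t i)) b η n) := by
  refine (measure_hitSet_inter_le (fun i => measurable_drifted hWm μ (t i))
    (measurableSet_le (measurable_drifted hWm μ T) measurable_const)
    fun j hj => (firstHit_estimates hW hWm μ ht (hn ▸ ht hj) b η x).1).trans ?_
  gcongr
  exact Set.inter_subset_right

lemma reflMeasure_le_hitSet [IsProbabilityMeasure P] (hW : IsPreBrownianReal W P)
    (hWm : ∀ t, Measurable (W t)) (μ : ℝ) {T : ℝ≥0} {t : ℕ → ℝ≥0} (ht : Monotone t) {n : ℕ}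
    (hn : t n = T) {b η x : ℝ} (hbx : -b ≤ x) :
    reflMeasure P μ b (drifted W μ T) {ω | drifted W μ T ω ≤ -2 * b - x}
      ≤ ENNReal.ofReal (Real.exp (2 * |μ| * η))
        * P (hitSet (fun i => drifted W μ (t i)) b n ∩ {ω | x - 2 * η ≤ drifted W μ T ω})
        + reflMeasure P μ b (drifted W μ T) (badSet (fun i => drifted W μ (t i)) b η n) := by
  refine le_trans (measure_mono ?_) (measure_hitSet_inter_le
    (fun i => measurable_drifted hWm μ (t i))
    (measurableSet_le measurable_const (measurable_drifted hWm μ T))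
    fun j hj => (firstHit_estimates hW hWm μ ht (hn ▸ ht hj) b η x).2)
  -- Since `-b ≤ x`, a terminal value of at most `-2 * b - x` is already a visit at the last grid
  -- time.
  intro ω hω
  refine ⟨⟨n, le_rfl, ?_⟩, hω⟩
  have : drifted W μ T ω ≤ -2 * b - x := hω
  simp only [hn]
  linarith

end PreBrownian

end DigitalBarrier
end

noncomputable section
namespace DigitalBarrier
open Params (Phi phi)
open scoped Topology ENNReal

/-! ### Approximation of continuous paths along grids -/

/-- The points of the grid that divides `[0, T]` into `N + 1` intervals. -/
def gridTime (T : ℝ≥0) (N i : ℕ) : ℝ≥0 := T * (i / ((N : ℝ≥0) + 1))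

lemma gridTime_mono (T : ℝ≥0) (N : ℕ) : Monotone (gridTime T N) := by
  intro i j hij
  unfold gridTime
  gcongr

lemma gridTime_zero (T : ℝ≥0) (N : ℕ) : gridTime T N 0 = 0 := by simp [gridTime]

lemma gridTime_last (T : ℝ≥0) (N : ℕ) : gridTime T N (N + 1) = T := by
  have : (N : ℝ≥0) + 1 ≠ 0 := by positivity
  simp [gridTime, this]

lemma gridTime_le (T : ℝ≥0) {N i : ℕ} (h : i ≤ N + 1) : gridTime T N i ≤ T :=
  (gridTime_mono T N h).trans (gridTime_last T N).le

lemma gridTime_succ (T : ℝ≥0) (N i : ℕ) :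
    (gridTime T N (i + 1) : ℝ) = gridTime T N i + T / ((N : ℝ) + 1) := by
  simp only [gridTime]; push_cast; ring

lemma tendsto_mesh (T : ℝ) : Tendsto (fun N : ℕ => T / ((N : ℝ) + 1)) atTop (𝓝 0) := by
  simpa [div_eq_mul_inv] using (tendsto_one_div_add_atTop_nhds_zero_nat (𝕜 := ℝ)).const_mul T

lemma eventually_gridTime_step_le {f : ℝ≥0 → ℝ} (hf : Continuous f) (T : ℝ≥0) {η : ℝ}
    (hη : 0 < η) : ∀ᶠ N in atTop, ∀ i < N + 1,
      f (gridTime T N i) - f (gridTime T N (i + 1)) ≤ η := by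
  have huc : UniformContinuousOn f (Set.Icc 0 T) :=
    isCompact_Icc.uniformContinuousOn_of_continuous hf.continuousOn
  obtain ⟨δ, hδ, h⟩ := Metric.uniformContinuousOn_iff.1 huc η hη
  filter_upwards [(tendsto_mesh T).eventually_lt_const hδ] with N hN i hi
  have h1 := h (gridTime T N i) ⟨zero_le, gridTime_le T hi.le⟩ (gridTime T N (i + 1))
    ⟨zero_le, gridTime_le T hi⟩ (by
      rw [NNReal.dist_eq, gridTime_succ, sub_add_cancel_left, abs_neg,
        abs_of_nonneg (by positivity)]
      exact hN)
  rw [Real.dist_eq] at h1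
  exact (le_abs_self _).trans h1.le

/-- Take the last grid point before `s`; the slack between `c` and `c'` absorbs the oscillation of
`f` over one mesh. -/
lemma eventually_exists_gridTime_le {f : ℝ≥0 → ℝ} (hf : Continuous f) {T s : ℝ≥0} (hT : T ≠ 0)
    (hs : s ≤ T) {c c' : ℝ} (hc : f s ≤ c) (hcc' : c < c') :
    ∀ᶠ N in atTop, ∃ i ≤ N + 1, f (gridTime T N i) ≤ c' := by
  obtain ⟨δ, hδ, h⟩ := Metric.continuous_iff.1 hf s (c' - c) (by linarith)
  filter_upwards [(tendsto_mesh T).eventually_lt_const hδ] with N hN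
  have hT0 : (0 : ℝ) < T := by positivity
  have hN1 : (0 : ℝ) < (N : ℝ) + 1 := by positivity
  have hsT : (s : ℝ) ≤ T := by exact_mod_cast hs
  set i := ⌊(s : ℝ) * (N + 1) / T⌋₊ with hi
  have h0 : (0 : ℝ) ≤ (s : ℝ) * (N + 1) / T := by positivity
  have h1 : (i : ℝ) ≤ (s : ℝ) * (N + 1) / T := Nat.floor_le h0
  have h2 : (s : ℝ) * (N + 1) / T < i + 1 := Nat.lt_floor_add_one _
  rw [le_div_iff₀ hT0] at h1
  rw [div_lt_iff₀ hT0] at h2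
  have hg : (gridTime T N i : ℝ) = i * T / (N + 1) := by
    simp only [gridTime]; push_cast; ring
  have hgs : (gridTime T N i : ℝ) ≤ s := by rw [hg, div_le_iff₀ hN1]; exact h1
  have hsg : (s : ℝ) - gridTime T N i < T / (N + 1) := by
    rw [hg, sub_lt_iff_lt_add, ← add_div, lt_div_iff₀ hN1]; linarith
  refine ⟨i, ?_, ?_⟩
  · have : (i : ℝ) ≤ N + 1 := by
      have h3 : (i : ℝ) * T ≤ (N + 1) * T := by nlinarith
      exact le_of_mul_le_mul_right h3 hT0
    exact_mod_cast this
  · have h4 := h (gridTime T N i) (by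
      rw [NNReal.dist_eq, abs_sub_comm, abs_of_nonneg (by linarith)]
      linarith)
    rw [Real.dist_eq] at h4
    linarith [(abs_lt.1 h4).2]

/-! ### Joint law of the terminal value and the minimum of Brownian motion with drift -/

variable {Ω : Type*}

lemma continuous_drifted {B : ℝ≥0 → Ω → ℝ} {ω : Ω} (hω : Continuous (B · ω)) (μ : ℝ) :
    Continuous fun t => drifted B μ t ω := by
  unfold drifted; fun_prop

variable [MeasurableSpace Ω] {P : Measure Ω}

lemma tendsto_measure_badSet {B W : ℝ≥0 → Ω → ℝ} (hB : IsBrownianReal B P)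
    (hWm : ∀ t, Measurable (W t)) {T : ℝ≥0}
    (hWB : ∀ᵐ ω ∂P, ∀ N i, W (gridTime T N i) ω = B (gridTime T N i) ω) (μ : ℝ) {b η : ℝ}
    (hb : 0 < b) (hη : 0 < η) {Q : Measure Ω} [IsFiniteMeasure Q] (hQ : Q ≪ P) :
    Tendsto (fun N => Q (badSet (fun i => drifted W μ (gridTime T N i)) b η (N + 1)))
      atTop (𝓝 0) := by
  have h := tendsto_measure_of_ae_tendsto_indicator_of_isFiniteMeasure (μ := Q) (L := atTop)
    (A := ∅) (As := fun N => badSet (fun i => drifted W μ (gridTime T N i)) b η (N + 1))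
    MeasurableSet.empty
    (fun N => measurableSet_badSet (fun i => measurable_drifted hWm μ _) b η (N + 1))
    (hQ.ae_le (by
      filter_upwards [hB.cont, hWB, hB.eval_zero_ae_eq_zero] with ω hc hω h0
      filter_upwards [eventually_gridTime_step_le (continuous_drifted hc μ) T hη] with N hN
      simp only [Set.mem_empty_iff_false, iff_false]
      have hd : ∀ i, drifted W μ (gridTime T N i) ω = drifted B μ (gridTime T N i) ω :=
        fun i => by simp only [drifted, hω N i]
      rintro (h | ⟨i, hi, h⟩)
      · simp only [hd] at h
        rw [gridTime_zero, drifted, h0] at h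
        simp at h
        linarith
      · simp only [hd] at h
        exact absurd (hN i hi) (not_le.2 h)))
  simpa using h

/-- The probability that a Brownian motion with drift reaches `-b` before `T` and is above `x`
at time `T`. -/
theorem measure_drifted_hit {B : ℝ≥0 → Ω → ℝ} (hB : IsBrownianReal B P) (μ : ℝ) {T : ℝ≥0}
    (hT : T ≠ 0) {b x : ℝ} (hb : 0 < b) (hbx : -b ≤ x) :
    NullMeasurableSet {ω | (∃ t ≤ T, drifted B μ t ω ≤ -b) ∧ x ≤ drifted B μ T ω} P ∧
    P {ω | (∃ t ≤ T, drifted B μ t ω ≤ -b) ∧ x ≤ drifted B μ T ω}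
      = ENNReal.ofReal (Real.exp (-2 * μ * b) * Phi ((μ * T - 2 * b - x) / √(T : ℝ))) := by
  have : IsProbabilityMeasure P := hB.isGaussianProcess.isProbabilityMeasure
  set S : Set Ω := {ω | (∃ t ≤ T, drifted B μ t ω ≤ -b) ∧ x ≤ drifted B μ T ω} with hS
  -- The variables `B t` are only almost everywhere measurable. The measurable versions agree with
  -- them almost surely at the countably many grid times, and paths are always taken from `B`.
  set W : ℝ≥0 → Ω → ℝ := fun t => (hB.aemeasurable t).mk (B t) with hWdef
  have hWm : ∀ t, Measurable (W t) := fun t => (hB.aemeasurable t).measurable_mk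
  have hWB0 : ∀ t, B t =ᵐ[P] W t := fun t => (hB.aemeasurable t).ae_eq_mk
  have hW : IsPreBrownianReal W P := hB.toIsPreBrownianReal.congr hWB0
  have hWB : ∀ᵐ ω ∂P, ∀ N i, W (gridTime T N i) ω = B (gridTime T N i) ω :=
    ae_all_iff.2 fun N => ae_all_iff.2 fun i => (hWB0 _).symm
  set H : ℕ → ℝ → Set Ω := fun N c => hitSet (fun i => drifted W μ (gridTime T N i)) c (N + 1)
    with hH
  have hHm : ∀ N c, MeasurableSet (H N c) := fun N c =>
    measurableSet_hitSet (fun i => measurable_drifted hWm μ _) c (N + 1)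
  set g : ℝ → ℝ → ℝ := fun c y => Real.exp (-2 * μ * c) * Phi ((μ * T - 2 * c - y) / √(T : ℝ))
    with hg
  have hg0 : ∀ c y, 0 ≤ g c y := fun c y => mul_nonneg (Real.exp_pos _).le (Phi_nonneg _)
  have hrefl : ∀ c y, reflMeasure P μ c (drifted W μ T) {ω | drifted W μ T ω ≤ -2 * c - y}
      = ENNReal.ofReal (g c y) := by
    intro c y
    rw [reflMeasure_Iic (measurable_drifted hWm μ T) hT (map_drifted hW μ T)]
    congr 3
    ring_nf
  have hgood : ∀ᵐ ω ∂P, Continuous (B · ω) ∧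
      (∀ N i, drifted W μ (gridTime T N i) ω = drifted B μ (gridTime T N i) ω) ∧
      drifted W μ T ω = drifted B μ T ω := by
    filter_upwards [hB.cont, hWB, hWB0 T] with ω h1 h2 h3
    exact ⟨h1, fun N i => by simp only [drifted, h2 N i], by simp only [drifted, h3]⟩
  have hup : ∀ {ω}, Continuous (B · ω) →
      (∀ N i, drifted W μ (gridTime T N i) ω = drifted B μ (gridTime T N i) ω) →
      (∃ t ≤ T, drifted B μ t ω ≤ -b) → ∀ c < b, ∀ᶠ N in atTop, ω ∈ H N c := by
    rintro ω h1 h2 ⟨s, hs, hsb⟩ c hc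
    filter_upwards [eventually_exists_gridTime_le (continuous_drifted h1 μ) hT hs hsb
      (neg_lt_neg hc)] with N hN
    obtain ⟨i, hi, h⟩ := hN
    exact ⟨i, hi, by simpa only [h2 N i] using h⟩
  have hdown : ∀ {ω}, (∀ N i, drifted W μ (gridTime T N i) ω = drifted B μ (gridTime T N i) ω) →
      ∀ N c, ω ∈ H N c → ∃ t ≤ T, drifted B μ t ω ≤ -c := by
    rintro ω h2 N c ⟨i, hi, h⟩
    exact ⟨gridTime T N i, gridTime_le T hi, by simpa only [h2 N i] using h⟩
  constructor
  · have hmeas : MeasurableSet ((⋂ k : ℕ, ⋃ N, H N (b - 1 / ((k : ℝ) + 1)))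
        ∩ {ω | x ≤ drifted W μ T ω}) :=
      (MeasurableSet.iInter fun k => MeasurableSet.iUnion fun N => hHm N _).inter
        (measurableSet_le measurable_const (measurable_drifted hWm μ T))
    refine hmeas.nullMeasurableSet.congr ?_
    filter_upwards [hgood] with ω ⟨h1, h2, h3⟩
    apply propext
    change (ω ∈ (⋂ k : ℕ, ⋃ N, H N (b - 1 / ((k : ℝ) + 1))) ∧ x ≤ drifted W μ T ω) ↔
      ((∃ t ≤ T, drifted B μ t ω ≤ -b) ∧ x ≤ drifted B μ T ω)
    rw [h3]
    refine and_congr_left fun _ => ?_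
    simp only [Set.mem_iInter, Set.mem_iUnion]
    constructor
    · intro h
      obtain ⟨s, hs, hmin⟩ := (isCompact_Icc (a := (0 : ℝ≥0)) (b := T)).exists_isMinOn
        ⟨0, le_rfl, zero_le⟩ (continuous_drifted h1 μ).continuousOn
      refine ⟨s, hs.2, ?_⟩
      have hk : ∀ k : ℕ, drifted B μ s ω ≤ -b + 1 / ((k : ℝ) + 1) := by
        intro k
        obtain ⟨N, hN⟩ := h k
        obtain ⟨t, ht, hle⟩ := hdown h2 N _ hN
        have := hmin (show t ∈ Set.Icc 0 T from ⟨zero_le, ht⟩)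
        have h5 : drifted B μ s ω ≤ drifted B μ t ω := this
        linarith
      have hlim := (tendsto_one_div_add_atTop_nhds_zero_nat (𝕜 := ℝ)).const_add (-b)
      rw [add_zero] at hlim
      exact ge_of_tendsto' hlim hk
    · intro h k
      exact (hup h1 h2 h (b - 1 / ((k : ℝ) + 1)) (by
        have : (0 : ℝ) < 1 / ((k : ℝ) + 1) := by positivity
        linarith)).exists
  -- The barrier is raised to `-(b - η)`, since a path that touches `-b` between grid points visits
  -- the raised barrier on all fine grids. The increasing sets `F M` collect the paths that do so
  -- from the grid `M` onwards.
  · have hupper : ∀ η, 0 < η → η < b →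
        P S ≤ ENNReal.ofReal (Real.exp (2 * |μ| * η) * g (b - η) x) := by
      intro η hη hηb
      set C : Set Ω := {ω | x ≤ drifted W μ T ω}
      set F : ℕ → Set Ω := fun M => {ω | (∀ N, M ≤ N → ω ∈ H N (b - η)) ∧ ω ∈ C}
      have hFmono : Monotone F := fun M M' hMM' ω hω => ⟨fun N hN => hω.1 N (hMM'.trans hN), hω.2⟩
      have hFle : ∀ M, P (F M) ≤ ENNReal.ofReal (Real.exp (2 * |μ| * η) * g (b - η) x) := by
        intro M
        have hbad := tendsto_measure_badSet hB hWm hWB μ (b := b - η) (by linarith) hη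
          (Measure.AbsolutelyContinuous.refl P)
        have hlim := hbad.const_add (ENNReal.ofReal (Real.exp (2 * |μ| * η) * g (b - η) x))
        rw [add_zero] at hlim
        refine ge_of_tendsto hlim ?_
        filter_upwards [eventually_ge_atTop M] with N hN
        have h1 := measure_hitSet_le hW hWm μ (gridTime_mono T N) (gridTime_last T N) (b - η) η x
        rw [hrefl, ← ENNReal.ofReal_mul (Real.exp_pos _).le] at h1
        have h2 : F M ⊆ H N (b - η) ∩ C := fun ω hω => ⟨hω.1 N hN, hω.2⟩
        exact (measure_mono h2).trans h1
      have hsub : P S ≤ P (⋃ M, F M) := by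
        refine measure_mono_ae ?_
        filter_upwards [hgood] with ω ⟨h1, h2, h3⟩ hω
        obtain ⟨M, hM⟩ := eventually_atTop.1 (hup h1 h2 hω.1 (b - η) (by linarith))
        exact Set.mem_iUnion.2 ⟨M, hM, by
          change x ≤ drifted W μ T ω
          rw [h3]; exact hω.2⟩
      rw [hFmono.measure_iUnion] at hsub
      exact hsub.trans (iSup_le hFle)
    -- A visit on the grid is a visit of the path, so the barrier stays at `-b`; starting from `x +
    -- 2 * η` compensates the loss `2 * η`.
    have hlower : ∀ η, 0 < η → ENNReal.ofReal (g b (x + 2 * η))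
        ≤ ENNReal.ofReal (Real.exp (2 * |μ| * η)) * P S := by
      intro η hη
      have := isFiniteMeasure_reflMeasure (measurable_drifted hWm μ T) (map_drifted hW μ T) b
      have hbad := tendsto_measure_badSet hB hWm hWB μ hb hη
        (Q := reflMeasure P μ b (drifted W μ T)) (withDensity_absolutelyContinuous _ _)
      have hlim := hbad.const_add (ENNReal.ofReal (Real.exp (2 * |μ| * η)) * P S)
      rw [add_zero] at hlim
      refine ge_of_tendsto' hlim fun N => ?_
      have h1 := reflMeasure_le_hitSet hW hWm μ (gridTime_mono T N) (gridTime_last T N)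
        (b := b) (η := η) (x := x + 2 * η) (by linarith)
      rw [hrefl, add_sub_cancel_right] at h1
      refine h1.trans ?_
      refine add_le_add (mul_le_mul' le_rfl (measure_mono_ae ?_)) le_rfl
      filter_upwards [hgood] with ω ⟨_, h2, h3⟩ hω
      refine ⟨hdown h2 N b hω.1, ?_⟩
      rw [← h3]
      exact hω.2
    have hPhi := continuous_Phi
    apply le_antisymm
    · have hcont : Continuous fun η : ℝ =>
          ENNReal.ofReal (Real.exp (2 * |μ| * η) * g (b - η) x) := by
        refine ENNReal.continuous_ofReal.comp ?_
        simp only [hg]; fun_prop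
      have hlim := (hcont.tendsto 0).mono_left (nhdsWithin_le_nhds (s := Set.Ioi 0))
      simp only [mul_zero, Real.exp_zero, one_mul, sub_zero] at hlim
      refine ge_of_tendsto hlim ?_
      filter_upwards [Ioo_mem_nhdsGT hb] with η hη using hupper η hη.1 hη.2
    · have hcont : Continuous fun η : ℝ => ENNReal.ofReal (g b (x + 2 * η)) := by
        refine ENNReal.continuous_ofReal.comp ?_
        simp only [hg]; fun_prop
      have hlim := (hcont.tendsto 0).mono_left (nhdsWithin_le_nhds (s := Set.Ioi 0))
      simp only [mul_zero, add_zero] at hlim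
      have hcont' : Continuous fun η : ℝ => ENNReal.ofReal (Real.exp (2 * |μ| * η)) :=
        ENNReal.continuous_ofReal.comp (by fun_prop)
      have hlim' := ENNReal.Tendsto.mul_const
        ((hcont'.tendsto 0).mono_left (nhdsWithin_le_nhds (s := Set.Ioi 0)))
        (Or.inr (measure_ne_top P S))
      simp only [mul_zero, Real.exp_zero, ENNReal.ofReal_one, one_mul] at hlim'
      refine le_of_tendsto_of_tendsto hlim hlim' ?_
      filter_upwards [self_mem_nhdsWithin] with η hη using hlower η hη

end DigitalBarrier
end

noncomputable section
namespace DigitalBarrier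
open Params (Phi phi)
open scoped Topology ENNReal

/-! ### The Black-Scholes prices -/

namespace Params

variable {m : Params} {Ω : Type*} {B : ℝ≥0 → Ω → ℝ}

/-- The drift of the logarithm of the stock price in units of the volatility. -/
def drift (m : Params) : ℝ := (m.r - m.σ ^ 2 / 2) / m.σ

lemma stock_eq_exp_drifted (hσ : 0 < m.σ) (t : ℝ≥0) (ω : Ω) :
    m.stock B t ω = m.s₀ * Real.exp (m.σ * drifted B m.drift t ω) := by
  rw [stock, drifted, drift]
  congr 2
  field_simp

lemma stock_le_iff (hs₀ : 0 < m.s₀) (hL : 0 < m.L) (hσ : 0 < m.σ) (t : ℝ≥0) (ω : Ω) :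
    m.stock B t ω ≤ m.L ↔ drifted B m.drift t ω ≤ -(Real.log (m.s₀ / m.L) / m.σ) := by
  have h : -(Real.log (m.s₀ / m.L) / m.σ) = Real.log (m.L / m.s₀) / m.σ := by
    rw [← neg_div, ← Real.log_inv, inv_div]
  rw [h, le_div_iff₀ hσ, Real.le_log_iff_exp_le (by positivity), le_div_iff₀ hs₀,
    stock_eq_exp_drifted hσ, mul_comm m.σ, mul_comm m.s₀]

lemma strike_le_stock_iff (hs₀ : 0 < m.s₀) (hK : 0 < m.K) (hσ : 0 < m.σ) (t : ℝ≥0) (ω : Ω) :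
    m.K ≤ m.stock B t ω ↔ Real.log (m.K / m.s₀) / m.σ ≤ drifted B m.drift t ω := by
  rw [div_le_iff₀ hσ, Real.log_le_iff_le_exp (by positivity), div_le_iff₀ hs₀,
    stock_eq_exp_drifted hσ, mul_comm m.σ, mul_comm m.s₀]

lemma stockInf_le_iff {ω : Ω} (hω : Continuous (B · ω)) (x : ℝ) :
    m.stockInf B ω ≤ x ↔ ∃ t ≤ m.T.toNNReal, m.stock B t ω ≤ x := by
  have hcont : Continuous fun t : ℝ≥0 => m.stock B t ω := by unfold stock; fun_prop
  have hcomp : IsCompact ((fun t : ℝ≥0 => m.stock B t ω) '' Set.Icc 0 m.T.toNNReal) :=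
    isCompact_Icc.image hcont
  constructor
  · intro h
    obtain ⟨t, ht, hte⟩ := hcomp.sInf_mem ⟨_, 0, ⟨le_rfl, zero_le⟩, rfl⟩
    refine ⟨t, ht.2, ?_⟩
    simp only at hte
    rw [hte]
    exact h
  · rintro ⟨t, ht, hx⟩
    exact (csInf_le hcomp.bddBelow ⟨t, ⟨zero_le, ht⟩, rfl⟩).trans hx

variable [MeasurableSpace Ω] {P : Measure Ω}

lemma payoffDI_set_ae_eq (hs₀ : 0 < m.s₀) (hL : 0 < m.L) (hLK : m.L < m.K) (hσ : 0 < m.σ)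
    (hB : IsBrownianReal B P) :
    ({ω | m.K ≤ m.stock B m.T.toNNReal ω ∧ m.stockInf B ω ≤ m.L} : Set Ω) =ᵐ[P]
      {ω | (∃ t ≤ m.T.toNNReal, drifted B m.drift t ω ≤ -(Real.log (m.s₀ / m.L) / m.σ))
        ∧ Real.log (m.K / m.s₀) / m.σ ≤ drifted B m.drift m.T.toNNReal ω} := by
  filter_upwards [hB.cont] with ω hω
  apply propext
  change (m.K ≤ m.stock B m.T.toNNReal ω ∧ m.stockInf B ω ≤ m.L) ↔
    ((∃ t ≤ m.T.toNNReal, drifted B m.drift t ω ≤ -(Real.log (m.s₀ / m.L) / m.σ))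
      ∧ Real.log (m.K / m.s₀) / m.σ ≤ drifted B m.drift m.T.toNNReal ω)
  rw [stockInf_le_iff hω, strike_le_stock_iff hs₀ (hL.trans hLK) hσ, and_comm]
  simp only [stock_le_iff hs₀ hL hσ]

lemma payoffDI_set (hs₀ : 0 < m.s₀) (hL : 0 < m.L) (hLs₀ : m.L < m.s₀) (hLK : m.L < m.K)
    (hσ : 0 < m.σ) (hT : 0 < m.T) (hB : IsBrownianReal B P) :
    NullMeasurableSet {ω | m.K ≤ m.stock B m.T.toNNReal ω ∧ m.stockInf B ω ≤ m.L} P ∧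
    P {ω | m.K ≤ m.stock B m.T.toNNReal ω ∧ m.stockInf B ω ≤ m.L}
      = ENNReal.ofReal (m.rho * Phi m.d22) := by
  have hK := hL.trans hLK
  have hsT : 0 < √m.T := Real.sqrt_pos.2 hT
  have hT2 : √m.T ^ 2 = m.T := Real.sq_sqrt hT.le
  have hb : 0 < Real.log (m.s₀ / m.L) / m.σ := div_pos (Real.log_pos ((one_lt_div hL).2 hLs₀)) hσ
  have hbx : -(Real.log (m.s₀ / m.L) / m.σ) ≤ Real.log (m.K / m.s₀) / m.σ := by
    rw [← neg_div, ← Real.log_inv, inv_div]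
    gcongr
  have hae := payoffDI_set_ae_eq (P := P) hs₀ hL hLK hσ hB
  obtain ⟨h1, h2⟩ := measure_drifted_hit hB m.drift (T := m.T.toNNReal)
    (Real.toNNReal_pos.2 hT).ne' hb hbx
  refine ⟨h1.congr hae.symm, ?_⟩
  rw [measure_congr hae, h2, Real.coe_toNNReal _ hT.le, rho_eq hs₀ hL hσ hT,
    d22_eq hs₀ hL hLK hσ hT]
  have hlog : Real.log (m.K / m.s₀) = -Real.log (m.s₀ / m.K) := by rw [← Real.log_inv, inv_div]
  rw [hlog, alpha, drift]
  generalize Real.log (m.s₀ / m.K) = k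
  generalize Real.log (m.s₀ / m.L) = l
  congr 3
  · field_simp
  · nth_rewrite 1 [← hT2]
    field_simp
    ring

lemma strike_set (hs₀ : 0 < m.s₀) (hK : 0 < m.K) (hσ : 0 < m.σ) (hT : 0 < m.T)
    (hB : IsBrownianReal B P) :
    NullMeasurableSet {ω | m.K ≤ m.stock B m.T.toNNReal ω} P ∧
    P {ω | m.K ≤ m.stock B m.T.toNNReal ω} = ENNReal.ofReal (Phi m.d12) := by
  have hsT : 0 < √m.T := Real.sqrt_pos.2 hT
  have hT2 : √m.T ^ 2 = m.T := Real.sq_sqrt hT.le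
  have hset : {ω | m.K ≤ m.stock B m.T.toNNReal ω}
      = drifted B m.drift m.T.toNNReal ⁻¹' Set.Ici (Real.log (m.K / m.s₀) / m.σ) := by
    ext ω
    simp only [Set.mem_ofPred_eq, Set.mem_preimage, Set.mem_Ici]
    exact strike_le_stock_iff hs₀ hK hσ _ _
  have hmeas : AEMeasurable (drifted B m.drift m.T.toNNReal) P :=
    (hB.aemeasurable m.T.toNNReal).const_add _
  rw [hset]
  refine ⟨hmeas.nullMeasurable measurableSet_Ici, ?_⟩
  rw [← Measure.map_apply_of_aemeasurable hmeas measurableSet_Ici,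
    map_drifted hB.toIsPreBrownianReal, gaussianReal_Ici _ (Real.toNNReal_pos.2 hT).ne',
    Real.coe_toNNReal _ hT.le, d12_eq hσ hT]
  have hlog : Real.log (m.K / m.s₀) = -Real.log (m.s₀ / m.K) := by rw [← Real.log_inv, inv_div]
  rw [hlog, alpha, drift]
  generalize Real.log (m.s₀ / m.K) = k
  congr 2
  nth_rewrite 1 [← hT2]
  field_simp
  ring

/-- The Black-Scholes price of the down-and-in digital call. -/
lemma priceBSDI_eq (hs₀ : 0 < m.s₀) (hL : 0 < m.L) (hLs₀ : m.L < m.s₀) (hLK : m.L < m.K)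
    (hσ : 0 < m.σ) (hT : 0 < m.T) (hB : IsBrownianReal B P) :
    m.priceBSDI P B = Real.exp (-m.r * m.T) * (m.rho * Phi m.d22) := by
  obtain ⟨h1, h2⟩ := payoffDI_set hs₀ hL hLs₀ hLK hσ hT hB
  have hρ : 0 ≤ m.rho * Phi m.d22 := by
    rw [rho_eq hs₀ hL hσ hT]
    exact mul_nonneg (Real.exp_pos _).le (Phi_nonneg _)
  rw [priceBSDI, payoffDI, integral_indicator₀ h1]
  simp [Measure.real, h2, hρ]

/-- The Black-Scholes prices of the two barrier options add up to the digital call. -/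
lemma priceBSDI_add_priceBSDO (hs₀ : 0 < m.s₀) (hL : 0 < m.L) (hLs₀ : m.L < m.s₀)
    (hLK : m.L < m.K) (hσ : 0 < m.σ) (hT : 0 < m.T) (hB : IsBrownianReal B P) :
    m.priceBSDI P B + m.priceBSDO P B = Real.exp (-m.r * m.T) * Phi m.d12 := by
  have : IsProbabilityMeasure P := hB.isGaussianProcess.isProbabilityMeasure
  obtain ⟨h1, -⟩ := payoffDI_set hs₀ hL hLs₀ hLK hσ hT hB
  obtain ⟨h3, h4⟩ := strike_set hs₀ (hL.trans hLK) hσ hT hB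
  -- Writing the down-and-out event as a difference gives its null-measurability and its probability
  -- from the two computed events.
  have hset : {ω | m.K ≤ m.stock B m.T.toNNReal ω ∧ m.L < m.stockInf B ω}
      = {ω | m.K ≤ m.stock B m.T.toNNReal ω}
        \ {ω | m.K ≤ m.stock B m.T.toNNReal ω ∧ m.stockInf B ω ≤ m.L} := by
    ext ω
    change (_ ∧ _) ↔ (_ ∧ ¬ (_ ∧ _))
    rw [not_and, not_le]
    exact ⟨fun h => ⟨h.1, fun _ => h.2⟩, fun h => ⟨h.1, h.2 h.1⟩⟩
  rw [priceBSDI, priceBSDO, payoffDI, payoffDO, ← mul_add, hset, integral_indicator₀ h1,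
    integral_indicator₀ (h3.diff h1)]
  simp only [Pi.one_apply, integral_const, smul_eq_mul, mul_one, measureReal_restrict_apply_univ]
  have hsub : {ω | m.K ≤ m.stock B m.T.toNNReal ω ∧ m.stockInf B ω ≤ m.L}
      ⊆ {ω | m.K ≤ m.stock B m.T.toNNReal ω} := fun ω hω => hω.1
  have hadd : P.real {ω | m.K ≤ m.stock B m.T.toNNReal ω ∧ m.stockInf B ω ≤ m.L}
      + P.real ({ω | m.K ≤ m.stock B m.T.toNNReal ω}
        \ {ω | m.K ≤ m.stock B m.T.toNNReal ω ∧ m.stockInf B ω ≤ m.L})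
      = P.real {ω | m.K ≤ m.stock B m.T.toNNReal ω} := by
    have h := measureReal_inter_add_sdiff₀ (μ := P) (s := {ω | m.K ≤ m.stock B m.T.toNNReal ω}) h1
    rwa [Set.inter_eq_right.2 hsub] at h
  rw [hadd, Measure.real, h4, ENNReal.toReal_ofReal (Phi_nonneg _)]

end Params

lemma eps_pow_three_eq (n : ℕ) : eps n ^ 3 = 1 / (n : ℝ) ^ (3 / 2 : ℝ) := by
  rw [eps, div_pow, one_pow, Real.sqrt_eq_rpow, ← Real.rpow_natCast, ← Real.rpow_mul (by positivity)]
  norm_num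

end DigitalBarrier
end

theorem theorem1 (m : DigitalBarrier.Params)
    (hs₀ : 0 < m.s₀) (hL : 0 < m.L) (hLs₀ : m.L < m.s₀) (hLK : m.L < m.K)
    (hr : 0 ≤ m.r) (hσ : 0 < m.σ) (hT : 0 < m.T)
    {Ω : Type*} [MeasurableSpace Ω] (P : Measure Ω)
    (B : ℝ≥0 → Ω → ℝ) (hB : IsBrownianReal B P) :
    ((fun n : ℕ => (m.priceCRRDI n - m.priceBSDI P B) - m.expansionDI n)
        =O[atTop] fun n : ℕ => 1 / (n : ℝ) ^ (3 / 2 : ℝ)) ∧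
    ((fun n : ℕ => (m.priceCRRDO n - m.priceBSDO P B) - m.expansionDO n)
        =O[atTop] fun n : ℕ => 1 / (n : ℝ) ^ (3 / 2 : ℝ)) := by
  have hDI := DigitalBarrier.Params.isBigO_priceCRRDI hs₀ hL hLs₀ hLK hσ hT
  have hsum := DigitalBarrier.Params.isBigO_priceCRR_sum hs₀ (hL.trans hLK) hσ hT
  have hBSDI := DigitalBarrier.Params.priceBSDI_eq hs₀ hL hLs₀ hLK hσ hT hB
  have hBS := DigitalBarrier.Params.priceBSDI_add_priceBSDO hs₀ hL hLs₀ hLK hσ hT hB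
  simp only [← DigitalBarrier.eps_pow_three_eq]
  rw [← hBSDI] at hDI
  rw [← hBS] at hsum
  -- The down-and-out error is that of the plain digital call minus that of the down-and-in.
  exact ⟨hDI, (hsum.sub hDI).congr_left fun n => by ring⟩
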